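/- Let $G=(V,E)$ be a connected simple graph with $n$ vertices, $m$ edges and maximum degree $\Delta$. Two edges dominate each other if they share an endpoint. A set $F\subseteq E$ is a connected edge dominating set of $G$ if every edge of $G$ is dominated by an edge of $F$ and the subgraph $G[F]$, formed by the edges of $F$ and their endpoints, is connected; it is minimal if for every $f\in F$ the set $F\setminus\{f\}$ is not a connected edge dominating set. Theorem. There is an algorithm that, for every connected simple graph $G$ in which every connected edge dominating set has at least two edges, given as a list of its edges, outputs every minimal connected edge dominating set of $G$ exactly once and nothing else, and then halts, with delay $O(nm^2\Delta)$ and exponential space. More precisely, there are a single program of a random access machine (unit-cost addition, truncated subtraction, tests, and indirect memory access) and a constant $C$ such that on every such input the time until the first output is completed, the time between the completions of any two consecutive outputs, and the time from the last completion until the machine halts are all at most $C\,nm^2\Delta$, and all memory addresses and all numbers used during the run are smaller than $2^{Cm}$. -/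

import Mathlib

/-! ### Connected edge dominating sets -/

section Domination

variable {V : Type*}

/-- Two edges dominate each other when they share an endpoint. -/
def EdgeDominates (e f : Sym2 V) : Prop := ∃ v, v ∈ e ∧ v ∈ f

/-- `F` is a set of edges of `G` such that every edge of `G` is dominated by an edge of `F`. -/
def IsEdgeDominatingSet (G : SimpleGraph V) (F : Finset (Sym2 V)) : Prop :=
  (↑F : Set (Sym2 V)) ⊆ G.edgeSet ∧ ∀ f ∈ G.edgeSet, ∃ e ∈ F, EdgeDominates e f

/-- The subgraph with edge set `F` whose vertices are the endpoints of the edges of `F` is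
connected: any two of its vertices are joined by a path using edges of `F` only. -/
def EdgeInducedConnected (F : Finset (Sym2 V)) : Prop :=
  ∀ u v : V, (∃ e ∈ F, u ∈ e) → (∃ e ∈ F, v ∈ e) →
    (SimpleGraph.fromEdgeSet (↑F : Set (Sym2 V))).Reachable u v

/-- Connected edge dominating sets of `G`. -/
def IsCEDS (G : SimpleGraph V) (F : Finset (Sym2 V)) : Prop :=
  IsEdgeDominatingSet G F ∧ EdgeInducedConnected F

/-- Minimal connected edge dominating sets: no single edge can be dropped. -/
def IsMinimalCEDS [DecidableEq V] (G : SimpleGraph V) (F : Finset (Sym2 V)) : Prop :=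
  IsCEDS G F ∧ ∀ f ∈ F, ¬ IsCEDS G (F.erase f)

end Domination

/-! ### A random access machine with a clock and an output log

Programs are structured programs over finitely many registers and a memory whose cells are
addressed indirectly. Arithmetic is addition and truncated subtraction; each operation, memory
access, test, and printed word costs one unit of time. -/

namespace RAM

/-- Expressions; `load a` is the content of the memory cell with address `a`. -/
inductive Expr : Type
  | const (k : ℕ)
  | reg (r : ℕ)
  | add (a b : Expr)
  | sub (a b : Expr)
  | load (a : Expr)

/-- Commands. `print e` prints one word, `endLine` terminates the line printed so far,
`ite` and `loop` test whether an expression is nonzero. -/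
inductive Cmd : Type
  | skip
  | assign (r : ℕ) (e : Expr)
  | store (a e : Expr)
  | print (e : Expr)
  | endLine
  | seq (c d : Cmd)
  | ite (e : Expr) (c d : Cmd)
  | loop (e : Expr) (c : Cmd)

/-- Configurations: registers, memory, the clock, the words printed since the last completed
line, and the completed lines in order, each with the time of its completion. -/
structure Config where
  reg : ℕ → ℕ
  mem : ℕ → ℕ
  time : ℕ
  line : List ℕ
  log : List (ℕ × List ℕ)

namespace Expr

/-- The value of an expression. -/
def val (s : Config) : Expr → ℕ
  | const k => k
  | reg r => s.reg r
  | add a b => a.val s + b.val s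
  | sub a b => a.val s - b.val s
  | load a => s.mem (a.val s)

/-- The number of operations in an expression. -/
def cost : Expr → ℕ
  | const _ => 1
  | reg _ => 1
  | add a b => a.cost + b.cost + 1
  | sub a b => a.cost + b.cost + 1
  | load a => a.cost + 1

/-- All values and addresses that occur while the expression is evaluated are below `B`. -/
def Fits (B : ℕ) (s : Config) : Expr → Prop
  | const k => k < B
  | reg r => s.reg r < B
  | add a b => a.Fits B s ∧ b.Fits B s ∧ a.val s + b.val s < B
  | sub a b => a.Fits B s ∧ b.Fits B s
  | load a => a.Fits B s ∧ s.mem (a.val s) < B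

end Expr

/-- Let the clock advance by `t`. -/
def Config.tick (s : Config) (t : ℕ) : Config :=
  ⟨s.reg, s.mem, s.time + t, s.line, s.log⟩

/-- Write `v` into register `r`. -/
def Config.setReg (s : Config) (r v : ℕ) : Config :=
  ⟨Function.update s.reg r v, s.mem, s.time, s.line, s.log⟩

/-- Write `v` into the memory cell with address `a`. -/
def Config.setMem (s : Config) (a v : ℕ) : Config :=
  ⟨s.reg, Function.update s.mem a v, s.time, s.line, s.log⟩

/-- Append the word `v` to the current line. -/
def Config.putWord (s : Config) (v : ℕ) : Config :=
  ⟨s.reg, s.mem, s.time, s.line ++ [v], s.log⟩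

/-- Complete the current line and record it with the present time. -/
def Config.closeLine (s : Config) : Config :=
  ⟨s.reg, s.mem, s.time, [], s.log ++ [(s.time, s.line)]⟩

/-- `Exec B c s s'`: started in `s`, the command `c` halts in `s'`, and every value computed and
every memory address accessed on the way is below `B`. So, apart from the finitely many registers
that occur in `c`, the run uses at most `B` memory cells, and all numbers it handles are
below `B`. A run that would exceed the bound has no derivation. -/
inductive Exec (B : ℕ) : Cmd → Config → Config → Prop
  | skip (s : Config) : Exec B .skip s (s.tick 1)
  | assign (s : Config) (r : ℕ) (e : Expr) (he : e.Fits B s) :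
      Exec B (.assign r e) s ((s.setReg r (e.val s)).tick (e.cost + 1))
  | store (s : Config) (a e : Expr) (ha : a.Fits B s) (he : e.Fits B s) :
      Exec B (.store a e) s ((s.setMem (a.val s) (e.val s)).tick (a.cost + e.cost + 1))
  | print (s : Config) (e : Expr) (he : e.Fits B s) :
      Exec B (.print e) s ((s.putWord (e.val s)).tick (e.cost + 1))
  | endLine (s : Config) : Exec B .endLine s (s.tick 1).closeLine
  | seq {s s' s'' : Config} {c d : Cmd} (hc : Exec B c s s') (hd : Exec B d s' s'') :
      Exec B (.seq c d) s s''
  | ite_true {s s' : Config} {e : Expr} {c d : Cmd} (he : e.Fits B s) (h : e.val s ≠ 0)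
      (hc : Exec B c (s.tick (e.cost + 1)) s') : Exec B (.ite e c d) s s'
  | ite_false {s s' : Config} {e : Expr} {c d : Cmd} (he : e.Fits B s) (h : e.val s = 0)
      (hd : Exec B d (s.tick (e.cost + 1)) s') : Exec B (.ite e c d) s s'
  | loop_true {s s' s'' : Config} {e : Expr} {c : Cmd} (he : e.Fits B s) (h : e.val s ≠ 0)
      (hc : Exec B c (s.tick (e.cost + 1)) s') (hl : Exec B (.loop e c) s' s'') :
      Exec B (.loop e c) s s''
  | loop_false {s : Config} {e : Expr} {c : Cmd} (he : e.Fits B s) (h : e.val s = 0) :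
      Exec B (.loop e c) s (s.tick (e.cost + 1))

/-- Initial configuration: the memory holds the input word by word from address `0` on, followed
by zeros; the registers are zero, and nothing has been printed. -/
def Config.init (input : List ℕ) : Config where
  reg := fun _ => 0
  mem := fun a => input.getD a 0
  time := 0
  line := []
  log := []

/-- The delay of a finished run is at most `D`: the first line is completed by time `D`, at most
`D` time units pass between the completions of consecutive lines, and the run halts at most `D`
time units after the last completion. -/
def Config.DelayAtMost (s : Config) (D : ℕ) : Prop :=
  List.IsChain (fun t t' => t' ≤ t + D) (0 :: (s.log.map Prod.fst ++ [s.time]))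

end RAM

/-! ### Graphs as inputs, edge sets as outputs -/

section Encoding

variable {n : ℕ}

/-- `L` lists the edges of `G`, each exactly once, in any order, each as a pair of endpoints in
either order. -/
def IsEdgeListing (G : SimpleGraph (Fin n)) (L : List (Fin n × Fin n)) : Prop :=
  (L.map fun p => s(p.1, p.2)).Nodup ∧ ∀ e, e ∈ L.map (fun p => s(p.1, p.2)) ↔ e ∈ G.edgeSet

/-- The input words: the number of vertices, the number of edges, and the endpoints of the
edges one after the other. -/
def graphInput (L : List (Fin n × Fin n)) : List ℕ :=
  n :: L.length :: L.flatMap fun p => [(p.1 : ℕ), (p.2 : ℕ)]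

/-- The printed line `w` consists of the positions in `L` of the edges of `F`, each printed
exactly once. -/
def PrintsEdgeSet (L : List (Fin n × Fin n)) (w : List ℕ) (F : Finset (Sym2 (Fin n))) : Prop :=
  w.Nodup ∧ (∀ i ∈ w, i < L.length) ∧
    ∀ e, e ∈ F ↔ ∃ i ∈ w, (L.map fun p => s(p.1, p.2))[i]? = some e

/-- The run ending in `s` has printed every minimal connected edge dominating set of `G`
exactly once, one per line, and nothing else. -/
def EnumeratesMinimalCEDS (G : SimpleGraph (Fin n)) (L : List (Fin n × Fin n))
    (s : RAM.Config) : Prop :=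
  s.line = [] ∧ ∃ sols : List (Finset (Sym2 (Fin n))),
    sols.Nodup ∧ (∀ F, F ∈ sols ↔ IsMinimalCEDS G F) ∧
      List.Forall₂ (PrintsEdgeSet L) (s.log.map Prod.snd) sols

end Encoding

/-! Domination means that the endpoints of the edges of `F` form a vertex cover. An edge of `F` on a
cycle can be dropped, and so can the edge at a leaf all of whose neighbours are touched. Since every
solution has at least two edges, the minimal connected edge dominating sets are exactly the subtrees
that cover `G` and each of whose leaves has a neighbour outside the tree (`IsMinimalCEDS.isSubtree`,
`IsMinimalCEDS.leaf`, `isMinimalCEDS_of_leaves`). Every covering subtree can be pruned to such a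
tree in a single pass over the vertices (`prune_spec`).

The solutions are the nodes of a directed graph that is searched. Two kinds of moves start at a
solution `X`, each followed by pruning. A leaf move drops a leaf `v` and hangs every outside
neighbour of `v` on a tree vertex other than `v`. An exchange move removes a tree edge and rejoins
the two parts by one edge, or by a path of length two through an outside vertex.

By `of_moveClosed`, moves lead from any solution to any solution `T`. If a leaf `v` of `X` is not in
`T`, then all neighbours of `v` are in `T`, and the leaf move at `v` lowers the number of vertices
of `X` outside `T`. Otherwise `T` contains all leaves of `X`. For an edge `f` of `X` outside `T`,
both parts of `X` without `f` contain leaves, so `T` joins the two parts. Two vertices outside the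
cover `X` are never adjacent, so `T` crosses by an edge or by a path of length two, and exchanging
`f` for it lowers the number of edges outside `T` without adding vertices outside `T`.

A table indexed by the `2 ^ m` binary codes of edge sets holds both the visited marks and the links
of the stack, so a set is looked up and stored in time `O(m)`. Each solution is printed when it is
popped, and then its moves are made. For exchanges there are at most `n` tree edges, `2 * m`
half-edges that enter the marked part, at most `Δ` continuations, and `O(m)` time per candidate,
which gives the delay; leaf moves are cheaper (`moves_spec`).

The programs are written in a loop language with a total semantics `AC.den` and Hoare triples
`AC.Run`. `AC.simulate` transfers them to the machine, each counted step paying for a constant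
amount of machine time. -/

set_option linter.constructorNameAsVariable false
set_option linter.unusedSectionVars false

/-! ### A total loop language with named registers and arrays, compiled to the machine -/

namespace RAM

/-- Named registers. -/
inductive Reg : Type
  | M | N | top | full | code | root | flag | c | u | w | h | g | e | q
  | i | iq | j | jq | k | kq | l | lq | v | vq | p | pq | s | sq
  deriving DecidableEq

/-- Named arrays; `inp` is the (read only) input. -/
inductive Arr : Type
  | inp | en | op | ei | st | ad | xs | dx | ys | dy | mk | al | tb
  deriving DecidableEq

/-- The number of a register. -/
def Reg.idx : Reg → ℕ
  | M => 0 | N => 1 | top => 2 | full => 3 | code => 4 | root => 5 | flag => 6 | c => 7 | u => 8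
  | w => 9 | h => 10 | g => 11 | e => 12 | q => 13 | i => 14 | iq => 15 | j => 16 | jq => 17
  | k => 18 | kq => 19 | l => 20 | lq => 21 | v => 22 | vq => 23 | p => 24 | pq => 25 | s => 26
  | sq => 27

/-- The residue of the addresses of an array. -/
def Arr.idx : Arr → ℕ
  | inp => 0 | en => 1 | op => 2 | ei => 3 | st => 4 | ad => 5 | xs => 6 | dx => 7 | ys => 8
  | dy => 9 | mk => 10 | al => 11 | tb => 12

theorem Reg.idx_injective : Function.Injective Reg.idx := by
  intro a b h; cases a <;> cases b <;> first | rfl | cases h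

theorem Arr.idx_injective : Function.Injective Arr.idx := by
  intro a b h; cases a <;> cases b <;> first | rfl | cases h

theorem Arr.idx_lt (a : Arr) : a.idx < 16 := by cases a <;> decide

/-- Abstract machine states: registers, arrays, the current line, and a step counter. -/
structure Store where
  reg : Reg → ℕ
  arr : Arr → ℕ → ℕ
  line : List ℕ
  clk : ℕ

namespace Store

/-- Write a register. -/
def set (σ : Store) (r : Reg) (x : ℕ) : Store := ⟨Function.update σ.reg r x, σ.arr, σ.line, σ.clk⟩

/-- Write an array entry. -/
def put (σ : Store) (a : Arr) (i x : ℕ) : Store :=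
  ⟨σ.reg, Function.update σ.arr a (Function.update (σ.arr a) i x), σ.line, σ.clk⟩

/-- Append a word to the line. -/
def word (σ : Store) (x : ℕ) : Store := ⟨σ.reg, σ.arr, σ.line ++ [x], σ.clk⟩

/-- Count steps. -/
def tick (σ : Store) (t : ℕ) : Store := ⟨σ.reg, σ.arr, σ.line, σ.clk + t⟩

variable (σ : Store) (r r' : Reg) (a a' : Arr) (i x t : ℕ)

@[simp] theorem set_reg : (σ.set r x).reg r' = if r' = r then x else σ.reg r' := by
  simp [set, Function.update_apply]
@[simp] theorem set_arr : (σ.set r x).arr = σ.arr := rfl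
@[simp] theorem set_line : (σ.set r x).line = σ.line := rfl
@[simp] theorem set_clk : (σ.set r x).clk = σ.clk := rfl
@[simp] theorem put_reg : (σ.put a i x).reg = σ.reg := rfl
@[simp] theorem put_arr : (σ.put a i x).arr a' =
    if a' = a then Function.update (σ.arr a) i x else σ.arr a' := by
  simp only [put, Function.update_apply]
@[simp] theorem put_line : (σ.put a i x).line = σ.line := rfl
@[simp] theorem put_clk : (σ.put a i x).clk = σ.clk := rfl
@[simp] theorem word_reg : (σ.word x).reg = σ.reg := rfl
@[simp] theorem word_arr : (σ.word x).arr = σ.arr := rfl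
@[simp] theorem word_line : (σ.word x).line = σ.line ++ [x] := rfl
@[simp] theorem word_clk : (σ.word x).clk = σ.clk := rfl
@[simp] theorem tick_reg : (σ.tick t).reg = σ.reg := rfl
@[simp] theorem tick_arr : (σ.tick t).arr = σ.arr := rfl
@[simp] theorem tick_line : (σ.tick t).line = σ.line := rfl
@[simp] theorem tick_clk : (σ.tick t).clk = σ.clk + t := rfl

/-- All registers and array entries are at most `K`. -/
def Bounded (K : ℕ) (σ : Store) : Prop :=
  1 ≤ K ∧ (∀ r, σ.reg r ≤ K) ∧ ∀ a i, σ.arr a i ≤ K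

variable {σ} {K : ℕ}

theorem Bounded.set (h : σ.Bounded K) (hx : x ≤ K) : (σ.set r x).Bounded K := by
  refine ⟨h.1, fun r' => ?_, h.2.2⟩
  rw [set_reg]; split_ifs
  exacts [hx, h.2.1 r']

theorem Bounded.put (h : σ.Bounded K) (hx : x ≤ K) : (σ.put a i x).Bounded K := by
  refine ⟨h.1, h.2.1, fun a' j => ?_⟩
  rw [put_arr]; split_ifs
  · rw [Function.update_apply]; split_ifs
    exacts [hx, h.2.2 _ _]
  · exact h.2.2 _ _

end Store

/-- Expressions over named registers and arrays. -/
inductive AE : Type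
  | const (x : ℕ)
  | reg (r : Reg)
  | add (a b : AE)
  | sub (a b : AE)
  | cell (k : Arr) (a : AE)

namespace AE

/-- The value of an expression. -/
def ev (σ : Store) : AE → ℕ
  | const x => x
  | reg r => σ.reg r
  | add a b => a.ev σ + b.ev σ
  | sub a b => a.ev σ - b.ev σ
  | cell k a => σ.arr k (a.ev σ)

/-- Only existing input words are read. -/
def Safe (σ : Store) : AE → Prop
  | const _ => True
  | reg _ => True
  | add a b => a.Safe σ ∧ b.Safe σ
  | sub a b => a.Safe σ ∧ b.Safe σ
  | cell k a => a.Safe σ ∧ (k = .inp → a.ev σ < 2 * σ.reg .M + 2)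

/-- The value is at most the bound of the state, for syntactic reasons. -/
def small : AE → Bool
  | const x => decide (x ≤ 1)
  | reg _ => true
  | cell _ _ => true
  | _ => false

/-- Machine code for the address of entry `x` of an array. -/
def addr (k : Arr) (x : Expr) : Expr :=
  let d : Expr → Expr := fun y => .add y y
  match k with
  | .inp => x
  | k => .add (d (d (d (d (.add x (.reg 0)))))) (.const k.idx)

/-- Machine code of an expression. -/
def comp : AE → Expr
  | const x => .const x
  | reg r => .reg r.idx
  | add a b => .add a.comp b.comp
  | sub a b => .sub a.comp b.comp
  | cell k a => .load (addr k a.comp)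

/-- Growth factor: intermediate values are at most `wt * K`. -/
def wt : AE → ℕ
  | const x => x
  | reg _ => 1
  | add a b => a.wt + b.wt
  | sub a b => a.wt + b.wt
  | cell _ a => 16 * a.wt + 33

/-- Nonzero iff the two values differ. -/
def ne (a b : AE) : AE := add (sub a b) (sub b a)

theorem ne_ev (a b : AE) (σ : Store) : (ne a b).ev σ = 0 ↔ a.ev σ = b.ev σ := by
  simp only [ne, ev]; omega

/-- Constants up to 1, registers and array entries need no bound of their own in a bounded state, so
most side conditions of commands are closed by `.inl rfl`. -/
theorem ev_le {K x : ℕ} {σ : Store} {e : AE} (h : e.small = true ∨ x ≤ K) (hx : e.ev σ = x)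
    (hb : σ.Bounded K) : e.ev σ ≤ K := by
  rcases h with h | h
  · cases e with
    | const x => exact le_trans (of_decide_eq_true h) hb.1
    | reg r => exact hb.2.1 r
    | cell k a => exact hb.2.2 _ _
    | _ => cases h
  · exact hx.trans_le h

end AE

/-- Commands over named registers and arrays. `loop r q lo hi c` runs `c` for `r` from `lo` to
`hi - 1`, where `q` holds `hi`. -/
inductive AC : Type
  | skip
  | set (r : Reg) (e : AE)
  | put (k : Arr) (a e : AE)
  | print (e : AE)
  | seq (c d : AC)
  | ite (e : AE) (c d : AC)
  | loop (r q : Reg) (lo hi : AE) (c : AC)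

namespace AC

/-- The state transformation of a command. -/
def den : AC → Store → Store
  | skip, σ => σ.tick 1
  | set r e, σ => (σ.set r (e.ev σ)).tick 1
  | put k a e, σ => (σ.put k (a.ev σ) (e.ev σ)).tick 1
  | print e, σ => (σ.word (e.ev σ)).tick 1
  | seq c d, σ => d.den (c.den σ)
  | ite e c d, σ => if e.ev σ ≠ 0 then c.den (σ.tick 1) else d.den (σ.tick 1)
  | loop r q lo hi c, σ =>
    let σ₁ := (σ.set q (hi.ev σ)).tick 1
    let σ₂ := (σ₁.set r (lo.ev σ₁)).tick 1
    ((fun τ => ((c.den (τ.tick 1)).set r (τ.reg r + 1)).tick 1)^[hi.ev σ - lo.ev σ₁] σ₂).tick 1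

/-- The side conditions under which a command runs within the bound `K`. -/
def Safe (K : ℕ) : AC → Store → Prop
  | skip, _ => True
  | set _ e, σ => e.Safe σ ∧ e.ev σ ≤ K
  | put _ a e, σ => a.Safe σ ∧ e.Safe σ ∧ e.ev σ ≤ K
  | print e, σ => e.Safe σ
  | seq c d, σ => c.Safe K σ ∧ d.Safe K (c.den σ)
  | ite e c d, σ => e.Safe σ ∧
      if e.ev σ ≠ 0 then c.Safe K (σ.tick 1) else d.Safe K (σ.tick 1)
  | loop r q lo hi c, σ =>
    let σ₁ := (σ.set q (hi.ev σ)).tick 1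
    let σ₂ := (σ₁.set r (lo.ev σ₁)).tick 1
    (hi.Safe σ ∧ hi.ev σ ≤ K) ∧ (lo.Safe σ₁ ∧ lo.ev σ₁ ≤ K) ∧
    ∀ i < hi.ev σ - lo.ev σ₁,
      let τ := (fun τ => ((c.den (τ.tick 1)).set r (τ.reg r + 1)).tick 1)^[i] σ₂
      c.Safe K (τ.tick 1) ∧ τ.reg r < K

/-- The command writes register `r`. -/
def wr : AC → Reg → Bool
  | set r' _, r => decide (r = r')
  | seq c d, r => c.wr r || d.wr r
  | ite _ c d, r => c.wr r || d.wr r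
  | loop r' q _ _ c, r => decide (r = r') || decide (r = q) || c.wr r
  | _, _ => false

/-- The command writes array `k`. -/
def wa : AC → Arr → Bool
  | put k' _ _, k => decide (k = k')
  | seq c d, k => c.wa k || d.wa k
  | ite _ c d, k => c.wa k || d.wa k
  | loop _ _ _ _ c, k => c.wa k
  | _, _ => false

/-- The command prints. -/
def wp : AC → Bool
  | print _ => true
  | seq c d => c.wp || d.wp
  | ite _ c d => c.wp || d.wp
  | loop _ _ _ _ c => c.wp
  | _ => false

/-- Machine code of a command. -/
def comp : AC → Cmd
  | skip => .skip
  | set r e => .assign r.idx e.comp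
  | put k a e => .store (AE.addr k a.comp) e.comp
  | print e => .print e.comp
  | seq c d => .seq c.comp d.comp
  | ite e c d => .ite e.comp c.comp d.comp
  | loop r q lo hi c => .seq (.assign q.idx hi.comp) (.seq (.assign r.idx lo.comp)
      (.loop (.sub (.reg q.idx) (.reg r.idx))
        (.seq c.comp (.assign r.idx (.add (.reg r.idx) (.const 1))))))

/-- Static checks: loop registers are not written in loop bodies, the register `M` and the input
are not written, and all expressions have cost and growth at most `W`. -/
def wf (W : ℕ) : AC → Bool
  | skip => true
  | set r e => decide (r ≠ .M) && decide (e.comp.cost < W) && decide (e.wt ≤ W)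
  | put k a e => decide (k ≠ .inp) && decide ((AE.addr k a.comp).cost + e.comp.cost < W) &&
      decide (16 * a.wt + 33 ≤ W) && decide (e.wt ≤ W)
  | print e => decide (e.comp.cost < W) && decide (e.wt ≤ W)
  | seq c d => c.wf W && d.wf W
  | ite e c d => decide (e.comp.cost < W) && decide (e.wt ≤ W) && c.wf W && d.wf W
  | loop r q lo hi c => decide (r ≠ .M) && decide (q ≠ .M) && decide (r ≠ q) &&
      !c.wr r && !c.wr q &&
      decide (hi.comp.cost < W) && decide (hi.wt ≤ W) && decide (lo.comp.cost < W) &&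
      decide (lo.wt ≤ W) && c.wf W

/-- `c` may lead from `σ` to `τ`, judging by what it writes. -/
def Same (c : AC) (σ τ : Store) : Prop :=
  (∀ r, c.wr r = false → τ.reg r = σ.reg r) ∧ (∀ k, c.wa k = false → τ.arr k = σ.arr k) ∧
    (c.wp = false → τ.line = σ.line)

theorem same_refl (c : AC) (σ : Store) : c.Same σ σ := ⟨fun _ _ => rfl, fun _ _ => rfl, fun _ => rfl⟩

theorem Same.trans {c : AC} {σ τ ρ : Store} (h : c.Same σ τ) (h' : c.Same τ ρ) : c.Same σ ρ :=
  ⟨fun r hr => (h'.1 r hr).trans (h.1 r hr), fun r hr => (h'.2.1 r hr).trans (h.2.1 r hr),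
    fun hr => (h'.2.2 hr).trans (h.2.2 hr)⟩

/-- This is the frame rule. Because `wr`, `wa` and `wp` are computable, later facts of the form
"this register is unchanged" follow by `rfl`. -/
theorem same_den (c : AC) (σ : Store) : c.Same σ (c.den σ) := by
  induction c generalizing σ with
  | skip => exact ⟨fun _ _ => rfl, fun _ _ => rfl, fun _ => rfl⟩
  | set r e => exact ⟨fun r' h => by simp_all [wr, den], fun _ _ => rfl, fun _ => rfl⟩
  | put k a e => exact ⟨fun r' h => rfl, fun k' h => by simp_all [wa, den], fun _ => rfl⟩
  | print e => exact ⟨fun _ _ => rfl, fun _ _ => rfl, fun h => by simp [wp] at h⟩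
  | seq c d hc hd =>
    refine ⟨fun r h => ?_, fun r h => ?_, fun h => ?_⟩
    · simp only [wr, Bool.or_eq_false_iff] at h
      exact ((hd _).1 r h.2).trans ((hc _).1 r h.1)
    · simp only [wa, Bool.or_eq_false_iff] at h
      exact ((hd _).2.1 r h.2).trans ((hc _).2.1 r h.1)
    · simp only [wp, Bool.or_eq_false_iff] at h
      exact ((hd _).2.2 h.2).trans ((hc _).2.2 h.1)
  | ite e c d hc hd =>
    refine ⟨fun r h => ?_, fun r h => ?_, fun h => ?_⟩ <;>
      simp only [wr, wa, wp, Bool.or_eq_false_iff] at h <;> simp only [den] <;> split_ifs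
    exacts [(hc _).1 r h.1, (hd _).1 r h.2, (hc _).2.1 r h.1, (hd _).2.1 r h.2, (hc _).2.2 h.1,
      (hd _).2.2 h.2]
  | loop r q lo hi c hc =>
    simp only [den]
    generalize hi.ev σ - _ = N
    refine Same.trans (τ := ((σ.set q (hi.ev σ)).tick 1 |>.set r
      (lo.ev ((σ.set q (hi.ev σ)).tick 1))).tick 1) ?_ ?_
    · refine ⟨fun r' h => ?_, fun _ _ => rfl, fun _ => rfl⟩
      simp only [wr, Bool.or_eq_false_iff, decide_eq_false_iff_not] at h
      simp [h.1.1, h.1.2]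
    · generalize ((σ.set q (hi.ev σ)).tick 1 |>.set r
        (lo.ev ((σ.set q (hi.ev σ)).tick 1))).tick 1 = ρ
      induction N generalizing ρ with
      | zero => exact same_refl _ _
      | succ N ih =>
        rw [Function.iterate_succ_apply]
        refine Same.trans ?_ (ih _)
        refine ⟨fun r' h => ?_, fun r' h => ?_, fun h => ?_⟩
        · simp only [wr, Bool.or_eq_false_iff, decide_eq_false_iff_not] at h
          simpa [h.1.1] using (hc (ρ.tick 1)).1 r' h.2
        · exact (hc (ρ.tick 1)).2.1 r' h
        · exact (hc (ρ.tick 1)).2.2 h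

theorem bounded_den {K : ℕ} (c : AC) {σ : Store} (h : σ.Bounded K) (hs : c.Safe K σ) :
    (c.den σ).Bounded K := by
  induction c generalizing σ with
  | skip => exact h
  | set r e => exact h.set _ _ hs.2
  | put k a e => exact h.put _ _ _ hs.2.2
  | print e => exact h
  | seq c d hc hd => exact hd (hc h hs.1) hs.2
  | ite e c d hc hd =>
    simp only [den]
    have := hs.2
    split_ifs at this ⊢
    exacts [hc h this, hd h this]
  | loop r q lo hi c hc =>
    obtain ⟨h₁, h₂, h₃⟩ := hs
    simp only [den]
    have b₁ : ((σ.set q (hi.ev σ)).tick 1).Bounded K := h.set _ _ h₁.2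
    have b₂ : (((σ.set q (hi.ev σ)).tick 1 |>.set r
        (lo.ev ((σ.set q (hi.ev σ)).tick 1))).tick 1).Bounded K := b₁.set _ _ h₂.2
    have key : ∀ N ≤ hi.ev σ - lo.ev ((σ.set q (hi.ev σ)).tick 1),
        ((fun τ => ((c.den (τ.tick 1)).set r (τ.reg r + 1)).tick 1)^[N]
          (((σ.set q (hi.ev σ)).tick 1 |>.set r
        (lo.ev ((σ.set q (hi.ev σ)).tick 1))).tick 1)).Bounded K := by
      intro N hN
      induction N with
      | zero => exact b₂
      | succ N ih =>
        rw [Function.iterate_succ_apply']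
        have := h₃ N (by omega)
        exact (hc (σ := Store.tick _ 1) (ih (by omega)) this.1).set _ _ this.2
    exact key _ le_rfl

/-- Partial correctness together with the side conditions, for states bounded by `K`. -/
def Run (K : ℕ) (c : AC) (σ : Store) (Q : Store → Prop) : Prop :=
  σ.Bounded K → c.Safe K σ ∧ Q (c.den σ)

variable {K : ℕ} {σ : Store} {Q R : Store → Prop} {c d : AC}

theorem Run.mono (h : Run K c σ R)
    (hQ : ∀ τ, τ.Bounded K → c.Same σ τ → R τ → Q τ) : Run K c σ Q := fun hb =>
  ⟨(h hb).1, hQ _ (bounded_den c hb (h hb).1) (same_den c σ) (h hb).2⟩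

theorem Run.seq (h : Run K c σ (fun τ => Run K d τ Q)) : Run K (.seq c d) σ Q := fun hb =>
  let ⟨h₁, h₂⟩ := h hb
  let ⟨h₃, h₄⟩ := h₂ (bounded_den c hb h₁)
  ⟨⟨h₁, h₃⟩, h₄⟩

theorem Run.set {r : Reg} {e : AE} (x : ℕ) (hs : e.Safe σ) (hx : e.ev σ = x)
    (hl : e.small = true ∨ x ≤ K) (hQ : Q ((σ.set r x).tick 1)) : Run K (.set r e) σ Q :=
  fun hb => ⟨⟨hs, AE.ev_le hl hx hb⟩, by subst hx; exact hQ⟩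

theorem Run.put {k : Arr} {a e : AE} (i x : ℕ) (ha : a.Safe σ) (hs : e.Safe σ) (hi : a.ev σ = i)
    (hx : e.ev σ = x) (hl : e.small = true ∨ x ≤ K) (hQ : Q ((σ.put k i x).tick 1)) :
    Run K (.put k a e) σ Q :=
  fun hb => ⟨⟨ha, hs, AE.ev_le hl hx hb⟩, by subst hx; subst hi; exact hQ⟩

theorem Run.skip (hQ : Q (σ.tick 1)) : Run K .skip σ Q := fun _ => ⟨trivial, hQ⟩

theorem Run.print {e : AE} (hs : e.Safe σ)
    (hQ : Q ((σ.word (e.ev σ)).tick 1)) : Run K (.print e) σ Q := fun _ => ⟨hs, hQ⟩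

theorem Run.ite {e : AE} (x : ℕ) (hs : e.Safe σ) (hx : e.ev σ = x)
    (hc : x ≠ 0 → Run K c (σ.tick 1) Q) (hd : x = 0 → Run K d (σ.tick 1) Q) :
    Run K (.ite e c d) σ Q := by
  intro hb
  subst hx
  by_cases h : e.ev σ = 0
  · have := hd h hb
    simpa [Safe, den, h, hs] using this
  · have := hc h hb
    simpa [Safe, den, h, hs] using this

theorem Run.loop {r q : Reg} {lo hi : AE} {l u : ℕ} (I : ℕ → Store → Prop)
    (hrq : r ≠ q) (hq : c.wr q = false)
    (sh : hi.Safe σ) (lh : hi.small = true ∨ u ≤ K) (sl : lo.Safe ((σ.set q u).tick 1))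
    (ll : lo.small = true ∨ l ≤ K)
    (eh : hi.ev σ = u) (el : lo.ev ((σ.set q u).tick 1) = l) (hlu : l ≤ u)
    (init : I l ((((σ.set q u).tick 1).set r l).tick 1))
    (step : ∀ i τ, l ≤ i → i < u → τ.Bounded K → τ.reg r = i → τ.reg q = u →
      (AC.loop r q lo hi c).Same σ τ → I i τ →
      Run K c (τ.tick 1) (fun τ' => I (i + 1) ((τ'.set r (i + 1)).tick 1)))
    (post : ∀ τ, τ.Bounded K → (AC.loop r q lo hi c).Same σ τ → I u τ → Q (τ.tick 1)) :
    Run K (.loop r q lo hi c) σ Q := by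
  intro hb
  replace lh := AE.ev_le lh eh hb
  replace ll := fun hb => AE.ev_le ll el (K := K) hb
  subst eh; subst el
  set F : Store → Store := fun τ => ((c.den (τ.tick 1)).set r (τ.reg r + 1)).tick 1 with hF
  set σ₁ := (σ.set q (hi.ev σ)).tick 1 with hσ₁
  set σ₂ := (σ₁.set r (lo.ev σ₁)).tick 1 with hσ₂
  have b₁ : σ₁.Bounded K := hb.set _ _ lh
  have b₂ : σ₂.Bounded K := b₁.set _ _ (ll b₁)
  -- The counter is advanced from its value before the body, so it is `lo + N` whatever the body
  -- does to it; only `q` has to be protected, by `hq`.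
  have key : ∀ N ≤ hi.ev σ - lo.ev σ₁, (F^[N] σ₂).Bounded K ∧ (F^[N] σ₂).reg r = lo.ev σ₁ + N ∧
      (F^[N] σ₂).reg q = hi.ev σ ∧ (AC.loop r q lo hi c).Same σ (F^[N] σ₂) ∧
      I (lo.ev σ₁ + N) (F^[N] σ₂) ∧ ∀ i < N, c.Safe K ((F^[i] σ₂).tick 1) ∧ (F^[i] σ₂).reg r < K := by
    intro N
    induction N with
    | zero =>
      refine fun _ => ⟨b₂, by simp [hσ₂], by simp [hσ₂, hσ₁, hrq.symm], ?_, init, by simp⟩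
      refine ⟨fun r' h => ?_, fun _ _ => rfl, fun _ => rfl⟩
      simp only [wr, Bool.or_eq_false_iff, decide_eq_false_iff_not] at h
      simp [hσ₂, hσ₁, h.1.1, h.1.2]
    | succ N ih =>
      intro hN
      obtain ⟨hB, h₁, h₂, h₃, h₄, h₅⟩ := ih (by omega)
      rw [Function.iterate_succ_apply']
      set τ := F^[N] σ₂
      obtain ⟨s₁, s₂⟩ := step _ τ (by omega) (by omega) hB h₁ h₂ h₃ h₄ hB
      have hlt : τ.reg r < K := by
        omega
      refine ⟨(bounded_den c (σ := τ.tick 1) hB s₁).set _ _ hlt, by simp [hF, h₁]; omega, ?_, ?_, ?_, ?_⟩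
      · simp only [hF, Store.tick_reg, Store.set_reg, if_neg hrq.symm]
        rw [(same_den c _).1 q hq, Store.tick_reg, h₂]
      · refine h₃.trans ⟨fun r' h => ?_, fun r' h => (same_den c (τ.tick 1)).2.1 r' h,
          fun h => (same_den c (τ.tick 1)).2.2 h⟩
        simp only [wr, Bool.or_eq_false_iff, decide_eq_false_iff_not] at h
        simpa [hF, h.1.1] using (same_den c (τ.tick 1)).1 r' h.2
      · simpa only [hF, h₁, Nat.add_assoc] using s₂
      · intro i hi'
        rcases Nat.lt_succ_iff_lt_or_eq.1 hi' with h | rfl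
        · exact h₅ i h
        · exact ⟨s₁, hlt⟩
  obtain ⟨hB, h₁, h₂, h₃, h₄, h₅⟩ := key _ le_rfl
  refine ⟨⟨⟨sh, lh⟩, ⟨sl, ll b₁⟩, h₅⟩, post _ hB h₃ ?_⟩
  rwa [Nat.add_sub_cancel' hlu] at h₄

end AC

/-- The machine configuration `s` represents the abstract state `σ`. -/
structure Represents (m : ℕ) (s : Config) (σ : Store) : Prop where
  reg : ∀ r, s.reg r.idx = σ.reg r
  arr : ∀ a, a ≠ .inp → ∀ i, s.mem (16 * (i + m) + a.idx) = σ.arr a i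
  inp : ∀ i, i < 2 * m + 2 → s.mem i = σ.arr .inp i
  line : s.line = σ.line
  size : σ.reg .M = m

/-! ### Correctness and cost of the compilation. -/

variable {m K B W : ℕ} {s : Config} {σ : Store}

/-- The arrays are interleaved by residues modulo 16, so none needs a length fixed in advance. The
shift by `16 * m` puts them behind the `2 * m + 2` input words when `m > 0`. -/
theorem AE.addr_val (hR : Represents m s σ) (k : Arr) (x : Expr) (hk : k ≠ .inp) :
    (AE.addr k x).val s = 16 * (x.val s + m) + k.idx := by
  have h0 : s.reg 0 = m := (hR.reg .M).trans hR.size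
  cases k <;> first | exact absurd rfl hk | (simp only [AE.addr, Expr.val, h0]; omega)

theorem AE.comp_val (hR : Represents m s σ) (e : AE) (hs : e.Safe σ) : e.comp.val s = e.ev σ := by
  induction e with
  | const x => rfl
  | reg r => exact hR.reg r
  | add a b ha hb => simp [comp, Expr.val, ev, ha hs.1, hb hs.2]
  | sub a b ha hb => simp [comp, Expr.val, ev, ha hs.1, hb hs.2]
  | cell k a ha =>
    by_cases hk : k = .inp
    · subst hk
      have := hs.2 rfl
      rw [hR.size] at this
      simp only [comp, Expr.val, addr, ev, ha hs.1]
      exact hR.inp _ this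
    · simp only [comp, Expr.val, addr_val hR k _ hk, ev, ha hs.1]
      exact hR.arr k hk _

/-- The only delicate case is `cell`: the address is `16 * (x + m) + idx` with `m ≤ K` and `idx ≤ 12
≤ 12 * K`, hence at most `(16 * wt + 28) * K`, and 33 leaves room. -/
theorem AE.comp_fits (hR : Represents m s σ) (hb : σ.Bounded K) (e : AE) (hs : e.Safe σ) :
    e.ev σ ≤ e.wt * K ∧ (e.wt * K < B → e.comp.Fits B s) := by
  have hK := hb.1
  have hm : m ≤ K := hR.size ▸ hb.2.1 .M
  have h0 : s.reg 0 = m := (hR.reg .M).trans hR.size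
  induction e with
  | const x => exact ⟨Nat.le_mul_of_pos_right x hK, fun h => lt_of_le_of_lt (Nat.le_mul_of_pos_right x hK) h⟩
  | reg r =>
    refine ⟨by simpa [wt, ev] using hb.2.1 r, fun h => ?_⟩
    simp only [comp, Expr.Fits, hR.reg]
    simp only [wt, one_mul] at h
    exact lt_of_le_of_lt (hb.2.1 r) h
  | add a b ha hb' =>
    obtain ⟨a1, a2⟩ := ha hs.1
    obtain ⟨b1, b2⟩ := hb' hs.2
    simp only [wt, add_mul, ev, comp, Expr.Fits, comp_val hR a hs.1, comp_val hR b hs.2]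
    exact ⟨by omega, fun h => ⟨a2 (by omega), b2 (by omega), by omega⟩⟩
  | sub a b ha hb' =>
    obtain ⟨a1, a2⟩ := ha hs.1
    obtain ⟨b1, b2⟩ := hb' hs.2
    simp only [wt, add_mul, ev, comp, Expr.Fits]
    exact ⟨by omega, fun h => ⟨a2 (by omega), b2 (by omega)⟩⟩
  | cell k a ha =>
    obtain ⟨a1, a2⟩ := ha hs.1
    have hv := comp_val hR (cell k a) hs
    have hle : (cell k a).ev σ ≤ K := hb.2.2 _ _
    simp only [wt, add_mul, mul_assoc]
    refine ⟨by omega, fun h => ⟨?_, ?_⟩⟩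
    · have a3 := a2 (by omega)
      have a4 := comp_val hR a hs.1
      cases k <;> simp [addr, Expr.Fits, Expr.val, a4, h0, Arr.idx] <;>
        first | exact a3 | (and_intros <;> first | exact a3 | omega)
    · have : (comp a).val s = a.ev σ := comp_val hR a hs.1
      change (Expr.load (addr k a.comp)).val s < B
      change (cell k a).comp.val s < B
      omega

/-- One unit of the step counter pays for `W` units of machine time. -/
theorem AC.simulate (hm : 0 < m) (hW : 8 ≤ W) (hB : W * K < B) (c : AC) (hwf : c.wf W = true) {s : Config}
    {σ : Store} (hR : Represents m s σ) (hb : σ.Bounded K) (hs : c.Safe K σ) :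
    ∃ s', Exec B c.comp s s' ∧ Represents m s' (c.den σ) ∧ s'.log = s.log ∧
      s'.time + W * σ.clk ≤ s.time + W * (c.den σ).clk := by
  have fit : ∀ {w : ℕ}, w ≤ W → w * K < B := fun h =>
    lt_of_le_of_lt (Nat.mul_le_mul_right K h) hB
  have fits : ∀ {s σ}, Represents m s σ → σ.Bounded K → ∀ e : AE, e.Safe σ → e.wt ≤ W →
      e.comp.Fits B s := fun hR hb e he hw => (AE.comp_fits hR hb e he).2 (fit hw)
  have assign : ∀ {s σ} {r : Reg} {e : AE}, Represents m s σ → σ.Bounded K → e.Safe σ →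
      r ≠ .M → e.comp.cost < W → e.wt ≤ W →
      ∃ s', Exec B (.assign r.idx e.comp) s s' ∧
        Represents m s' ((σ.set r (e.ev σ)).tick 1) ∧ s'.log = s.log ∧ s'.time ≤ s.time + W := by
    intro s σ r e hR hb he hr hc hw
    refine ⟨_, .assign s r.idx e.comp (fits hR hb e he hw), ⟨fun r' => ?_, hR.arr, hR.inp, hR.line, ?_⟩,
      rfl, ?_⟩
    · simp [Config.tick, Config.setReg, Function.update_apply, Reg.idx_injective.eq_iff,
        AE.comp_val hR e he, hR.reg]
    · simpa [hr.symm] using hR.size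
    · simp only [Config.tick, Config.setReg]; omega
  induction c generalizing s σ with
  | skip =>
    refine ⟨_, .skip s, ⟨hR.reg, hR.arr, hR.inp, hR.line, hR.size⟩, rfl, ?_⟩
    simp only [Config.tick, den, Store.tick_clk, mul_add]; omega
  | set r e =>
    simp only [wf, Bool.and_eq_true, decide_eq_true_eq] at hwf
    obtain ⟨s', h₁, h₂, h₃, h₄⟩ := assign hR hb hs.1 hwf.1.1 hwf.1.2 hwf.2
    refine ⟨s', h₁, h₂, h₃, ?_⟩
    simp only [den, Store.tick_clk, Store.set_clk, mul_add]; omega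
  | put k a e =>
    simp only [wf, Bool.and_eq_true, decide_eq_true_eq] at hwf
    obtain ⟨⟨⟨hk, hc⟩, ha⟩, he⟩ := hwf
    have hfa := (AE.comp_fits (B := B) hR hb (.cell k a) ⟨hs.1, fun h => absurd h hk⟩).2 (fit ha)
    have hva := AE.comp_val hR a hs.1
    refine ⟨_, .store s _ _ hfa.1 (fits hR hb e hs.2.1 he), ⟨hR.reg, ?_, ?_, hR.line, hR.size⟩, rfl, ?_⟩
    · intro k' hk' i
      simp only [Config.tick, Config.setMem, AE.addr_val hR k _ hk, hva, den, Store.tick_arr,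
        Store.put_arr, AE.comp_val hR e hs.2.1, Function.update_apply]
      have l1 := Arr.idx_lt k
      have l2 := Arr.idx_lt k'
      by_cases h : k' = k
      · subst h
        by_cases h' : i = a.ev σ
        · simp [h']
        · rw [if_neg (by omega), if_pos rfl, Function.update_apply, if_neg h']
          exact hR.arr _ hk' _
      · have : k'.idx ≠ k.idx := fun h' => h (Arr.idx_injective h')
        rw [if_neg (by omega), if_neg h]
        exact hR.arr _ hk' _
    · intro i hi
      have l3 : k.idx ≠ 0 := fun h => hk (Arr.idx_injective h)
      simp only [Config.tick, Config.setMem, AE.addr_val hR k _ hk, hva, den, Store.tick_arr,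
        Store.put_arr, if_neg (Ne.symm hk), Function.update_apply]
      rw [if_neg (by omega)]
      exact hR.inp i hi
    · simp only [Config.tick, Config.setMem, den, Store.tick_clk, Store.put_clk, mul_add]; omega
  | print e =>
    simp only [wf, Bool.and_eq_true, decide_eq_true_eq] at hwf
    refine ⟨_, .print s _ (fits hR hb e hs hwf.2), ⟨hR.reg, hR.arr, hR.inp, ?_, hR.size⟩, rfl, ?_⟩
    · simp [Config.tick, Config.putWord, den, hR.line, AE.comp_val hR e hs]
    · simp only [Config.tick, Config.putWord, den, Store.tick_clk, Store.word_clk, mul_add]; omega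
  | seq c d hc hd =>
    simp only [wf, Bool.and_eq_true] at hwf
    obtain ⟨s', h₁, h₂, h₃, h₄⟩ := hc hwf.1 hR hb hs.1
    obtain ⟨s'', g₁, g₂, g₃, g₄⟩ := hd hwf.2 h₂ (bounded_den c hb hs.1) hs.2
    refine ⟨s'', .seq h₁ g₁, g₂, g₃.trans h₃, ?_⟩
    simp only [den]; omega
  | ite e c d hc hd =>
    simp only [wf, Bool.and_eq_true, decide_eq_true_eq] at hwf
    have hR' : Represents m (s.tick (e.comp.cost + 1)) (σ.tick 1) :=
      ⟨hR.reg, hR.arr, hR.inp, hR.line, hR.size⟩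
    have hf := fits hR hb e hs.1 hwf.1.1.2
    have hv := AE.comp_val hR e hs.1
    have hs2 := hs.2
    simp only [den]
    by_cases h : e.ev σ = 0
    · rw [if_neg (not_not.2 h)] at hs2 ⊢
      obtain ⟨s', h₁, h₂, h₃, h₄⟩ := hd hwf.2 hR' hb hs2
      refine ⟨s', .ite_false hf (hv.trans h) h₁, h₂, h₃, ?_⟩
      simp only [Config.tick, Store.tick_clk, mul_add] at h₄; omega
    · rw [if_pos h] at hs2 ⊢
      obtain ⟨s', h₁, h₂, h₃, h₄⟩ := hc hwf.1.2 hR' hb hs2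
      refine ⟨s', .ite_true hf (hv ▸ h) h₁, h₂, h₃, ?_⟩
      simp only [Config.tick, Store.tick_clk, mul_add] at h₄; omega
  | loop r q lo hi c hc =>
    simp only [wf, Bool.and_eq_true, decide_eq_true_eq, Bool.not_eq_true'] at hwf
    obtain ⟨⟨⟨⟨⟨⟨⟨⟨⟨hr, hq⟩, hrq⟩, hwr⟩, hwq⟩, hhc⟩, hhw⟩, hlc⟩, hlw⟩, hcw⟩ := hwf
    obtain ⟨sh, sl, sc⟩ := hs
    simp only [den]
    obtain ⟨s₁, e₁, R₁, l₁, t₁⟩ := assign (r := q) hR hb sh.1 hq hhc hhw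
    have b₁ : ((σ.set q (hi.ev σ)).tick 1).Bounded K := hb.set _ _ sh.2
    set σ₁ := (σ.set q (hi.ev σ)).tick 1 with hσ₁
    obtain ⟨s₂, e₂, R₂, l₂, t₂⟩ := assign (r := r) R₁ b₁ sl.1 hr hlc hlw
    have b₂ : ((σ₁.set r (lo.ev σ₁)).tick 1).Bounded K := b₁.set _ _ sl.2
    set F : Store → Store := fun τ => ((c.den (τ.tick 1)).set r (τ.reg r + 1)).tick 1 with hF
    have v₁ : ((σ₁.set r (lo.ev σ₁)).tick 1).reg r = lo.ev σ₁ := by simp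
    have v₂ : ((σ₁.set r (lo.ev σ₁)).tick 1).reg q = hi.ev σ := by simp [hσ₁, Ne.symm hrq]
    have k₁ : ((σ₁.set r (lo.ev σ₁)).tick 1).clk = σ.clk + 2 := by simp [hσ₁]
    generalize (σ₁.set r (lo.ev σ₁)).tick 1 = σ₂ at *
    -- In `F` the first tick pays for the loop test and the second for the increment; the tick after
    -- the last iteration pays for the failing test.
    have main : ∀ N (s : Config) (τ : Store), Represents m s τ → τ.Bounded K →
        τ.reg q = τ.reg r + N → (∀ i < N, c.Safe K ((F^[i] τ).tick 1) ∧ (F^[i] τ).reg r < K) →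
        ∃ s', Exec B (.loop (.sub (.reg q.idx) (.reg r.idx))
          (.seq c.comp (.assign r.idx (.add (.reg r.idx) (.const 1))))) s s' ∧
          Represents m s' ((F^[N] τ).tick 1) ∧ s'.log = s.log ∧
          s'.time + W * τ.clk ≤ s.time + W * ((F^[N] τ).tick 1).clk := by
      intro N
      induction N with
      | zero =>
        intro s τ hR hb hN _
        have hf := fits hR hb (.sub (.reg q) (.reg r)) ⟨trivial, trivial⟩ (by simp [AE.wt]; omega)
        have hv := AE.comp_val hR (.sub (.reg q) (.reg r)) ⟨trivial, trivial⟩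
        refine ⟨_, .loop_false hf (hv.trans (by simp [AE.ev, hN])),
          ⟨hR.reg, hR.arr, hR.inp, hR.line, hR.size⟩, rfl, ?_⟩
        simp only [Config.tick, Expr.cost, Function.iterate_zero, id, Store.tick_clk, mul_add]; omega
      | succ N ih =>
        intro s τ hR hb hN hs
        have hf := fits hR hb (.sub (.reg q) (.reg r)) ⟨trivial, trivial⟩ (by simp [AE.wt]; omega)
        have hv := AE.comp_val hR (.sub (.reg q) (.reg r)) ⟨trivial, trivial⟩
        have h0 := hs 0 (by omega)
        simp only [Function.iterate_zero, id] at h0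
        obtain ⟨s', h₁, h₂, h₃, h₄⟩ := hc hcw
          (s := s.tick ((Expr.sub (.reg q.idx) (.reg r.idx)).cost + 1)) (σ := τ.tick 1)
          ⟨hR.reg, hR.arr, hR.inp, hR.line, hR.size⟩ hb h0.1
        have bc := bounded_den c (σ := τ.tick 1) hb h0.1
        obtain ⟨s'', g₁, g₂, g₃, g₄⟩ := assign (r := r) (e := .add (.reg r) (.const 1)) h₂ bc
          ⟨trivial, trivial⟩ hr (by simp [AE.comp, Expr.cost]; omega) (by simp [AE.wt]; omega)
        have hreg : (c.den (τ.tick 1)).reg r = τ.reg r := (same_den c _).1 r hwr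
        have hFτ : ((c.den (τ.tick 1)).set r ((AE.add (.reg r) (.const 1)).ev (c.den (τ.tick 1)))).tick 1
            = F τ := by simp [hF, AE.ev, hreg]
        rw [hFτ] at g₂
        have bF : (F τ).Bounded K := by
          rw [hF]; exact bc.set _ _ h0.2
        obtain ⟨s3, f₁, f₂, f₃, f₄⟩ := ih s'' (F τ) g₂ bF (by
            simp only [hF, Store.tick_reg, Store.set_reg, if_neg (Ne.symm hrq), if_true]
            rw [(same_den c _).1 q hwq]
            simp only [Store.tick_reg]; omega) (fun i hi => by
            have := hs (i + 1) (by omega)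
            simpa only [Function.iterate_succ_apply] using this)
        refine ⟨s3, .loop_true hf (by rw [show (Expr.sub (.reg q.idx) (.reg r.idx)).val s = _ from hv]; simp [AE.ev]; omega)
          (.seq h₁ g₁) f₁, by rwa [Function.iterate_succ_apply],
          f₃.trans (g₃.trans h₃), ?_⟩
        have hclk : (F τ).clk = (c.den (τ.tick 1)).clk + 1 := rfl
        rw [Function.iterate_succ_apply]
        rw [hclk] at f₄
        simp only [Config.tick, Expr.cost, Store.tick_clk, mul_add] at h₄ f₄ ⊢
        omega
    by_cases hle : lo.ev σ₁ ≤ hi.ev σ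
    · obtain ⟨s3, f₁, f₂, f₃, f₄⟩ := main (hi.ev σ - lo.ev σ₁) s₂ σ₂ R₂ b₂ (by omega) sc
      refine ⟨s3, .seq e₁ (.seq e₂ f₁), f₂, f₃.trans (l₂.trans l₁), ?_⟩
      rw [k₁, mul_add] at f₄
      omega
    -- For `lo > hi` both the iteration count and the machine's test vanish by truncated
    -- subtraction.
    · have h0 : hi.ev σ - lo.ev σ₁ = 0 := by omega
      rw [h0]
      have hf := fits R₂ b₂ (.sub (.reg q) (.reg r)) ⟨trivial, trivial⟩ (by simp [AE.wt]; omega)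
      have hv := AE.comp_val R₂ (.sub (.reg q) (.reg r)) ⟨trivial, trivial⟩
      refine ⟨_, .seq e₁ (.seq e₂ (.loop_false hf (hv.trans (by simp [AE.ev]; omega)))),
        ⟨R₂.reg, R₂.arr, R₂.inp, R₂.line, R₂.size⟩, l₂.trans l₁, ?_⟩
      simp only [Config.tick, Expr.cost, Function.iterate_zero, id, Store.tick_clk, k₁, mul_add]
      omega

end RAM

/-! ### Minimal connected edge dominating sets as trees, and exchange moves between them -/

section Trees

variable {V : Type*} {G : SimpleGraph V} {F F' T X : Finset (Sym2 V)} {a b u v w x y z : V}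

/-- `u` and `v` are joined by a path with edges in `F`. -/
def Reach (F : Finset (Sym2 V)) (u v : V) : Prop :=
  (SimpleGraph.fromEdgeSet (↑F : Set (Sym2 V))).Reachable u v

/-- `v` is an endpoint of an edge in `F`. -/
def Touches (F : Finset (Sym2 V)) (v : V) : Prop := ∃ e ∈ F, v ∈ e

/-- The endpoints of the edges in `F` form a vertex cover of `G`. -/
def Covers (G : SimpleGraph V) (F : Finset (Sym2 V)) : Prop :=
  ∀ a b, G.Adj a b → Touches F a ∨ Touches F b

theorem Reach.refl (F : Finset (Sym2 V)) (u : V) : Reach F u u := SimpleGraph.Reachable.refl u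

theorem Reach.symm (h : Reach F u v) : Reach F v u := SimpleGraph.Reachable.symm h

theorem Reach.trans (h : Reach F u v) (h' : Reach F v w) : Reach F u w :=
  SimpleGraph.Reachable.trans h h'

theorem Reach.mono (hF : F ⊆ F') (h : Reach F u v) : Reach F' u v :=
  SimpleGraph.Reachable.mono (SimpleGraph.fromEdgeSet_mono (by exact_mod_cast hF)) h

theorem Reach.of_mem (h : s(u, v) ∈ F) : Reach F u v := by
  by_cases huv : u = v
  · subst huv; exact Reach.refl _ _
  · exact SimpleGraph.Adj.reachable (by simpa [huv] using h)

/-- This is the induction principle for reachability; the arguments below differ mainly in the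
choice of the invariant `S`. -/
theorem Reach.closed (h : Reach F u v) (S : V → Prop) (hS : ∀ a b, s(a, b) ∈ F → S a → S b)
    (hu : S u) : S v := by
  obtain ⟨p⟩ := h
  induction p with
  | nil => exact hu
  | cons hadj p ih => exact ih (hS _ _ (by simpa using (SimpleGraph.fromEdgeSet_adj _ |>.1 hadj).1) hu)

theorem Reach.of_forall (h : Reach F u v) (hF : ∀ a b, s(a, b) ∈ F → Reach F' a b) :
    Reach F' u v :=
  h.closed (fun z => Reach F' u z) (fun a b hab ha => ha.trans (hF a b hab)) (Reach.refl _ _)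

theorem touches_left (h : s(a, b) ∈ F) : Touches F a := ⟨_, h, Sym2.mem_mk_left a b⟩

theorem touches_right (h : s(a, b) ∈ F) : Touches F b := ⟨_, h, Sym2.mem_mk_right a b⟩

theorem Touches.mono (hF : F ⊆ F') (h : Touches F v) : Touches F' v :=
  let ⟨e, he, hv⟩ := h
  ⟨e, hF he, hv⟩

theorem Touches.exists_mem (h : Touches F v) : ∃ u, s(v, u) ∈ F := by
  obtain ⟨e, he, hv⟩ := h
  obtain ⟨u, rfl⟩ := Sym2.mem_iff_exists.1 hv
  exact ⟨u, he⟩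

theorem Reach.touches (h : Reach F u v) (hne : u ≠ v) : Touches F v :=
  (h.closed (fun z => z = u ∨ Touches F z) (fun _ _ hab _ => .inr (touches_right hab))
    (.inl rfl)).resolve_left (fun h => hne h.symm)

/-- An edge is dominated as soon as one of its ends is touched, so domination turns into a vertex
cover condition. -/
theorem isCEDS_iff : IsCEDS G F ↔ ((∀ e ∈ F, e ∈ G.edgeSet) ∧ Covers G F) ∧
    EdgeInducedConnected F := by
  refine and_congr_left fun _ => and_congr_right fun _ => ⟨fun h a b hab => ?_, fun h e he => ?_⟩
  · obtain ⟨e, he, z, hz, hz'⟩ := h s(a, b) hab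
    rcases Sym2.mem_iff.1 hz' with rfl | rfl
    exacts [.inl ⟨e, he, hz⟩, .inr ⟨e, he, hz⟩]
  · induction e with
    | _ a b =>
      rcases h a b he with ⟨e, he, hz⟩ | ⟨e, he, hz⟩
      exacts [⟨e, he, a, hz, Sym2.mem_mk_left a b⟩, ⟨e, he, b, hz, Sym2.mem_mk_right a b⟩]

/-- `F` consists of the edges of a subtree of `G` (or is empty). -/
structure IsSubtree (G : SimpleGraph V) (F : Finset (Sym2 V)) : Prop where
  sub : ∀ e ∈ F, e ∈ G.edgeSet
  acyclic : (SimpleGraph.fromEdgeSet (↑F : Set (Sym2 V))).IsAcyclic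
  conn : EdgeInducedConnected F

theorem IsSubtree.adj (h : IsSubtree G F) (hab : s(a, b) ∈ F) : G.Adj a b := h.sub _ hab

theorem IsSubtree.reach (h : IsSubtree G F) (ha : Touches F a) (hb : Touches F b) : Reach F a b :=
  h.conn a b ha hb

theorem IsSubtree.isCEDS (h : IsSubtree G F) (hc : Covers G F) : IsCEDS G F :=
  isCEDS_iff.2 ⟨⟨h.sub, hc⟩, h.conn⟩

/-! ### Leaves, bridges and surgery on subtrees. -/

variable [DecidableEq V]

/-- The number of edges of `F` at `v`. -/
def edgeDeg (F : Finset (Sym2 V)) (v : V) : ℕ := (F.filter (v ∈ ·)).card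

theorem edgeDeg_eq_zero : edgeDeg F v = 0 ↔ ¬ Touches F v := by
  simp [edgeDeg, Touches, Finset.filter_eq_empty_iff]

theorem edgeDeg_eq_one : edgeDeg F v = 1 ↔ ∃ y, s(v, y) ∈ F ∧ ∀ e ∈ F, v ∈ e → e = s(v, y) := by
  rw [edgeDeg, Finset.card_eq_one]
  constructor
  · rintro ⟨e, he⟩
    have h1 : e ∈ F.filter (v ∈ ·) := by simp [he]
    rw [Finset.mem_filter] at h1
    obtain ⟨y, rfl⟩ := Sym2.mem_iff_exists.1 h1.2
    refine ⟨y, h1.1, fun e' h2 h3 => ?_⟩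
    have : e' ∈ F.filter (v ∈ ·) := Finset.mem_filter.2 ⟨h2, h3⟩
    simpa [he] using this
  · rintro ⟨y, hy, h⟩
    refine ⟨s(v, y), Finset.eq_singleton_iff_unique_mem.2 ⟨by simp [hy], fun e he => ?_⟩⟩
    exact h e (Finset.mem_filter.1 he).1 (Finset.mem_filter.1 he).2

theorem not_reach_erase (h : (SimpleGraph.fromEdgeSet (↑F : Set (Sym2 V))).IsAcyclic)
    (hne : x ≠ y) (hxy : s(x, y) ∈ F) : ¬ Reach (F.erase s(x, y)) x y := by
  have := SimpleGraph.isAcyclic_iff_forall_adj_isBridge.1 h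
    ((SimpleGraph.fromEdgeSet_adj (v := x) (w := y) _).2 ⟨hxy, hne⟩)
  rw [SimpleGraph.isBridge_iff, SimpleGraph.deleteEdges_fromEdgeSet] at this
  simpa [Reach] using this

theorem acyclic_of_not_reach (h : ∀ x y, s(x, y) ∈ F → x ≠ y → ¬ Reach (F.erase s(x, y)) x y) :
    (SimpleGraph.fromEdgeSet (↑F : Set (Sym2 V))).IsAcyclic := by
  refine SimpleGraph.isAcyclic_iff_forall_adj_isBridge.2 fun x y hxy => ?_
  rw [SimpleGraph.isBridge_iff, SimpleGraph.deleteEdges_fromEdgeSet]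
  have := h x y hxy.1 hxy.2
  simpa [Reach] using this

theorem acyclic_mono (h : (SimpleGraph.fromEdgeSet (↑F : Set (Sym2 V))).IsAcyclic) (hF : F' ⊆ F) :
    (SimpleGraph.fromEdgeSet (↑F' : Set (Sym2 V))).IsAcyclic :=
  h.anti (SimpleGraph.fromEdgeSet_mono (by exact_mod_cast hF))

theorem acyclic_insert (h : (SimpleGraph.fromEdgeSet (↑F : Set (Sym2 V))).IsAcyclic)
    (hab : ¬ Reach F a b) :
    (SimpleGraph.fromEdgeSet (↑(insert s(a, b) F) : Set (Sym2 V))).IsAcyclic := by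
  have := h.sup_edge_of_not_reachable hab
  convert this using 1
  rw [SimpleGraph.edge, ← SimpleGraph.fromEdgeSet_union, Finset.coe_insert, Set.union_comm]
  rfl

theorem IsSubtree.not_reach_erase (h : IsSubtree G F) (hxy : s(x, y) ∈ F) :
    ¬ Reach (F.erase s(x, y)) x y :=
  _root_.not_reach_erase h.acyclic (h.adj hxy).ne hxy

/-- Removing one edge leaves at most two parts, those of its two ends. -/
theorem Reach.erase_or (h : Reach F x u) (y : V) :
    Reach (F.erase s(x, y)) x u ∨ Reach (F.erase s(x, y)) y u := by
  refine h.closed (fun z => Reach (F.erase s(x, y)) x z ∨ Reach (F.erase s(x, y)) y z)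
    (fun a b hab ha => ?_) (.inl (Reach.refl _ _))
  by_cases hs : s(a, b) = s(x, y)
  · rcases Sym2.eq_iff.1 hs with ⟨rfl, rfl⟩ | ⟨rfl, rfl⟩
    exacts [.inr (Reach.refl _ _), .inl (Reach.refl _ _)]
  · have := Reach.of_mem (Finset.mem_erase.2 ⟨hs, hab⟩)
    exact ha.imp (·.trans this) (·.trans this)

theorem IsSubtree.insert_pendant (h : IsSubtree G F) (huw : G.Adj u w) (hu : Touches F u)
    (hw : ¬ Touches F w) : IsSubtree G (insert s(u, w) F) where
  sub := by
    intro e he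
    rcases Finset.mem_insert.1 he with rfl | he
    exacts [huw, h.sub e he]
  acyclic := acyclic_insert h.acyclic fun hr => hw (hr.touches huw.ne)
  conn := by
    have key : ∀ z, Touches (insert s(u, w) F) z → Reach (insert s(u, w) F) u z := by
      rintro z ⟨e, he, hz⟩
      rcases Finset.mem_insert.1 he with rfl | he
      · rcases Sym2.mem_iff.1 hz with rfl | rfl
        exacts [Reach.refl _ _, Reach.of_mem (Finset.mem_insert_self _ _)]
      · exact (h.reach hu ⟨e, he, hz⟩).mono (Finset.subset_insert _ _)
    exact fun a b ha hb => (key a ha).symm.trans (key b hb)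

section Leaf

variable (h : IsSubtree G F) (hvy : s(v, y) ∈ F) (hv : ∀ e ∈ F, v ∈ e → e = s(v, y))
include h hvy hv

theorem IsSubtree.reach_erase_leaf (hab : Reach F a b) (ha : a ≠ v) (hb : b ≠ v) :
    Reach (F.erase s(v, y)) a b := by
  have hne := (h.adj hvy).ne
  -- A walk enters and leaves `v` through `y` only. While it stays at `v`, the invariant remembers
  -- that `y` was reached without the erased edge.
  have := hab.closed (fun z => (z = v ∧ Reach (F.erase s(v, y)) a y) ∨
    (z ≠ v ∧ Reach (F.erase s(v, y)) a z)) (fun p q hpq hp => ?_) (.inr ⟨ha, Reach.refl _ _⟩)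
  · rcases this with ⟨h1, _⟩ | ⟨_, h2⟩
    exacts [absurd h1 hb, h2]
  · by_cases hs : s(p, q) = s(v, y)
    · rcases Sym2.eq_iff.1 hs with ⟨rfl, rfl⟩ | ⟨rfl, rfl⟩
      · rcases hp with ⟨_, h2⟩ | ⟨h1, _⟩
        exacts [.inr ⟨hne.symm, h2⟩, absurd rfl h1]
      · rcases hp with ⟨h1, _⟩ | ⟨_, h2⟩
        exacts [absurd h1.symm hne, .inl ⟨rfl, h2⟩]
    · have hp' : p ≠ v := by rintro rfl; exact hs (hv _ hpq (Sym2.mem_mk_left _ _))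
      have hq' : q ≠ v := by rintro rfl; exact hs (hv _ hpq (Sym2.mem_mk_right _ _))
      rcases hp with ⟨h1, _⟩ | ⟨_, h2⟩
      exacts [absurd h1 hp', .inr ⟨hq', h2.trans (Reach.of_mem (Finset.mem_erase.2 ⟨hs, hpq⟩))⟩]

theorem IsSubtree.not_touches_erase_leaf : ¬ Touches (F.erase s(v, y)) v := by
  rintro ⟨e, he, hz⟩
  exact (Finset.mem_erase.1 he).1 (hv e (Finset.mem_erase.1 he).2 hz)

theorem IsSubtree.erase_leaf : IsSubtree G (F.erase s(v, y)) where
  sub := fun e he => h.sub e (Finset.mem_of_mem_erase he)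
  acyclic := acyclic_mono h.acyclic (Finset.erase_subset _ _)
  conn := fun a b ha hb => by
    refine h.reach_erase_leaf hvy hv (h.conn a b (Touches.mono (Finset.erase_subset _ _) ha)
      (Touches.mono (Finset.erase_subset _ _) hb)) ?_ ?_
    · rintro rfl; exact h.not_touches_erase_leaf hvy hv ha
    · rintro rfl; exact h.not_touches_erase_leaf hvy hv hb

/-- Only `y` is in danger of losing its last edge. A second edge of `F` has an end that remains
joined to `y`, so `y` keeps an edge. -/
theorem IsSubtree.touches_erase_leaf (h2 : 2 ≤ F.card) (hz : Touches F z) (hzv : z ≠ v) :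
    Touches (F.erase s(v, y)) z := by
  have hne := (h.adj hvy).ne
  obtain ⟨e, he, hze⟩ := hz
  by_cases hs : e = s(v, y)
  · subst hs
    obtain rfl := (Sym2.mem_iff.1 hze).resolve_left hzv
    obtain ⟨e', he', hne'⟩ := Finset.exists_mem_ne (by omega : 1 < F.card) s(v, z)
    induction e' with
    | _ p q =>
      have hp : p ≠ v := by rintro rfl; exact hne' (hv _ he' (Sym2.mem_mk_left _ _))
      have he'' : s(p, q) ∈ F.erase s(v, z) := Finset.mem_erase.2 ⟨hne', he'⟩
      by_cases hpz : p = z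
      · subst hpz; exact touches_left he''
      · exact (h.reach_erase_leaf hvy hv (h.reach (touches_left he') (touches_right hvy))
          hp hzv).touches hpz
  · exact ⟨e, Finset.mem_erase.2 ⟨hs, he⟩, hze⟩

end Leaf

/-- Replacing an edge of a tree by another edge between the two parts gives a tree on the same
vertices. -/
theorem IsSubtree.exchange (h : IsSubtree G F) (hxy : s(x, y) ∈ F)
    (ha : Reach (F.erase s(x, y)) x a) (hb : ¬ Reach (F.erase s(x, y)) x b) (hab : G.Adj a b)
    (hbF : Touches F b) :
    IsSubtree G (insert s(a, b) (F.erase s(x, y))) ∧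
      ∀ z, Touches F z → Touches (insert s(a, b) (F.erase s(x, y))) z := by
  set E := F.erase s(x, y)
  have hx : Touches F x := touches_left hxy
  have hy : Touches F y := touches_right hxy
  have hyb : Reach E y b := ((h.reach hx hbF).erase_or y).resolve_left hb
  have hEI : E ⊆ insert s(a, b) E := Finset.subset_insert _ _
  have rab : Reach (insert s(a, b) E) a b := Reach.of_mem (Finset.mem_insert_self _ _)
  -- The removed edge is bypassed through `s(a, b)`, so whatever `F` joins stays joined.
  have rxy : Reach (insert s(a, b) E) x y :=
    ((ha.mono hEI).trans rab).trans (hyb.mono hEI).symm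
  have key : ∀ p q, s(p, q) ∈ F → Reach (insert s(a, b) E) p q := by
    intro p q hpq
    by_cases hs : s(p, q) = s(x, y)
    · rcases Sym2.eq_iff.1 hs with ⟨rfl, rfl⟩ | ⟨rfl, rfl⟩
      exacts [rxy, rxy.symm]
    · exact Reach.of_mem (hEI (Finset.mem_erase.2 ⟨hs, hpq⟩))
  have touch : ∀ z, Touches (insert s(a, b) E) z → Touches F z := by
    rintro z ⟨e, he, hz⟩
    rcases Finset.mem_insert.1 he with rfl | he
    · rcases Sym2.mem_iff.1 hz with rfl | rfl
      · by_cases hxz : x = z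
        · exact hxz ▸ hx
        · exact Touches.mono (Finset.erase_subset _ _) (ha.touches hxz)
      · exact hbF
    · exact ⟨e, Finset.mem_of_mem_erase he, hz⟩
  refine ⟨⟨?_, acyclic_insert (acyclic_mono h.acyclic (Finset.erase_subset _ _))
    fun hr => hb (ha.trans hr), ?_⟩, ?_⟩
  · intro e he
    rcases Finset.mem_insert.1 he with rfl | he
    exacts [hab, h.sub e (Finset.mem_of_mem_erase he)]
  · exact fun p q hp hq => (h.reach (touch p hp) (touch q hq)).of_forall key
  · intro z hz
    obtain ⟨q, hq⟩ := hz.exists_mem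
    exact (key z q hq).symm.touches (h.adj hq).ne.symm

/-- Replacing an edge of a tree by a path of length two through an outside vertex. -/
theorem IsSubtree.exchange_path (h : IsSubtree G F) (hxy : s(x, y) ∈ F)
    (ha : Reach (F.erase s(x, y)) x a) (hb : ¬ Reach (F.erase s(x, y)) x b) (haw : G.Adj a w)
    (hwb : G.Adj w b) (hw : ¬ Touches F w) (hbF : Touches F b) :
    IsSubtree G (insert s(a, w) (insert s(w, b) (F.erase s(x, y)))) ∧
      ∀ z, Touches F z → Touches (insert s(a, w) (insert s(w, b) (F.erase s(x, y)))) z := by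
  have hne : s(w, b) ≠ s(x, y) := by rintro h'; rw [← h'] at hxy; exact hw (touches_left hxy)
  have hwx : w ≠ x := by rintro rfl; exact hw (touches_left hxy)
  -- First `w` is hung on `b` as a pendant vertex. It then lies in the part of `y`, and the path
  -- exchange becomes an ordinary exchange with the edge `s(a, w)`.
  have h' : IsSubtree G (insert s(w, b) F) := by
    rw [Sym2.eq_swap]; exact h.insert_pendant hwb.symm hbF hw
  have hE : (insert s(w, b) F).erase s(x, y) = insert s(w, b) (F.erase s(x, y)) :=
    Finset.erase_insert_of_ne hne
  have hwE : ¬ Reach (F.erase s(x, y)) x w := fun hr =>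
    hw (Touches.mono (Finset.erase_subset _ _) (hr.touches hwx.symm))
  have hnr : ¬ Reach ((insert s(w, b) F).erase s(x, y)) x w := by
    rw [hE]
    intro hr
    refine hwE (hr.closed (fun z => Reach (F.erase s(x, y)) x z) (fun p q hpq hp => ?_)
      (Reach.refl _ _))
    rcases Finset.mem_insert.1 hpq with hs | hpq
    · rcases Sym2.eq_iff.1 hs with ⟨rfl, rfl⟩ | ⟨rfl, rfl⟩
      exacts [absurd hp hwE, absurd hp hb]
    · exact hp.trans (Reach.of_mem hpq)
  have := h'.exchange (Finset.mem_insert_of_mem hxy)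
    (ha.mono (Finset.erase_subset_erase _ (Finset.subset_insert _ _))) hnr haw
    (touches_left (Finset.mem_insert_self _ _))
  rw [hE] at this
  exact ⟨this.1, fun z hz => this.2 z (hz.mono (Finset.subset_insert _ _))⟩

/-- The part of a tree behind an edge contains a leaf. -/
theorem IsSubtree.exists_leaf [Fintype V] (h : IsSubtree G F) (hxy : s(x, y) ∈ F) :
    ∃ z, Reach (F.erase s(x, y)) x z ∧ edgeDeg F z = 1 := by
  classical
  obtain ⟨k, hk⟩ : ∃ k, (Finset.univ.filter fun z => Reach (F.erase s(x, y)) x z).card = k := ⟨_, rfl⟩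
  induction k using Nat.strong_induction_on generalizing x y with
  | _ k ih =>
    by_cases h1 : edgeDeg F x = 1
    · exact ⟨x, Reach.refl _ _, h1⟩
    · have : ∃ e ∈ F, x ∈ e ∧ e ≠ s(x, y) := by
        by_contra hcon
        push Not at hcon
        exact h1 (edgeDeg_eq_one.2 ⟨y, hxy, hcon⟩)
      obtain ⟨e, he, hxe, hne⟩ := this
      obtain ⟨z, rfl⟩ := Sym2.mem_iff_exists.1 hxe
      rw [Sym2.eq_swap] at he
      have hnx : ¬ Reach (F.erase s(z, x)) z x := h.not_reach_erase he
      have hxz : Reach (F.erase s(x, y)) x z :=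
        Reach.of_mem (Finset.mem_erase.2 ⟨hne, by rwa [Sym2.eq_swap]⟩)
      -- Walking on from `x` to `z`, the part behind the new edge lies inside the old part and
      -- misses `x`, so the induction descends.
      have hsub : ∀ p, Reach (F.erase s(z, x)) z p → Reach (F.erase s(x, y)) x p := by
        intro p hp
        refine (hp.closed (fun q => Reach (F.erase s(z, x)) z q ∧ Reach (F.erase s(x, y)) x q)
          (fun q r hqr hq => ?_) ⟨Reach.refl _ _, hxz⟩).2
        have hzr := hq.1.trans (Reach.of_mem hqr)
        refine ⟨hzr, hq.2.trans (Reach.of_mem (Finset.mem_erase.2 ⟨?_, Finset.mem_of_mem_erase hqr⟩))⟩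
        intro hs
        rcases Sym2.eq_iff.1 hs with ⟨rfl, rfl⟩ | ⟨rfl, rfl⟩
        exacts [hnx hq.1, hnx hzr]
      obtain ⟨l, hl, hd⟩ := ih _ (by
        rw [← hk]
        refine Finset.card_lt_card (Finset.ssubset_iff_of_subset ?_ |>.2 ⟨x, ?_, ?_⟩)
        · intro p hp
          simpa using hsub p (by simpa using hp)
        · simpa using Reach.refl _ _
        · simpa using hnx) he rfl
      exact ⟨l, hsub l hl, hd⟩

/-! ### Minimal solutions as covering trees with restricted leaves. -/

theorem IsSubtree.covers_erase_leaf (h : IsSubtree G F) (hc : Covers G F)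
    (h2 : 2 ≤ F.card) (hvy : s(v, y) ∈ F) (hv : ∀ e ∈ F, v ∈ e → e = s(v, y))
    (ho : ∀ w, G.Adj v w → Touches F w) : Covers G (F.erase s(v, y)) := by
  intro a b hab
  by_cases ha : a = v
  · subst ha
    exact .inr (h.touches_erase_leaf hvy hv h2 (ho b hab) hab.ne.symm)
  by_cases hb : b = v
  · subst hb
    exact .inl (h.touches_erase_leaf hvy hv h2 (ho a hab.symm) hab.ne)
  exact (hc a b hab).imp (h.touches_erase_leaf hvy hv h2 · ha) (h.touches_erase_leaf hvy hv h2 · hb)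

/-- After dropping `f`, both ends of `f` must still be touched: an end that is not was a leaf, and
the edge to its outside neighbour would be uncovered. But then connectedness contradicts that `f` is
a bridge. -/
theorem isMinimalCEDS_of_leaves (h : IsSubtree G F) (hc : Covers G F)
    (hl : ∀ v, edgeDeg F v = 1 → ∃ w, G.Adj v w ∧ ¬ Touches F w) : IsMinimalCEDS G F := by
  refine ⟨h.isCEDS hc, fun f hf hE => ?_⟩
  obtain ⟨⟨_, hcov⟩, hconn⟩ := isCEDS_iff.1 hE
  have key : ∀ p q, s(p, q) = f → Touches (F.erase f) p := by
    intro p q hpq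
    by_contra hcon
    have : edgeDeg F p = 1 := by
      refine edgeDeg_eq_one.2 ⟨q, hpq ▸ hf, fun e he hpe => ?_⟩
      by_contra hne
      exact hcon ⟨e, Finset.mem_erase.2 ⟨hpq ▸ hne, he⟩, hpe⟩
    obtain ⟨w, hw, hw'⟩ := hl p this
    rcases hcov p w hw with h1 | h1
    exacts [hcon h1, hw' (h1.mono (Finset.erase_subset _ _))]
  induction f with
  | _ x y => exact h.not_reach_erase hf (hconn x y (key x y rfl) (key y x Sym2.eq_swap))

theorem IsMinimalCEDS.covers (h : IsMinimalCEDS G F) : Covers G F := (isCEDS_iff.1 h.1).1.2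

/-- If the ends of an edge remain joined without it, dropping it changes neither the touched
vertices nor connectedness, so every edge is a bridge. -/
theorem IsMinimalCEDS.isSubtree (h : IsMinimalCEDS G F) : IsSubtree G F := by
  obtain ⟨⟨hsub, hcov⟩, hconn⟩ := isCEDS_iff.1 h.1
  refine ⟨hsub, acyclic_of_not_reach fun x y hxy hne hr => h.2 _ hxy ?_, hconn⟩
  have key : ∀ p q, s(p, q) ∈ F → Reach (F.erase s(x, y)) p q := by
    intro p q hpq
    by_cases hs : s(p, q) = s(x, y)
    · rcases Sym2.eq_iff.1 hs with ⟨rfl, rfl⟩ | ⟨rfl, rfl⟩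
      exacts [hr, hr.symm]
    · exact Reach.of_mem (Finset.mem_erase.2 ⟨hs, hpq⟩)
  have touch : ∀ z, Touches F z → Touches (F.erase s(x, y)) z := by
    intro z hz
    obtain ⟨q, hq⟩ := hz.exists_mem
    exact (key z q hq).symm.touches (show G.Adj z q from hsub _ hq).ne.symm
  refine isCEDS_iff.2 ⟨⟨fun e he => hsub e (Finset.mem_of_mem_erase he),
    fun a b hab => (hcov a b hab).imp (touch a) (touch b)⟩, fun a b ha hb => ?_⟩
  exact Reach.of_forall (hconn a b (Touches.mono (Finset.erase_subset _ _) ha)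
    (Touches.mono (Finset.erase_subset _ _) hb)) key

theorem IsMinimalCEDS.leaf (h : IsMinimalCEDS G F) (h2 : 2 ≤ F.card) (hv : edgeDeg F v = 1) :
    ∃ w, G.Adj v w ∧ ¬ Touches F w := by
  obtain ⟨y, hvy, hy⟩ := edgeDeg_eq_one.1 hv
  have ht := h.isSubtree
  by_contra hcon
  push Not at hcon
  exact h.2 _ hvy ((ht.erase_leaf hvy hy).isCEDS
    (ht.covers_erase_leaf h.covers h2 hvy hy hcon))

/-- Minimality only speaks of single edges, so this needs an argument. A leaf of `T` has a neighbour
outside `T`, hence outside `X`, so `X` must touch the leaf. For `f` in `T` but not in `X`, leaves of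
`T` on both sides of `f` are then joined by `X` inside `T` without `f`. -/
theorem IsMinimalCEDS.eq_of_subset [Fintype V] (hX : IsMinimalCEDS G X) (hT : IsMinimalCEDS G T)
    (h2 : 2 ≤ T.card) (hXT : X ⊆ T) : X = T := by
  by_contra hne
  obtain ⟨f, hfT, hfX⟩ := Finset.exists_of_ssubset (Finset.ssubset_iff_subset_ne.2 ⟨hXT, hne⟩)
  have ht := hT.isSubtree
  induction f with
  | _ x y =>
    have key : ∀ z, edgeDeg T z = 1 → Touches X z := by
      intro z hz
      obtain ⟨w, hw, hw'⟩ := hT.leaf h2 hz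
      exact (hX.covers z w hw).resolve_right fun h => hw' (h.mono hXT)
    obtain ⟨p, hp, hp'⟩ := ht.exists_leaf hfT
    obtain ⟨q, hq, hq'⟩ := ht.exists_leaf (x := y) (y := x) (by rwa [Sym2.eq_swap])
    rw [Sym2.eq_swap] at hq
    have := (hX.isSubtree.reach (key p hp') (key q hq')).mono
      (F' := T.erase s(x, y)) fun e he => Finset.mem_erase.2 ⟨fun h => hfX (h ▸ he), hXT he⟩
    exact ht.not_reach_erase hfT ((hp.trans this).trans hq.symm)

/-- The sets with property `S` include a subset of the result of each move that starts at `X`. -/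
def MoveClosed (G : SimpleGraph V) (S : Finset (Sym2 V) → Prop) (X : Finset (Sym2 V)) : Prop :=
  (∀ v, edgeDeg X v = 1 → (∀ w, G.Adj v w → ¬ Touches X w → ∃ u, G.Adj w u ∧ u ≠ v) →
    ∃ F, S F ∧ ∀ z, Touches F z → (Touches X z ∨ G.Adj v z) ∧ z ≠ v) ∧
  ∀ f ∈ X, ∃ x y, f = s(x, y) ∧ ∀ a w, Reach (X.erase f) x a → ¬ Reach (X.erase f) x w →
    G.Adj a w →
      (Touches X w → ∃ F, S F ∧ F ⊆ insert s(a, w) (X.erase f)) ∧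
      (¬ Touches X w → ∀ b, G.Adj w b → ¬ Reach (X.erase f) x b →
        ∃ F, S F ∧ F ⊆ insert s(a, w) (insert s(w, b) (X.erase f)))

theorem MoveClosed.mono {S S' : Finset (Sym2 V) → Prop} (h : MoveClosed G S X)
    (hS : ∀ F, S F → S' F) : MoveClosed G S' X := by
  refine ⟨fun v hv hw => ?_, fun f hf => ?_⟩
  · obtain ⟨F, hF, h'⟩ := h.1 v hv hw
    exact ⟨F, hS F hF, h'⟩
  · obtain ⟨x, y, rfl, h'⟩ := h.2 f hf
    refine ⟨x, y, rfl, fun a w ha hw haw => ⟨fun ht => ?_, fun ht b hwb hb => ?_⟩⟩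
    · obtain ⟨F, hF, h''⟩ := (h' a w ha hw haw).1 ht
      exact ⟨F, hS F hF, h''⟩
    · obtain ⟨F, hF, h''⟩ := (h' a w ha hw haw).2 ht b hwb hb
      exact ⟨F, hS F hF, h''⟩

/-- A nonempty family of minimal connected edge dominating sets that is closed under moves
contains all of them. -/
theorem of_moveClosed [Fintype V] (h2 : ∀ F, IsCEDS G F → 2 ≤ F.card)
    {S : Finset (Sym2 V) → Prop} (hmin : ∀ X, S X → IsMinimalCEDS G X)
    (hmove : ∀ X, S X → MoveClosed G S X) (hT : IsMinimalCEDS G T) (hX : S X) : S T := by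
  classical
  have ht := hT.isSubtree
  let A : Finset (Sym2 V) → Finset V := fun X =>
    Finset.univ.filter fun z => Touches X z ∧ ¬ Touches T z
  -- This weight is the lexicographic order on the numbers of vertices and of edges of `X` outside
  -- `T`; the factor exceeds every possible second entry.
  obtain ⟨k, hk⟩ : ∃ k, (A X).card * (Fintype.card (Sym2 V) + 1) + (X \ T).card = k := ⟨_, rfl⟩
  induction k using Nat.strong_induction_on generalizing X with
  | _ k ih =>
    have hXm := hmin X hX
    have hx := hXm.isSubtree
    have memA : ∀ Y z, z ∈ A Y ↔ Touches Y z ∧ ¬ Touches T z := fun Y z => by simp [A]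
    by_cases hleaf : ∃ v, edgeDeg X v = 1 ∧ ¬ Touches T v
    · obtain ⟨v, hv, hvT⟩ := hleaf
      have cov : ∀ w, G.Adj v w → Touches T w := fun w hw =>
        (hT.covers v w hw).resolve_left hvT
      -- The leaf move is possible: a neighbour `w` of `v` lies on an edge of `T`, whose other end
      -- is not `v` because `T` avoids `v`.
      obtain ⟨F, hF, hFz⟩ := (hmove X hX).1 v hv fun w hw _ => by
        obtain ⟨u, hu⟩ := (cov w hw).exists_mem
        exact ⟨u, ht.adj hu, fun h => hvT (h ▸ touches_right hu)⟩
      refine ih _ ?_ hF rfl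
      have hlt : (A F).card < (A X).card := by
        refine Finset.card_lt_card (Finset.ssubset_iff_of_subset ?_ |>.2 ⟨v, ?_, ?_⟩)
        · intro z hz
          rw [memA] at hz ⊢
          exact ⟨(hFz z hz.1).1.resolve_right fun h => hz.2 (cov z h), hz.2⟩
        · obtain ⟨y, hy, _⟩ := edgeDeg_eq_one.1 hv
          exact (memA _ _).2 ⟨touches_left hy, hvT⟩
        · rw [memA]
          exact fun h => (hFz v h.1).2 rfl
      have hb : (F \ T).card ≤ Fintype.card (Sym2 V) := Finset.card_le_univ _
      have : ((A F).card + 1) * (Fintype.card (Sym2 V) + 1) ≤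
          (A X).card * (Fintype.card (Sym2 V) + 1) := Nat.mul_le_mul_right _ hlt
      rw [add_mul] at this
      omega
    · push Not at hleaf
      by_cases hXT : X ⊆ T
      · rwa [← hXm.eq_of_subset hT (h2 T hT.1) hXT]
      obtain ⟨f, hfX, hfT⟩ := Finset.not_subset.1 hXT
      obtain ⟨x, y, rfl, hmv⟩ := (hmove X hX).2 f hfX
      -- A found set made of edges of `X` other than `f` and edges of `T` has no new vertices
      -- outside `T` and has lost the edge `f` outside `T`, so its weight is smaller.
      have hdec : ∀ F, S F → (∀ e ∈ F, e ∈ X.erase s(x, y) ∨ e ∈ T) → S T := by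
        intro F hF hsub
        refine ih _ ?_ hF rfl
        have h1 : (A F).card ≤ (A X).card := by
          refine Finset.card_le_card fun z hz => ?_
          rw [memA] at hz ⊢
          obtain ⟨e, he, hze⟩ := hz.1
          rcases hsub e he with h | h
          exacts [⟨⟨e, Finset.mem_of_mem_erase h, hze⟩, hz.2⟩, absurd ⟨e, h, hze⟩ hz.2]
        have h3 : (F \ T).card < (X \ T).card := by
          refine Finset.card_lt_card (Finset.ssubset_iff_of_subset ?_ |>.2
            ⟨s(x, y), Finset.mem_sdiff.2 ⟨hfX, hfT⟩, ?_⟩)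
          · intro e he
            rw [Finset.mem_sdiff] at he ⊢
            exact ⟨Finset.mem_of_mem_erase ((hsub e he.1).resolve_right he.2), he.2⟩
          · intro he
            rw [Finset.mem_sdiff] at he
            rcases hsub _ he.1 with h | h
            exacts [(Finset.mem_erase.1 h).1 rfl, hfT h]
        have := Nat.mul_le_mul_right (Fintype.card (Sym2 V) + 1) h1
        omega
      obtain ⟨p, hp, hp'⟩ := hx.exists_leaf hfX
      obtain ⟨q, hq, hq'⟩ := hx.exists_leaf (x := y) (y := x) (by rwa [Sym2.eq_swap])
      rw [Sym2.eq_swap] at hq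
      have hqx : ¬ Reach (X.erase s(x, y)) x q := fun h =>
        hx.not_reach_erase hfX (h.trans hq.symm)
      by_contra hcon
      -- A path of `T` from `p` to `q` is followed. If no exchange helped, it could never get
      -- further than the part of `x` and the outside vertices that `T` joins to this part by one
      -- edge. But `q` is in `X` and on the other side.
      have := (ht.reach (hleaf p hp') (hleaf q hq')).closed
        (fun z => Reach (X.erase s(x, y)) x z ∨
          (¬ Touches X z ∧ ¬ Reach (X.erase s(x, y)) x z ∧
            ∃ a, Reach (X.erase s(x, y)) x a ∧ s(a, z) ∈ T)) ?_ (.inl hp)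
      · rcases this with h | ⟨h, _⟩
        · exact hqx h
        · rw [← edgeDeg_eq_zero] at h
          omega
      · rintro c d hcd (hc | ⟨hc, hc', a, ha, hac⟩)
        · by_cases hd : Reach (X.erase s(x, y)) x d
          · exact .inl hd
          · refine .inr ⟨fun hdX => hcon ?_, hd, c, hc, hcd⟩
            obtain ⟨F, hF, hF'⟩ := (hmv c d hc hd (ht.adj hcd)).1 hdX
            refine hdec F hF fun e he => ?_
            rcases Finset.mem_insert.1 (hF' he) with rfl | h
            exacts [.inr hcd, .inl h]
        · by_contra hd
          push Not at hd
          refine hcon ?_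
          obtain ⟨F, hF, hF'⟩ := (hmv a c ha hc' (ht.adj hac)).2 hc d (ht.adj hcd) hd.1
          refine hdec F hF fun e he => ?_
          rcases Finset.mem_insert.1 (hF' he) with rfl | h
          · exact .inr hac
          rcases Finset.mem_insert.1 h with rfl | h
          exacts [.inr hcd, .inl h]

end Trees

/-! ### Degrees under edge changes, and the size of a subtree. -/

section Counting

variable {V : Type*} [DecidableEq V] {G : SimpleGraph V} {F : Finset (Sym2 V)} {v : V} {e : Sym2 V}

theorem edgeDeg_insert (he : e ∉ F) :
    edgeDeg (insert e F) v = edgeDeg F v + if v ∈ e then 1 else 0 := by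
  rw [edgeDeg, Finset.filter_insert]
  split_ifs with h
  · rw [Finset.card_insert_of_notMem (by simp [he]), edgeDeg]
  · rfl

theorem edgeDeg_erase (he : e ∈ F) :
    edgeDeg (F.erase e) v = edgeDeg F v - if v ∈ e then 1 else 0 := by
  have := edgeDeg_insert (v := v) (Finset.notMem_erase e F)
  rw [Finset.insert_erase he] at this
  omega

theorem edgeDeg_le_card : edgeDeg F v ≤ F.card := Finset.card_filter_le _ _

/-- The tree extends to a spanning tree of the complete graph. This bound puts `n`, and not another
`m`, into the delay. -/
theorem IsSubtree.card_le [Fintype V] (h : IsSubtree G F) : F.card ≤ Fintype.card V := by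
  rcases isEmpty_or_nonempty V with hV | hV
  · rw [Finset.card_eq_zero.2 (Finset.eq_empty_of_forall_notMem fun e => ?_)]
    · exact Nat.zero_le _
    · induction e with | _ a b => exact hV.elim a
  obtain ⟨T, hFT, -, hT⟩ := (SimpleGraph.connected_top (V := V)).exists_isTree_le_of_le_of_isAcyclic
    le_top h.acyclic
  classical
  have h1 := hT.card_edgeFinset
  have h2 : F ⊆ T.edgeFinset := by
    intro e he
    rw [SimpleGraph.mem_edgeFinset]
    induction e with
    | _ a b => exact hFT ((SimpleGraph.fromEdgeSet_adj _).2 ⟨he, (h.adj he).ne⟩)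
  have := Finset.card_le_card h2
  omega

end Counting

/-! ### The input graph as arrays -/

section Input

variable {n : ℕ} [NeZero n]

/-- The vertex of a half-edge. Edge number `i` has the half-edges `2 * i` and `2 * i + 1`. -/
def halfEnd (L : List (Fin n × Fin n)) (h : ℕ) : Fin n :=
  if h % 2 = 0 then (L.getD (h / 2) (0, 0)).1 else (L.getD (h / 2) (0, 0)).2

/-- The opposite vertex of a half-edge. -/
def halfOpp (L : List (Fin n × Fin n)) (h : ℕ) : Fin n :=
  if h % 2 = 0 then (L.getD (h / 2) (0, 0)).2 else (L.getD (h / 2) (0, 0)).1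

/-- Edge number `i`. -/
def edgeNo (L : List (Fin n × Fin n)) (i : ℕ) : Sym2 (Fin n) :=
  s((L.getD i (0, 0)).1, (L.getD i (0, 0)).2)

/-- The array `A` is the characteristic function of `F`. -/
def RepSet (L : List (Fin n × Fin n)) (A : ℕ → ℕ) (F : Finset (Sym2 (Fin n))) : Prop :=
  ∀ i < L.length, A i = if edgeNo L i ∈ F then 1 else 0

/-- The array `D` holds the degrees of the vertices in `F`. -/
def RepDeg (D : ℕ → ℕ) (F : Finset (Sym2 (Fin n))) : Prop := ∀ v : Fin n, D v = edgeDeg F v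

/-- The bound for all numbers in registers and arrays. -/
def bound (L : List (Fin n × Fin n)) : ℕ := 2 ^ (L.length + 3)

/-- Standing assumptions on the input. -/
structure IsInput (G : SimpleGraph (Fin n)) (L : List (Fin n × Fin n)) : Prop where
  listing : IsEdgeListing G L
  conn : G.Connected
  two : ∀ F : Finset (Sym2 (Fin n)), IsCEDS G F → 2 ≤ F.card

variable {G : SimpleGraph (Fin n)} {L : List (Fin n × Fin n)} {F : Finset (Sym2 (Fin n))}

theorem le_bound (L : List (Fin n × Fin n)) : 8 * L.length + 8 ≤ bound L := by
  have : L.length < 2 ^ L.length := Nat.lt_two_pow_self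
  rw [bound, pow_add]; omega

theorem mk_halfEnd_halfOpp (h : ℕ) : s(halfEnd L h, halfOpp L h) = edgeNo L (h / 2) := by
  unfold halfEnd halfOpp edgeNo
  split_ifs
  exacts [rfl, Sym2.eq_swap]

theorem mk_halfEnd_halfOpp_double (i : ℕ) : s(halfEnd L (i + i), halfOpp L (i + i)) = edgeNo L i := by
  rw [mk_halfEnd_halfOpp, show (i + i) / 2 = i by omega]

theorem getElem?_edges (i : ℕ) (e : Sym2 (Fin n)) :
    (L.map fun p => s(p.1, p.2))[i]? = some e ↔ i < L.length ∧ edgeNo L i = e := by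
  rw [List.getElem?_eq_some_iff]
  constructor
  · rintro ⟨h, rfl⟩
    rw [List.length_map] at h
    exact ⟨h, by simp [edgeNo, h]⟩
  · rintro ⟨h, rfl⟩
    exact ⟨by simpa using h, by simp [edgeNo, h]⟩

theorem exists_edgeNo (hL : IsEdgeListing G L) {e : Sym2 (Fin n)} (he : e ∈ G.edgeSet) :
    ∃ i < L.length, edgeNo L i = e := by
  obtain ⟨i, hi⟩ := List.getElem?_of_mem ((hL.2 e).2 he)
  exact ⟨i, (getElem?_edges i e).1 hi⟩

theorem edgeNo_mem (hL : IsEdgeListing G L) {i : ℕ} (hi : i < L.length) :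
    edgeNo L i ∈ G.edgeSet :=
  (hL.2 _).1 (List.mem_of_getElem? ((getElem?_edges i _).2 ⟨hi, rfl⟩))

theorem edgeNo_inj (hL : IsEdgeListing G L) {i j : ℕ} (hi : i < L.length) (hj : j < L.length)
    (h : edgeNo L i = edgeNo L j) : i = j := by
  refine (List.Nodup.getElem_inj_iff hL.1 (hi := by simpa using hi) (hj := by simpa using hj)).1 ?_
  have h1 := (getElem?_edges i _).2 ⟨hi, rfl⟩
  have h2 := (getElem?_edges j _).2 ⟨hj, h.symm⟩
  rw [List.getElem?_eq_some_iff] at h1 h2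
  exact h1.2.trans h2.2.symm

theorem adj_half (hL : IsEdgeListing G L) {h : ℕ} (hh : h < 2 * L.length) :
    G.Adj (halfEnd L h) (halfOpp L h) := by
  rw [← SimpleGraph.mem_edgeSet, mk_halfEnd_halfOpp]
  exact edgeNo_mem hL (by omega)

theorem exists_half (hL : IsEdgeListing G L) {a b : Fin n} (hab : G.Adj a b) :
    ∃ h < 2 * L.length, halfEnd L h = a ∧ halfOpp L h = b := by
  obtain ⟨i, hi, he⟩ := exists_edgeNo hL (e := s(a, b)) hab
  rcases Sym2.eq_iff.1 he with ⟨h1, h2⟩ | ⟨h1, h2⟩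
  · refine ⟨2 * i, by omega, ?_, ?_⟩
    · rw [halfEnd, if_pos (by omega), show 2 * i / 2 = i by omega, h1]
    · rw [halfOpp, if_pos (by omega), show 2 * i / 2 = i by omega, h2]
  · refine ⟨2 * i + 1, by omega, ?_, ?_⟩
    · rw [halfEnd, if_neg (by omega), show (2 * i + 1) / 2 = i by omega, h2]
    · rw [halfOpp, if_neg (by omega), show (2 * i + 1) / 2 = i by omega, h1]

/-- The two ends determine the edge number, and the orientation determines the parity because there
are no loops. -/
theorem half_inj (hL : IsEdgeListing G L) {h h' : ℕ} (hh : h < 2 * L.length)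
    (hh' : h' < 2 * L.length) (h1 : halfEnd L h = halfEnd L h') (h2 : halfOpp L h = halfOpp L h') :
    h = h' := by
  have he : h / 2 = h' / 2 := edgeNo_inj hL (by omega) (by omega) (by
    rw [← mk_halfEnd_halfOpp, ← mk_halfEnd_halfOpp, h1, h2])
  have hne := (adj_half hL hh).ne
  by_contra hcon
  unfold halfEnd halfOpp at *
  rw [← he] at h1
  rcases Nat.mod_two_eq_zero_or_one h with a | a <;> rcases Nat.mod_two_eq_zero_or_one h' with b | b
  · omega
  · simp [a, b] at h1 hne; exact hne h1
  · simp [a, b] at h1 hne; exact hne h1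
  · omega

/-- Without edges the empty set would be a connected edge dominating set with fewer than two edges.
-/
theorem IsInput.pos (hI : IsInput G L) : 0 < L.length := by
  by_contra h
  have h0 : L = [] := List.length_eq_zero_iff.1 (by omega)
  have hE : ∀ e, e ∉ G.edgeSet := fun e he => by
    obtain ⟨i, hi, _⟩ := exists_edgeNo hI.listing he
    omega
  have := hI.two ∅ ⟨⟨by simp, fun f hf => absurd hf (hE f)⟩, by rintro u v ⟨e, he, _⟩; simp at he⟩
  simp at this

theorem IsInput.le (hI : IsInput G L) : n ≤ L.length + 1 := by
  have h1 := hI.conn.card_vert_le_card_edgeSet_add_one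
  have h2 : Nat.card G.edgeSet ≤ L.length := by
    have : Set.ncard G.edgeSet ≤ (Finset.univ.image fun i : Fin L.length => edgeNo L i).card := by
      rw [← Set.ncard_coe_finset]
      refine Set.ncard_le_ncard (fun e he => ?_) (Finset.finite_toSet _)
      obtain ⟨i, hi, rfl⟩ := exists_edgeNo hI.listing he
      simpa using ⟨(⟨i, hi⟩ : Fin _), rfl⟩
    exact this.trans (Finset.card_image_le.trans (by simp))
  simpa using h1.trans (Nat.add_le_add_right h2 1)

theorem IsInput.le_two_mul (hI : IsInput G L) : n ≤ 2 * L.length := by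
  have := hI.pos
  have := hI.le
  omega

/-- Compressed adjacency lists: positions `st v` to `st (v + 1) - 1` of `ad` list the half-edges
at `v`. -/
structure IsAdjacency (G : SimpleGraph (Fin n)) [DecidableRel G.Adj] (L : List (Fin n × Fin n))
    (st ad : ℕ → ℕ) : Prop where
  last : st n ≤ 2 * L.length
  mono : ∀ v < n, st v ≤ st (v + 1)
  width : ∀ v < n, st (v + 1) ≤ st v + G.maxDegree
  mem : ∀ v : Fin n, ∀ j, st v ≤ j → j < st (v + 1) → ad j < 2 * L.length ∧ halfEnd L (ad j) = v
  all : ∀ h < 2 * L.length, ∃ j, st (halfEnd L h) ≤ j ∧ j < st (halfEnd L h + 1) ∧ ad j = h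
  inj : ∀ v : Fin n, ∀ j j', st v ≤ j → j < j' → j' < st (v + 1) → ad j ≠ ad j'

end Input

/-! ### States with loaded input, proof rules for loops, and computing degrees. -/

namespace RAM

variable {n : ℕ} [NeZero n] {G : SimpleGraph (Fin n)} [DecidableRel G.Adj]
  {L : List (Fin n × Fin n)} {F : Finset (Sym2 (Fin n))}

/-- The input has been read, and adjacency lists have been built. -/
structure Loaded (G : SimpleGraph (Fin n)) [DecidableRel G.Adj] (L : List (Fin n × Fin n))
    (σ : Store) : Prop where
  M : σ.reg .M = L.length
  N : σ.reg .N = n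
  full : σ.reg .full = 2 ^ L.length
  en : ∀ h < 2 * L.length, σ.arr .en h = halfEnd L h
  op : ∀ h < 2 * L.length, σ.arr .op h = halfOpp L h
  ei : ∀ h < 2 * L.length, σ.arr .ei h = h / 2
  adj : IsAdjacency G L (σ.arr .st) (σ.arr .ad)

/-- `c` does not touch the input data. -/
def AC.keeps (c : AC) : Bool :=
  !c.wr .M && !c.wr .N && !c.wr .full && !c.wa .en && !c.wa .op && !c.wa .ei && !c.wa .st &&
    !c.wa .ad

theorem Loaded.same {σ τ : Store} {c : AC} (h : Loaded G L σ) (hs : c.Same σ τ)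
    (hc : c.keeps = true) : Loaded G L τ := by
  simp only [AC.keeps, Bool.and_eq_true, Bool.not_eq_true'] at hc
  obtain ⟨⟨⟨⟨⟨⟨⟨h1, h2⟩, h3⟩, h4⟩, h5⟩, h6⟩, h7⟩, h8⟩ := hc
  constructor
  · rw [hs.1 _ h1, h.M]
  · rw [hs.1 _ h2, h.N]
  · rw [hs.1 _ h3, h.full]
  · rw [hs.2.1 _ h4]; exact h.en
  · rw [hs.2.1 _ h5]; exact h.op
  · rw [hs.2.1 _ h6]; exact h.ei
  · rw [hs.2.1 _ h7, hs.2.1 _ h8]; exact h.adj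

theorem Loaded.congr {σ τ : Store} (h : Loaded G L σ) (hr : ∀ r ∈ [Reg.M, .N, .full], τ.reg r = σ.reg r)
    (ha : τ.arr = σ.arr) : Loaded G L τ := by
  constructor
  · rw [hr _ (by simp), h.M]
  · rw [hr _ (by simp), h.N]
  · rw [hr _ (by simp), h.full]
  · rw [ha]; exact h.en
  · rw [ha]; exact h.op
  · rw [ha]; exact h.ei
  · rw [ha]; exact h.adj

theorem Loaded.tick {σ : Store} (h : Loaded G L σ) (t : ℕ) : Loaded G L (σ.tick t) :=
  h.congr (fun _ _ => rfl) rfl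

theorem Loaded.set {σ : Store} (h : Loaded G L σ) {r : Reg} (x : ℕ)
    (hr : r ∉ [Reg.M, .N, .full]) : Loaded G L (σ.set r x) :=
  h.congr (fun r' hr' => by
    rw [Store.set_reg, if_neg]
    rintro rfl; exact hr hr') rfl

theorem Loaded.put {σ : Store} (h : Loaded G L σ) {k : Arr} (i x : ℕ)
    (hk : k ∉ [Arr.en, .op, .ei, .st, .ad]) : Loaded G L (σ.put k i x) := by
  have key : ∀ k' ∈ [Arr.en, .op, .ei, .st, .ad], (σ.put k i x).arr k' = σ.arr k' := by
    intro k' hk'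
    rw [Store.put_arr, if_neg]
    rintro rfl; exact hk hk'
  refine ⟨h.M, h.N, h.full, ?_, ?_, ?_, ?_⟩
  · rw [key _ (by simp)]; exact h.en
  · rw [key _ (by simp)]; exact h.op
  · rw [key _ (by simp)]; exact h.ei
  · rw [key _ (by simp), key _ (by simp)]; exact h.adj

attribute [simp] AE.ev AE.Safe

infixr:60 " ;; " => AC.seq

variable {K : ℕ} {σ : Store} {Q : Store → Prop} {c : AC}

theorem AC.Run.range {r q b : Reg} {u : ℕ} (I : ℕ → Store → Prop)
    (hrq : r ≠ q) (hq : c.wr q = false) (eh : σ.reg b = u)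
    (init : I 0 ((((σ.set q u).tick 1).set r 0).tick 1))
    (step : ∀ i < u, ∀ τ, τ.Bounded K → τ.reg r = i →
      (AC.loop r q (.const 0) (.reg b) c).Same σ τ → I i τ →
      AC.Run K c (τ.tick 1) (fun τ' => I (i + 1) ((τ'.set r (i + 1)).tick 1)))
    (post : ∀ τ, τ.Bounded K → (AC.loop r q (.const 0) (.reg b) c).Same σ τ → I u τ →
      Q (τ.tick 1)) :
    AC.Run K (.loop r q (.const 0) (.reg b) c) σ Q :=
  AC.Run.loop I hrq hq trivial (.inl rfl) trivial (.inl rfl) eh rfl (Nat.zero_le _) init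
    (fun i τ _ hi hb hr _ hs hI => step i hi τ hb hr hs hI) post

/-- Runs through the half-edges at the vertex in register `b`. -/
theorem AC.Run.segment {r q b : Reg} {v l u : ℕ} (I : ℕ → Store → Prop)
    (hrq : r ≠ q) (hqb : b ≠ q) (hq : c.wr q = false)
    (eb : σ.reg b = v) (el : σ.arr .st v = l) (eu : σ.arr .st (v + 1) = u) (hle : l ≤ u)
    (init : I l ((((σ.set q u).tick 1).set r l).tick 1))
    (step : ∀ i, l ≤ i → i < u → ∀ τ, τ.Bounded K → τ.reg r = i →
      (AC.loop r q (.cell .st (.reg b)) (.cell .st (.add (.reg b) (.const 1))) c).Same σ τ → I i τ →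
      AC.Run K c (τ.tick 1) (fun τ' => I (i + 1) ((τ'.set r (i + 1)).tick 1)))
    (post : ∀ τ, τ.Bounded K →
      (AC.loop r q (.cell .st (.reg b)) (.cell .st (.add (.reg b) (.const 1))) c).Same σ τ →
      I u τ → Q (τ.tick 1)) :
    AC.Run K (.loop r q (.cell .st (.reg b)) (.cell .st (.add (.reg b) (.const 1))) c) σ Q :=
  AC.Run.loop I hrq hq (by simp) (.inl rfl) (by simp) (.inl rfl) (by simp [eb, eu])
    (by simp [eb, hqb, el]) hle init
    (fun i τ hl hi hb hr _ hs hI => step i hl hi τ hb hr hs hI) post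

theorem AC.Run.iteNe {a b : AE} {c d : AC} (x y : ℕ) (ha : a.Safe σ) (hb : b.Safe σ)
    (hx : a.ev σ = x) (hy : b.ev σ = y) (hc : x ≠ y → AC.Run K c (σ.tick 1) Q)
    (hd : x = y → AC.Run K d (σ.tick 1) Q) : AC.Run K (.ite (.ne a b) c d) σ Q :=
  AC.Run.ite _ ⟨⟨ha, hb⟩, hb, ha⟩ rfl
    (fun h => hc fun he => h ((AE.ne_ev a b σ).2 (hx.trans (he.trans hy.symm))))
    (fun h => hd (hx.symm.trans (((AE.ne_ev a b σ).1 h).trans hy)))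

/-- Computes the degrees in the edge set `src`. -/
def degrees (src dst : Arr) : AC :=
  .loop .v .vq (.const 0) (.reg .N) (.put dst (.reg .v) (.const 0)) ;;
  .loop .k .kq (.const 0) (.reg .M) (.ite (.cell src (.reg .k))
    (.set .c (.cell .en (.add (.reg .k) (.reg .k))) ;;
     .set .u (.cell .op (.add (.reg .k) (.reg .k))) ;;
     .put dst (.reg .c) (.add (.cell dst (.reg .c)) (.const 1)) ;;
     .put dst (.reg .u) (.add (.cell dst (.reg .u)) (.const 1)))
    .skip)

/-- The edges of `F` with number less than `k`. -/
def below (L : List (Fin n × Fin n)) (F : Finset (Sym2 (Fin n))) (k : ℕ) :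
    Finset (Sym2 (Fin n)) := ((Finset.range k).image (edgeNo L)).filter (· ∈ F)

theorem below_zero : below L F 0 = ∅ := by simp [below]

theorem below_succ (k : ℕ) : below L F (k + 1) =
    if edgeNo L k ∈ F then insert (edgeNo L k) (below L F k) else below L F k := by
  rw [below, Finset.range_add_one, Finset.image_insert, Finset.filter_insert]; rfl

theorem notMem_below (hI : IsInput G L) {k : ℕ} (hk : k < L.length) : edgeNo L k ∉ below L F k := by
  simp only [below, Finset.mem_filter, Finset.mem_image, Finset.mem_range, not_and]
  rintro ⟨j, hj, hjk⟩
  have := edgeNo_inj hI.listing (by omega) hk hjk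
  omega

theorem card_below (F : Finset (Sym2 (Fin n))) (k : ℕ) : (below L F k).card ≤ k :=
  (Finset.card_filter_le _ _).trans (Finset.card_image_le.trans (by simp))

theorem below_length (hI : IsInput G L) (hF : ∀ e ∈ F, e ∈ G.edgeSet) : below L F L.length = F := by
  ext e
  simp only [below, Finset.mem_filter, Finset.mem_image, Finset.mem_range, and_iff_right_iff_imp]
  exact fun he => exists_edgeNo hI.listing (hF e he)

theorem degrees_spec (hI : IsInput G L) (hσ : Loaded G L σ) (hF : ∀ e ∈ F, e ∈ G.edgeSet)
    {src dst : Arr} (hs : RepSet L (σ.arr src) F) (h1 : src ≠ dst) (h2 : dst ≠ .en)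
    (h3 : dst ≠ .op) (h4 : src ≠ .inp) (h5 : dst ≠ .inp) :
    AC.Run (bound L) (degrees src dst) σ fun τ =>
      RepDeg (τ.arr dst) F ∧ τ.clk ≤ σ.clk + 30 * L.length := by
  have hb := le_bound L
  have hn := hI.le_two_mul
  have hm := hI.pos
  refine AC.Run.seq (AC.Run.range (u := n)
    (fun i τ => (∀ v < i, τ.arr dst v = 0) ∧ τ.clk = σ.clk + 2 + 3 * i)
    (by decide) rfl hσ.N (by simp) ?_ ?_)
  · intro i hi τ hB hr hS hInv
    refine AC.Run.put i 0 trivial trivial hr rfl (.inl rfl) ⟨fun v hv => ?_, by simp [hInv.2]; ring⟩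
    simp only [Store.tick_arr, Store.set_arr, Store.put_arr, if_true, Function.update_apply]
    split_ifs with h
    · rfl
    · exact hInv.1 v (by omega)
  · intro τ hB hS hInv
    have hsrc : τ.arr src = σ.arr src := hS.2.1 _ (by simp [AC.wa, h1])
    have hen : τ.arr .en = σ.arr .en := hS.2.1 _ (by simp [AC.wa, h2.symm])
    have hop : τ.arr .op = σ.arr .op := hS.2.1 _ (by simp [AC.wa, h3.symm])
    refine AC.Run.range (u := L.length)
      -- After `k` rounds the array holds the degrees in the part of `F` scanned so far.
      (fun k ρ => (∀ v : Fin n, ρ.arr dst v = edgeDeg (below L F k) v) ∧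
        ρ.clk ≤ σ.clk + 5 + 3 * n + 7 * k)
      (by decide) rfl ((hS.1 .M rfl).trans hσ.M) ?_ ?_ ?_
    · refine ⟨fun v => ?_, by simp [hInv.2]; omega⟩
      simp [hInv.1 v v.2, below_zero, edgeDeg]
    · intro k hk ρ hB' hr hS' hInv'
      have fsrc : ρ.arr src k = if edgeNo L k ∈ F then 1 else 0 := by
        rw [hS'.2.1 src (by simp [AC.wa, h1])]
        simpa [hsrc] using hs k hk
      have fen : ρ.arr .en (k + k) = halfEnd L (k + k) := by
        rw [hS'.2.1 .en (by simp [AC.wa, h2.symm])]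
        simpa [hen] using hσ.en (k + k) (by omega)
      have fop : ρ.arr .op (k + k) = halfOpp L (k + k) := by
        rw [hS'.2.1 .op (by simp [AC.wa, h3.symm])]
        simpa [hop] using hσ.op (k + k) (by omega)
      have hne : halfEnd L (k + k) ≠ halfOpp L (k + k) := (adj_half hI.listing (by omega)).ne
      have hd : ∀ v, edgeDeg (below L F k) v < L.length := fun v =>
        lt_of_le_of_lt (edgeDeg_le_card.trans (card_below F k)) hk
      have hd1 := hd (halfEnd L (k + k))
      have hd2 := hd (halfOpp L (k + k))
      refine AC.Run.ite (if edgeNo L k ∈ F then 1 else 0) (by simp [h4]) (by simp [hr, fsrc])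
        (fun hc => ?_) (fun hc => ?_)
      · have hkF : edgeNo L k ∈ F := by simpa using hc
        refine AC.Run.seq (AC.Run.set (halfEnd L (k + k)) (by simp) (by simp [hr, fen]) (.inl rfl)
          (AC.Run.seq (AC.Run.set (halfOpp L (k + k)) (by simp) (by simp [hr, fop]) (.inl rfl)
          (AC.Run.seq (AC.Run.put (halfEnd L (k + k)) (edgeDeg (below L F k) (halfEnd L (k + k)) + 1)
            (by simp) (by simp [h5]) (by simp) (by simp [hInv'.1]) (.inr (by omega))
          (AC.Run.put (halfOpp L (k + k)) (edgeDeg (below L F k) (halfOpp L (k + k)) + 1)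
            (by simp) (by simp [h5]) (by simp) (by simp [hInv'.1, Fin.val_inj, hne.symm])
            (.inr (by omega)) ⟨fun v => ?_, by simp; omega⟩))))))
        rw [below_succ, if_pos hkF, edgeDeg_insert (notMem_below hI hk)]
        simp only [← mk_halfEnd_halfOpp_double, Sym2.mem_iff]
        simp only [Store.tick_arr, Store.set_arr, Store.put_arr, if_true,
          Function.update_apply, Fin.val_inj, hInv'.1]
        by_cases a1 : v = halfEnd L (k + k)
        · simp [a1, hne]
        · by_cases a2 : v = halfOpp L (k + k) <;> simp [a1, a2, hne.symm]
      · have hkF : edgeNo L k ∉ F := by simpa using hc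
        refine AC.Run.skip ⟨fun v => ?_, by simp; omega⟩
        rw [below_succ, if_neg hkF]
        exact hInv'.1 v
    · intro ρ _ _ hInv'
      refine ⟨fun v => ?_, by simp; omega⟩
      have := hInv'.1 v
      rwa [below_length hI hF] at this

end RAM

/-! ### Codes of edge sets, and pruning -/

section
variable {n : ℕ} [NeZero n] {G : SimpleGraph (Fin n)} {L : List (Fin n × Fin n)}
  {F F' : Finset (Sym2 (Fin n))}

/-- The binary number formed by the first `i` bits of the characteristic function of `F`. -/
def prefixCode (L : List (Fin n × Fin n)) (F : Finset (Sym2 (Fin n))) : ℕ → ℕ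
  | 0 => 0
  | i + 1 => prefixCode L F i + prefixCode L F i + if edgeNo L i ∈ F then 1 else 0

/-- The number encoding an edge set. -/
def codeOf (L : List (Fin n × Fin n)) (F : Finset (Sym2 (Fin n))) : ℕ := prefixCode L F L.length

/-- The first `i` bits are the quotient of the first `i + k` bits by `2 ^ k`; this is what decoding
relies on. -/
theorem prefixCode_bounds (i k : ℕ) : prefixCode L F i * 2 ^ k ≤ prefixCode L F (i + k) ∧
    prefixCode L F (i + k) < (prefixCode L F i + 1) * 2 ^ k := by
  induction k with
  | zero => simp
  | succ k ih =>
    rw [← Nat.add_assoc, prefixCode, pow_succ, ← mul_assoc, ← mul_assoc]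
    split_ifs <;> omega

theorem prefixCode_lt (i : ℕ) : prefixCode L F i < 2 ^ i := by
  simpa [prefixCode] using (prefixCode_bounds (L := L) (F := F) 0 i).2

theorem codeOf_lt : codeOf L F < 2 ^ L.length := prefixCode_lt _

/-- All prefixes are recovered by halving from the full code downwards, and consecutive prefixes
differ by one bit. -/
theorem codeOf_inj (hL : IsEdgeListing G L) (hF : ∀ e ∈ F, e ∈ G.edgeSet)
    (hF' : ∀ e ∈ F', e ∈ G.edgeSet) (h : codeOf L F = codeOf L F') : F = F' := by
  have key : ∀ k ≤ L.length, prefixCode L F (L.length - k) = prefixCode L F' (L.length - k) := by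
    intro k
    induction k with
    | zero => exact fun _ => h
    | succ k ih =>
      intro hk
      have := ih (by omega)
      rw [show L.length - k = (L.length - (k + 1)) + 1 by omega, prefixCode, prefixCode] at this
      split_ifs at this <;> omega
  have key' : ∀ i ≤ L.length, prefixCode L F i = prefixCode L F' i := fun i hi => by
    have := key (L.length - i) (by omega)
    rwa [show L.length - (L.length - i) = i by omega] at this
  have bit : ∀ i < L.length, (edgeNo L i ∈ F ↔ edgeNo L i ∈ F') := by
    intro i hi
    have h1 := key' i (by omega)
    have h2 := key' (i + 1) (by omega)
    rw [prefixCode, prefixCode, h1] at h2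
    by_cases a : edgeNo L i ∈ F <;> by_cases b : edgeNo L i ∈ F' <;> simp_all
  ext e
  constructor
  · intro he
    obtain ⟨i, hi, rfl⟩ := exists_edgeNo hL (hF e he)
    exact (bit i hi).1 he
  · intro he
    obtain ⟨i, hi, rfl⟩ := exists_edgeNo hL (hF' e he)
    exact (bit i hi).2 he

theorem RepSet.erase {A : ℕ → ℕ} (hL : IsEdgeListing G L) (h : RepSet L A F) {i : ℕ}
    (hi : i < L.length) : RepSet L (Function.update A i 0) (F.erase (edgeNo L i)) := by
  intro j hj
  rw [Function.update_apply]
  by_cases hij : j = i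
  · simp [hij]
  · have : edgeNo L j ≠ edgeNo L i := fun h => hij (edgeNo_inj hL hj hi h)
    simp [hij, this, h j hj]

theorem RepSet.insert {A : ℕ → ℕ} (hL : IsEdgeListing G L) (h : RepSet L A F) {i : ℕ}
    (hi : i < L.length) : RepSet L (Function.update A i 1) (insert (edgeNo L i) F) := by
  intro j hj
  rw [Function.update_apply]
  by_cases hij : j = i
  · simp [hij]
  · have : edgeNo L j ≠ edgeNo L i := fun h => hij (edgeNo_inj hL hj hi h)
    simp [hij, this, h j hj]

end

namespace RAM

variable {n : ℕ} [NeZero n] {G : SimpleGraph (Fin n)} [DecidableRel G.Adj]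
  {L : List (Fin n × Fin n)} {F X : Finset (Sym2 (Fin n))} {σ : Store}

/-- Removes leaves without outside neighbours. -/
def prune : AC :=
  .loop .v .vq (.const 0) (.reg .N) (.ite (.ne (.cell .dy (.reg .v)) (.const 1)) .skip
    (.set .flag (.const 0) ;;
     .loop .s .sq (.cell .st (.reg .v)) (.cell .st (.add (.reg .v) (.const 1)))
      (.set .h (.cell .ad (.reg .s)) ;;
       .set .w (.cell .op (.reg .h)) ;;
       .ite (.cell .dy (.reg .w))
        (.set .e (.cell .ei (.reg .h)) ;;
         .ite (.cell .ys (.reg .e)) (.set .c (.reg .e) ;; .set .u (.reg .w)) .skip)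
        (.set .flag (.const 1))) ;;
     .ite (.reg .flag) .skip
      (.put .ys (.reg .c) (.const 0) ;;
       .put .dy (.reg .v) (.const 0) ;;
       .put .dy (.reg .u) (.sub (.cell .dy (.reg .u)) (.const 1)))))

theorem Loaded.half {v : Fin n} (hσ : Loaded G L σ) {j : ℕ} (h1 : σ.arr .st v ≤ j)
    (h2 : j < σ.arr .st (v + 1)) : ∃ h < 2 * L.length, σ.arr .ad j = h ∧ halfEnd L h = v ∧
      σ.arr .op h = halfOpp L h ∧ σ.arr .ei h = h / 2 ∧ edgeNo L (h / 2) = s(v, halfOpp L h) := by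
  obtain ⟨h3, h4⟩ := hσ.adj.mem v j h1 h2
  exact ⟨_, h3, rfl, h4, hσ.op _ h3, hσ.ei _ h3, by rw [← mk_halfEnd_halfOpp, h4]⟩

theorem Loaded.exists_pos {v w : Fin n} (hI : IsInput G L) (hσ : Loaded G L σ) (h : G.Adj v w) :
    ∃ j, σ.arr .st v ≤ j ∧ j < σ.arr .st (v + 1) ∧ halfOpp L (σ.arr .ad j) = w := by
  obtain ⟨i, hi, rfl, rfl⟩ := exists_half hI.listing h
  obtain ⟨j, h1, h2, h3⟩ := hσ.adj.all i hi
  exact ⟨j, h1, h2, by rw [h3]⟩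

/-- One pass suffices. Dropping a leaf `v` can make only its neighbour `y` a new leaf, and `y` then
has `v` as an outside neighbour. Leaves already settled keep their outside neighbours, since the
tree only shrinks. -/
theorem prune_spec (hI : IsInput G L) (hσ : Loaded G L σ) (ht : IsSubtree G F) (hc : Covers G F)
    (hs : RepSet L (σ.arr .ys) F) (hd : RepDeg (σ.arr .dy) F) :
    AC.Run (bound L) prune σ fun τ => ∃ F' ⊆ F, IsMinimalCEDS G F' ∧ RepSet L (τ.arr .ys) F' ∧
      τ.clk ≤ σ.clk + 50 * L.length := by
  have hb := le_bound L
  have hn := hI.le_two_mul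
  have hm := hI.pos
  refine AC.Run.range (u := n) (fun i τ => ∃ F' ⊆ F, IsSubtree G F' ∧ Covers G F' ∧
      RepSet L (τ.arr .ys) F' ∧ RepDeg (τ.arr .dy) F' ∧
      (∀ v : Fin n, (v : ℕ) < i → edgeDeg F' v = 1 → ∃ w, G.Adj v w ∧ ¬ Touches F' w) ∧
      -- The scans of adjacency lists are charged to `st i`, the number of list positions already
      -- passed, so the whole pass is linear in `m`.
      τ.clk ≤ σ.clk + 2 + 11 * i + 9 * σ.arr .st i)
    (by decide) rfl hσ.N ⟨F, subset_rfl, ht, hc, hs, hd, by simp, by simp⟩ ?_ ?_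
  · rintro i hi τ hB hr hS ⟨F', hF', ht', hc', hs', hd', hl', hk'⟩
    have hτ : Loaded G L τ := hσ.same hS rfl
    have fst : σ.arr .st = τ.arr .st := (hS.2.1 .st rfl).symm
    obtain ⟨v, rfl⟩ : ∃ v : Fin n, (v : ℕ) = i := ⟨⟨i, hi⟩, rfl⟩
    have hmono := hτ.adj.mono v v.2
    rw [fst] at hk' ⊢
    refine AC.Run.iteNe (edgeDeg F' v) 1 (by simp) trivial (by simp [hr, hd' v]) rfl (fun h1 => ?_)
      (fun h1 => ?_)
    · refine AC.Run.skip ⟨F', hF', ht', hc', hs', hd', fun x hx hx1 => ?_, by simp; omega⟩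
      rcases Nat.lt_succ_iff_lt_or_eq.1 hx with h | h
      · exact hl' x h hx1
      · rw [Fin.val_inj] at h; subst h; exact absurd hx1 h1
    · obtain ⟨y, hy, hyu⟩ := edgeDeg_eq_one.1 h1
      have hF2 : 2 ≤ F'.card := hI.two _ (ht'.isCEDS hc')
      refine AC.Run.seq (AC.Run.set 0 trivial rfl (.inl rfl) (AC.Run.seq (AC.Run.segment
        (v := v) (l := τ.arr .st v) (u := τ.arr .st (v + 1))
        (fun j ρ => (ρ.reg .flag ≠ 0 → ∃ w, G.Adj v w ∧ ¬ Touches F' w) ∧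
          (ρ.reg .flag = 0 → ∀ j', τ.arr .st v ≤ j' → j' < j →
            Touches F' (halfOpp L (τ.arr .ad j'))) ∧
          -- Once the scan has passed the tree edge at `v`, registers `c` and `u` hold its number
          -- and its other end.
          (∀ j', τ.arr .st v ≤ j' → j' < j → halfOpp L (τ.arr .ad j') = y →
            ρ.reg .c < L.length ∧ edgeNo L (ρ.reg .c) = s(v, y) ∧ ρ.reg .u = y) ∧
          ρ.clk + 9 * τ.arr .st v ≤ τ.clk + 5 + 9 * j)
        (by decide) (by decide) rfl (by simp [hr]) (by simp) (by simp) hmono ?_ ?_ ?_)))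
      · refine ⟨by simp, fun _ j' => by omega, fun j' => by omega, by simp⟩
      · rintro j hj1 hj2 ρ hB' hr' hS' ⟨i1, i2, i3, i4⟩
        obtain ⟨h, hh, e1, e2, e3, e4, e5⟩ := hτ.half hj1 hj2
        have fad : ρ.arr .ad = τ.arr .ad := by simpa using hS'.2.1 .ad rfl
        have fop : ρ.arr .op = τ.arr .op := by simpa using hS'.2.1 .op rfl
        have fei : ρ.arr .ei = τ.arr .ei := by simpa using hS'.2.1 .ei rfl
        have fdy : ρ.arr .dy = τ.arr .dy := by simpa using hS'.2.1 .dy rfl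
        have fys : ρ.arr .ys = τ.arr .ys := by simpa using hS'.2.1 .ys rfl
        have hadj : G.Adj v (halfOpp L h) := e2 ▸ adj_half hI.listing hh
        refine AC.Run.seq (AC.Run.set h (by simp) (by simp [hr', fad, e1]) (.inl rfl)
          (AC.Run.seq (AC.Run.set (halfOpp L h) (by simp) (by simp [fop, e3]) (.inl rfl)
          (AC.Run.ite (edgeDeg F' (halfOpp L h)) (by simp) (by simp [fdy, hd' (halfOpp L h)])
            (fun hx => ?_) (fun hx => ?_)))))
        · have htw : Touches F' (halfOpp L h) := by
            by_contra hcon; exact hx (edgeDeg_eq_zero.2 hcon)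
          refine AC.Run.seq (AC.Run.set (h / 2) (by simp) (by simp [fei, e4]) (.inl rfl)
            (AC.Run.ite (if edgeNo L (h / 2) ∈ F' then 1 else 0) (by simp)
              (by simp [fys, hs' (h / 2) (by omega)]) (fun hz => ?_) (fun hz => ?_)))
          · have hmem : s(v, halfOpp L h) ∈ F' := by simpa [e5] using hz
            have hyy : halfOpp L h = y := Sym2.congr_right.1 (hyu _ hmem (Sym2.mem_mk_left _ _))
            refine AC.Run.seq (AC.Run.set (h / 2) trivial (by simp) (.inl rfl)
              (AC.Run.set (halfOpp L h) trivial (by simp) (.inl rfl) ⟨?_, ?_, ?_, ?_⟩))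
            · simpa using i1
            · intro hf j' h1 h2
              rcases Nat.lt_succ_iff_lt_or_eq.1 h2 with h3 | rfl
              · exact i2 (by simpa using hf) j' h1 h3
              · rw [e1]; exact htw
            · intro j' _ _ _
              simp only [Store.tick_reg, Store.set_reg, reduceCtorEq, if_true, if_false]
              exact ⟨by omega, by rw [e5, hyy], by rw [hyy]⟩
            · simp; omega
          · have hmem : s(v, halfOpp L h) ∉ F' := by simpa [e5] using hz
            refine AC.Run.skip ⟨?_, ?_, ?_, ?_⟩
            · simpa using i1
            · intro hf j' h1 h2
              rcases Nat.lt_succ_iff_lt_or_eq.1 h2 with h3 | rfl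
              · exact i2 (by simpa using hf) j' h1 h3
              · rw [e1]; exact htw
            · intro j' h1 h2 h3
              rcases Nat.lt_succ_iff_lt_or_eq.1 h2 with h4 | rfl
              · simpa using i3 j' h1 h4 h3
              · rw [e1] at h3; rw [h3] at hmem; exact absurd hy hmem
            · simp; omega
        · have htw : ¬ Touches F' (halfOpp L h) := edgeDeg_eq_zero.1 hx
          refine AC.Run.set 1 trivial rfl (.inl rfl) ⟨?_, ?_, ?_, ?_⟩
          · exact fun _ => ⟨_, hadj, htw⟩
          · simp
          · intro j' h1 h2 h3
            rcases Nat.lt_succ_iff_lt_or_eq.1 h2 with h4 | rfl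
            · simpa using i3 j' h1 h4 h3
            · rw [e1] at h3; rw [h3] at htw; exact absurd (touches_right hy) htw
          · simp; omega
      · rintro ρ hB' hS' ⟨i1, i2, i3, i4⟩
        have frv : ρ.reg .v = v := by simpa [hr] using hS'.1 .v rfl
        have fdy : ρ.arr .dy = τ.arr .dy := by simpa using hS'.2.1 .dy rfl
        have fys : ρ.arr .ys = τ.arr .ys := by simpa using hS'.2.1 .ys rfl
        refine AC.Run.ite _ trivial rfl (fun hx => ?_) (fun hx => ?_)
        · refine AC.Run.skip ⟨F', hF', ht', hc', by simpa [fys] using hs', by simpa [fdy] using hd',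
            fun x hx' hx1 => ?_, by simp; omega⟩
          rcases Nat.lt_succ_iff_lt_or_eq.1 hx' with h | h
          · exact hl' x h hx1
          · rw [Fin.val_inj] at h; subst h; exact i1 hx
        · have hall : ∀ w, G.Adj v w → Touches F' w := by
            intro w hw
            obtain ⟨j, h1, h2, rfl⟩ := hτ.exists_pos hI hw
            exact i2 hx j h1 h2
          obtain ⟨j, g1, g2, g3⟩ := hτ.exists_pos hI (ht'.adj hy)
          obtain ⟨c1, c2, c3⟩ := i3 j g1 g2 g3
          have hvy : v ≠ y := (ht'.adj hy).ne
          refine AC.Run.seq (AC.Run.put (ρ.reg .c) 0 trivial trivial rfl rfl (.inl rfl)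
            (AC.Run.seq (AC.Run.put v 0 trivial trivial (by simp [frv]) rfl (.inl rfl)
            (AC.Run.put y (edgeDeg F' y - 1) trivial (by simp) (by simp [c3])
              (by simp [c3, fdy, hd' y, Fin.val_inj, hvy.symm]) (.inr ?_) ?_))))
          · have h0 := hB.2.2 .dy y
            rw [hd' y] at h0
            omega
          refine ⟨F'.erase s(v, y), (Finset.erase_subset _ _).trans hF', ht'.erase_leaf hy hyu,
            ht'.covers_erase_leaf hc' hF2 hy hyu hall, ?_, ?_, ?_, by simp; omega⟩
          · have := (hs'.erase hI.listing c1)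
            rw [c2] at this
            simpa [fys] using this
          · intro x
            rw [edgeDeg_erase hy]
            simp only [Store.tick_arr, Store.set_arr, Store.put_arr, if_true, fdy,
              Function.update_apply, Fin.val_inj, reduceCtorEq, if_false, Sym2.mem_iff]
            by_cases a1 : x = y
            · simp [a1]
            · by_cases a2 : x = v <;> simp [a1, a2, hvy, h1, hd' x]
          · intro x hx' hx1
            by_cases hxv : x = v
            · subst hxv
              exact absurd (edgeDeg_eq_zero.2 (ht'.not_touches_erase_leaf hy hyu)) (by omega)
            by_cases hxy : x = y
            · subst hxy
              exact ⟨v, (ht'.adj hy).symm, ht'.not_touches_erase_leaf hy hyu⟩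
            · rw [edgeDeg_erase hy] at hx1
              simp only [Sym2.mem_iff, hxv, hxy, or_self, if_false, Nat.sub_zero] at hx1
              have hlt : (x : ℕ) < v := lt_of_le_of_ne (by omega) (by rwa [Ne, Fin.val_inj])
              obtain ⟨w, hw, hw'⟩ := hl' x hlt hx1
              exact ⟨w, hw, fun h => hw' (h.mono (Finset.erase_subset _ _))⟩
  · rintro τ hB hS ⟨F', hF', ht', hc', hs', hd', hl', hk'⟩
    have := hσ.adj.last
    exact ⟨F', hF', isMinimalCEDS_of_leaves ht' hc' fun v => hl' v v.2, hs', by simp; omega⟩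

end RAM

/-! ### The stack of the search, and growing trees -/

namespace RAM

variable {n : ℕ} [NeZero n] {G : SimpleGraph (Fin n)} [DecidableRel G.Adj]
  {L : List (Fin n × Fin n)} {F X : Finset (Sym2 (Fin n))} {σ : Store}

/-- `top` points to a linked stack of codes of the listed sets in the table `tb`: entry number
`c` holds one more than the pointer to the element below `c`; pointers are codes plus one. -/
def IsStack (L : List (Fin n × Fin n)) (tb : ℕ → ℕ) : ℕ → List (Finset (Sym2 (Fin n))) → Prop
  | top, [] => top = 0
  | top, F :: l => top = codeOf L F + 1 ∧ IsStack L tb (tb (codeOf L F) - 1) l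

/-- The search has processed the sets in `done`; the sets on the stack `l` have been found in
addition. -/
structure IsSearch (G : SimpleGraph (Fin n)) (L : List (Fin n × Fin n))
    (done l : List (Finset (Sym2 (Fin n)))) (top : ℕ) (tb : ℕ → ℕ) : Prop where
  nodup : (done ++ l).Nodup
  minimal : ∀ F ∈ done ++ l, IsMinimalCEDS G F
  visited : ∀ c, tb c ≠ 0 ↔ ∃ F ∈ done ++ l, codeOf L F = c
  stack : IsStack L tb top l

/-- The search has processed the sets in `done`. -/
def Search (G : SimpleGraph (Fin n)) (L : List (Fin n × Fin n))
    (done : List (Finset (Sym2 (Fin n)))) (σ : Store) : Prop :=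
  ∃ l, IsSearch G L done l (σ.reg .top) (σ.arr .tb)

/-- The minimal connected edge dominating set `F` has been found. -/
def Found (G : SimpleGraph (Fin n)) (L : List (Fin n × Fin n)) (σ : Store)
    (F : Finset (Sym2 (Fin n))) : Prop := IsMinimalCEDS G F ∧ σ.arr .tb (codeOf L F) ≠ 0

/-- The search goes on from `σ` to `τ`. -/
def Extends (G : SimpleGraph (Fin n)) (L : List (Fin n × Fin n)) (σ τ : Store) : Prop :=
  (∀ done, Search G L done σ → Search G L done τ) ∧ ∀ c, σ.arr .tb c ≠ 0 → τ.arr .tb c ≠ 0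

theorem Extends.trans {σ τ ρ : Store} (h : Extends G L σ τ) (h' : Extends G L τ ρ) :
    Extends G L σ ρ := ⟨fun d hd => h'.1 d (h.1 d hd), fun c hc => h'.2 c (h.2 c hc)⟩

theorem Extends.of_eq {σ τ : Store} (h1 : τ.reg .top = σ.reg .top) (h2 : τ.arr .tb = σ.arr .tb) :
    Extends G L σ τ := by
  refine ⟨fun d hd => ?_, fun c hc => by rwa [h2]⟩
  rw [Search, h1, h2]; exact hd

theorem Extends.found {σ τ : Store} (h : Extends G L σ τ) (hF : Found G L σ F) : Found G L τ F :=
  ⟨hF.1, h.2 _ hF.2⟩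

theorem IsStack.congr {tb tb' : ℕ → ℕ} {l : List (Finset (Sym2 (Fin n)))} {top : ℕ}
    (h : IsStack L tb top l) (he : ∀ F ∈ l, tb' (codeOf L F) = tb (codeOf L F)) :
    IsStack L tb' top l := by
  induction l generalizing top with
  | nil => exact h
  | cons F l ih =>
    refine ⟨h.1, ?_⟩
    rw [he F (by simp)]
    exact ih h.2 fun F' hF' => he F' (by simp [hF'])

/-- A table entry is both a visited mark and a link. Storing the old pointer plus one keeps it
nonzero even at the bottom of the stack. As the entry was zero before, no set found earlier has this
code, so no other link is damaged. -/
theorem IsSearch.push {done l : List (Finset (Sym2 (Fin n)))} {top : ℕ} {tb : ℕ → ℕ}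
    (h : IsSearch G L done l top tb) (hF : IsMinimalCEDS G F) (h0 : tb (codeOf L F) = 0) :
    IsSearch G L done (F :: l) (codeOf L F + 1) (Function.update tb (codeOf L F) (top + 1)) := by
  have hne : ∀ F' ∈ done ++ l, codeOf L F' ≠ codeOf L F := fun F' hF' he =>
    (h.visited (codeOf L F)).2 ⟨F', hF', he⟩ h0
  have hp : (done ++ F :: l).Perm (F :: (done ++ l)) := List.perm_middle
  refine ⟨hp.nodup_iff.2 (List.nodup_cons.2 ⟨fun hm => hne F hm rfl, h.nodup⟩), ?_, ?_, ?_⟩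
  · intro F' hF'
    rcases List.mem_cons.1 (hp.subset hF') with rfl | h'
    exacts [hF, h.minimal _ h']
  · intro c
    rw [Function.update_apply]
    constructor
    · split_ifs with hc
      · exact fun _ => ⟨F, by simp, hc.symm⟩
      · intro h'
        obtain ⟨F', hF', rfl⟩ := (h.visited c).1 h'
        exact ⟨F', hp.symm.subset (List.mem_cons_of_mem _ hF'), rfl⟩
    · rintro ⟨F', hF', rfl⟩
      split_ifs with hc
      · omega
      · refine (h.visited _).2 ⟨F', ?_, rfl⟩
        rcases List.mem_cons.1 (hp.subset hF') with rfl | h'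
        exacts [absurd rfl hc, h']
  · refine ⟨rfl, ?_⟩
    rw [Function.update_self]
    exact h.stack.congr fun F' hF' => Function.update_of_ne (hne F' (by simp [hF'])) _ _

/-- Computes the code of `ys`, and pushes it unless it has been found before. -/
def push : AC :=
  .set .code (.const 0) ;;
  .loop .k .kq (.const 0) (.reg .M)
    (.set .code (.add (.add (.reg .code) (.reg .code)) (.cell .ys (.reg .k)))) ;;
  .ite (.cell .tb (.reg .code)) .skip
    (.put .tb (.reg .code) (.add (.reg .top) (.const 1)) ;;
     .set .top (.add (.reg .code) (.const 1)))

theorem pow_lt_bound : 2 ^ L.length + 2 ^ L.length + 4 ≤ bound L := by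
  have : 1 ≤ 2 ^ L.length := Nat.one_le_two_pow
  rw [bound, pow_add]; omega

theorem IsStack.top_le {tb : ℕ → ℕ} {l : List (Finset (Sym2 (Fin n)))} {top : ℕ}
    (h : IsStack L tb top l) : top ≤ 2 ^ L.length := by
  cases l with
  | nil => rw [show top = 0 from h]; exact Nat.zero_le _
  | cons F l =>
    have := h.1
    have := codeOf_lt (L := L) (F := F)
    omega

theorem push_spec {done : List (Finset (Sym2 (Fin n)))} (hσ : Loaded G L σ)
    (hF : IsMinimalCEDS G F) (hs : RepSet L (σ.arr .ys) F) (hS : Search G L done σ) :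
    AC.Run (bound L) push σ fun τ => Extends G L σ τ ∧ Found G L τ F ∧
      τ.clk ≤ σ.clk + 10 * L.length + 10 := by
  have hb := pow_lt_bound (L := L)
  refine AC.Run.seq (AC.Run.set 0 trivial rfl (.inl rfl) (AC.Run.seq (AC.Run.range (u := L.length)
    (fun i τ => τ.reg .code = prefixCode L F i ∧ τ.clk = σ.clk + 3 + 3 * i)
    (by decide) rfl (by simp [hσ.M]) (by simp [prefixCode]) ?_ ?_)))
  · rintro i hi τ hB hr hS' ⟨h1, h2⟩
    have fys : τ.arr .ys = σ.arr .ys := by simpa using hS'.2.1 .ys rfl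
    have hlt : prefixCode L F (i + 1) < 2 ^ (i + 1) := prefixCode_lt _
    have hle : 2 ^ (i + 1) ≤ 2 ^ L.length := Nat.pow_le_pow_right (by omega) hi
    refine AC.Run.set (prefixCode L F (i + 1)) (by simp) ?_ (.inr (by omega)) ?_
    · simp [h1, hr, fys, hs i hi, prefixCode]
    · simp [h2]; ring
  · rintro τ hB hS' ⟨h1, h2⟩
    have hcode : τ.reg .code = codeOf L F := h1
    have ftb : τ.arr .tb = σ.arr .tb := by simpa using hS'.2.1 .tb rfl
    have ftop : τ.reg .top = σ.reg .top := by simpa using hS'.1 .top rfl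
    refine AC.Run.ite (σ.arr .tb (codeOf L F)) (by simp) (by simp [hcode, ftb]) (fun hx => ?_)
      (fun hx => ?_)
    · exact AC.Run.skip ⟨Extends.of_eq (by simp [ftop]) (by simp [ftb]), ⟨hF, by simpa [ftb] using hx⟩,
        by simp; omega⟩
    · have hlt := codeOf_lt (L := L) (F := F)
      have htop : σ.reg .top ≤ 2 ^ L.length := by
        obtain ⟨l, hl⟩ := hS
        exact hl.stack.top_le
      refine AC.Run.seq (AC.Run.put (codeOf L F) (σ.reg .top + 1) trivial (by simp) (by simp [hcode])
        (by simp [ftop]) (.inr (by omega)) (AC.Run.set (codeOf L F + 1) (by simp)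
          (by simp [hcode]) (.inr (by omega)) ⟨⟨?_, ?_⟩, ⟨hF, ?_⟩, by simp; omega⟩))
      · rintro d ⟨l, hl⟩
        refine ⟨F :: l, ?_⟩
        simpa [ftb] using hl.push hF hx
      · intro c hc
        simp only [Store.tick_arr, Store.set_arr, Store.put_arr, if_true, ftb, Function.update_apply]
        split_ifs
        exacts [by omega, hc]
      · simp

/-- Processes the candidate in `ys`: prunes it to a minimal connected edge dominating set and
pushes that. -/
def process : AC := degrees .ys .dy ;; prune ;; push

/-- Pruning leaves only the containment `F' ⊆ F` under control; this is why `MoveClosed` asks for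
subsets of the results of moves. -/
theorem process_spec {done : List (Finset (Sym2 (Fin n)))} (hI : IsInput G L) (hσ : Loaded G L σ)
    (ht : IsSubtree G F) (hc : Covers G F) (hs : RepSet L (σ.arr .ys) F) (hS : Search G L done σ) :
    AC.Run (bound L) process σ fun τ => Extends G L σ τ ∧ (∃ F' ⊆ F, Found G L τ F') ∧
      τ.clk ≤ σ.clk + 100 * L.length := by
  have hm := hI.pos
  refine AC.Run.seq ((degrees_spec hI hσ ht.sub hs (by decide) (by decide) (by decide) (by decide)
    (by decide)).mono ?_)
  rintro τ₁ _ S₁ ⟨hd, hk⟩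
  have f₁ : τ₁.arr .ys = σ.arr .ys := S₁.2.1 .ys rfl
  refine AC.Run.seq ((prune_spec hI (hσ.same S₁ rfl) ht hc (f₁ ▸ hs) hd).mono ?_)
  rintro τ₂ _ S₂ ⟨F', hF', hmin, hs', hk'⟩
  have E : Extends G L σ τ₂ := Extends.of_eq ((S₂.1 .top rfl).trans (S₁.1 .top rfl))
    ((S₂.2.1 .tb rfl).trans (S₁.2.1 .tb rfl))
  refine (push_spec ((hσ.same S₁ rfl).same S₂ rfl) hmin hs' (E.1 _ hS)).mono ?_
  rintro τ₃ _ _ ⟨hE, hf, hk''⟩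
  exact ⟨E.trans hE, ⟨F', hF', hf⟩, by omega⟩

/-- Marks the vertices that can be reached from `root` through edges in `al`; the edges used form
the tree `ys`. -/
def grow : AC :=
  .loop .v .vq (.const 0) (.reg .N) (.put .mk (.reg .v) (.const 0)) ;;
  .loop .k .kq (.const 0) (.reg .M) (.put .ys (.reg .k) (.const 0)) ;;
  .put .mk (.reg .root) (.const 1) ;;
  .loop .v .vq (.const 0) (.reg .N) (.loop .k .kq (.const 0) (.reg .M)
    (.ite (.cell .al (.reg .k))
      (.set .c (.cell .en (.add (.reg .k) (.reg .k))) ;;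
       .set .u (.cell .op (.add (.reg .k) (.reg .k))) ;;
       .ite (.ne (.cell .mk (.reg .c)) (.cell .mk (.reg .u)))
        (.put .mk (.reg .c) (.const 1) ;; .put .mk (.reg .u) (.const 1) ;;
         .put .ys (.reg .k) (.const 1))
        .skip)
      .skip))

/-- `mk` marks the vertices of the tree `ys` within `F`, rooted at `r`. -/
def IsGrown (L : List (Fin n × Fin n)) (F : Finset (Sym2 (Fin n))) (r : Fin n) (mk ys : ℕ → ℕ) :
    Prop :=
  ∃ Z ⊆ F, (SimpleGraph.fromEdgeSet (↑Z : Set (Sym2 (Fin n)))).IsAcyclic ∧ RepSet L ys Z ∧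
    (∀ v, Touches Z v → Reach Z r v) ∧ ∀ v : Fin n, (mk v = 0 ∨ mk v = 1) ∧ (mk v = 1 ↔ Reach Z r v)

theorem IsGrown.symm_step {r a b : Fin n} {mk ys : ℕ → ℕ} (hI : IsInput G L)
    (h : IsGrown L F r mk ys) {k : ℕ} (hk : k < L.length) (hF : edgeNo L k ∈ F)
    (hab : edgeNo L k = s(a, b)) (ha : mk a = 1) (hb : mk b ≠ 1) :
    IsGrown L F r (Function.update (Function.update mk a 1) b 1) (Function.update ys k 1) := by
  obtain ⟨Z, hZ, hac, hs, ht, hm⟩ := h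
  have ra : Reach Z r a := (hm a).2.1 ha
  have rb : ¬ Reach Z r b := fun h => hb ((hm b).2.2 h)
  have hsub : Z ⊆ insert s(a, b) Z := Finset.subset_insert _ _
  have rb' : Reach (insert s(a, b) Z) r b :=
    (ra.mono hsub).trans (Reach.of_mem (Finset.mem_insert_self _ _))
  -- The new edge leads from the tree to a vertex outside it, so exactly `b` is gained.
  have hreach : ∀ v, Reach (insert s(a, b) Z) r v ↔ Reach Z r v ∨ v = b := by
    intro v
    constructor
    · intro hv
      refine hv.closed (fun v => Reach Z r v ∨ v = b) (fun p q hpq hp => ?_) (.inl (Reach.refl _ _))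
      rcases Finset.mem_insert.1 hpq with hs | hpq
      · rcases Sym2.eq_iff.1 hs with ⟨rfl, rfl⟩ | ⟨rfl, rfl⟩
        exacts [.inr rfl, .inl ra]
      · exact .inl (ht q (touches_right hpq))
    · rintro (h | rfl)
      exacts [h.mono hsub, rb']
  refine ⟨insert s(a, b) Z, Finset.insert_subset (hab ▸ hF) hZ,
    acyclic_insert hac fun h => rb (ra.trans h), hab ▸ hs.insert hI.listing hk, ?_, ?_⟩
  · rintro v ⟨e, he, hv⟩
    rw [hreach]
    rcases Finset.mem_insert.1 he with rfl | he
    · rcases Sym2.mem_iff.1 hv with rfl | rfl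
      exacts [.inl ra, .inr rfl]
    · exact .inl (ht v ⟨e, he, hv⟩)
  · intro v
    rw [hreach]
    simp only [Function.update_apply, Fin.val_inj]
    by_cases h1 : v = b
    · simp [h1]
    · by_cases h2 : v = a
      · subst h2
        simpa [h1] using ra
      · simpa [h1, h2] using hm v

theorem IsGrown.step {r a b : Fin n} {mk ys : ℕ → ℕ} (hI : IsInput G L)
    (h : IsGrown L F r mk ys) {k : ℕ} (hk : k < L.length) (hF : edgeNo L k ∈ F)
    (hab : edgeNo L k = s(a, b)) (hne : mk a ≠ mk b) :
    IsGrown L F r (Function.update (Function.update mk a 1) b 1) (Function.update ys k 1) := by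
  have hG := adj_half hI.listing (h := 2 * k) (by omega)
  have hab' : a ≠ b := by
    rintro rfl
    exact hne rfl
  obtain ⟨Z, _, _, _, _, hm⟩ := id h
  rcases (hm a).1 with h1 | h1
  · have h2 : mk b = 1 := by
      rcases (hm b).1 with h2 | h2
      exacts [absurd (h1.trans h2.symm) hne, h2]
    rw [Function.update_comm (by rwa [Ne, Fin.val_inj])]
    exact h.symm_step hI hk hF (hab.trans Sym2.eq_swap) h2 (by omega)
  · exact h.symm_step hI hk hF hab h1 fun h2 => hne (h1.trans h2.symm)

theorem exists_walk_le {r v : Fin n} (h : Reach F r v) :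
    ∃ p : (SimpleGraph.fromEdgeSet (↑F : Set (Sym2 (Fin n)))).Walk r v, p.length ≤ n := by
  obtain ⟨p, hp⟩ := SimpleGraph.Reachable.exists_isPath h
  exact ⟨p, by simpa using hp.length_lt.le⟩

/-- Each round scans all edges once, so after `t` rounds every vertex at the end of a walk of length
at most `t` is marked. A path has length at most `n`, so `n` rounds are enough. An edge is taken
into the tree only when exactly one of its ends is marked, which prevents cycles. -/
theorem grow_spec {r : Fin n} (hI : IsInput G L) (hσ : Loaded G L σ)
    (hF : ∀ e ∈ F, e ∈ G.edgeSet) (hs : RepSet L (σ.arr .al) F) (hr : σ.reg .root = r) :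
    AC.Run (bound L) grow σ fun τ => (∃ Z ⊆ F, IsSubtree G Z ∧ RepSet L (τ.arr .ys) Z ∧
        ∀ v, Reach F r v → Reach Z r v) ∧
      (∀ v : Fin n, τ.arr .mk v ≠ 0 ↔ Reach F r v) ∧
      τ.clk ≤ σ.clk + 50 * n * L.length := by
  have hb := le_bound L
  have hn := hI.le_two_mul
  have hm := hI.pos
  have hn0 : 0 < n := Nat.pos_of_ne_zero (NeZero.ne n)
  refine AC.Run.seq (AC.Run.range (u := n)
    (fun i τ => (∀ v < i, τ.arr .mk v = 0) ∧ τ.clk = σ.clk + 2 + 3 * i)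
    (by decide) rfl hσ.N (by simp) ?_ ?_)
  · intro i hi τ hB hr hS hInv
    refine AC.Run.put i 0 trivial trivial hr rfl (.inl rfl) ⟨fun v hv => ?_, by simp [hInv.2]; ring⟩
    simp only [Store.tick_arr, Store.set_arr, Store.put_arr, if_true, Function.update_apply]
    split_ifs with h
    · rfl
    · exact hInv.1 v (by omega)
  rintro τ₁ _ S₁ ⟨mk₁, k₁⟩
  have L₁ := hσ.same S₁ rfl
  refine AC.Run.seq (AC.Run.range (u := L.length)
    (fun i τ => (∀ v < i, τ.arr .ys v = 0) ∧ τ.clk = τ₁.clk + 3 + 3 * i)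
    (by decide) rfl L₁.M (by simp) ?_ ?_)
  · intro i hi τ hB hr hS hInv
    refine AC.Run.put i 0 trivial trivial hr rfl (.inl rfl) ⟨fun v hv => ?_, by simp [hInv.2]; ring⟩
    simp only [Store.tick_arr, Store.set_arr, Store.put_arr, if_true, Function.update_apply]
    split_ifs with h
    · rfl
    · exact hInv.1 v (by omega)
  rintro τ₂ _ S₂ ⟨ys₂, k₂⟩
  have L₂ : Loaded G L (τ₁.tick 1) := L₁.tick 1
  have L₃ := L₂.same S₂ rfl
  have hroot : τ₂.reg .root = r := ((S₂.1 .root rfl).trans (S₁.1 .root rfl)).trans hr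
  have hal : τ₂.arr .al = σ.arr .al := (S₂.2.1 .al rfl).trans (S₁.2.1 .al rfl)
  have hmk : τ₂.arr .mk = τ₁.arr .mk := S₂.2.1 .mk rfl
  refine AC.Run.seq (AC.Run.put r 1 trivial trivial (by simpa using hroot) rfl (.inl rfl)
    (AC.Run.range (u := n)
      (fun t τ => IsGrown L F r (τ.arr .mk) (τ.arr .ys) ∧
        (∀ v (p : (SimpleGraph.fromEdgeSet (↑F : Set (Sym2 (Fin n)))).Walk r v), p.length ≤ t →
          τ.arr .mk v = 1) ∧ τ.clk ≤ τ₂.clk + 4 + t * (9 * L.length + 5))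
      (by decide) rfl (by simpa using L₃.N) ?_ ?_ ?_))
  · refine ⟨⟨∅, by simp, by simp, fun i hi => ?_, ?_, ?_⟩, ?_, by simp⟩
    · simp [ys₂ i hi]
    · rintro v ⟨e, he, _⟩; simp at he
    · intro v
      have : Reach (∅ : Finset (Sym2 (Fin n))) r v ↔ r = v := by simp [Reach]
      rw [this]
      by_cases h : v = r
      · simp [h]
      · simp [Fin.val_inj, h, hmk, mk₁ v v.2, Ne.symm h]
    · intro v p hp
      have := SimpleGraph.Walk.eq_of_length_eq_zero (p := p) (by omega)
      simp [this]
  · rintro t ht ρ hB hrv hS ⟨i1, i2, i3⟩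
    have fal : ρ.arr .al = σ.arr .al := by simpa [hal] using hS.2.1 .al rfl
    have Lρ : Loaded G L ρ := (((L₃.tick 1).put _ _ (by decide)).tick 1).same hS rfl
    refine AC.Run.range (u := L.length)
      (fun k π => IsGrown L F r (π.arr .mk) (π.arr .ys) ∧
        (∀ v : Fin n, ρ.arr .mk v = 1 → π.arr .mk v = 1) ∧
        -- Marks present when the round began have been passed on along all edges scanned in it.
        (∀ j < k, edgeNo L j ∈ F → ∀ a b : Fin n, edgeNo L j = s(a, b) → ρ.arr .mk a = 1 →
          π.arr .mk b = 1) ∧ π.clk ≤ ρ.clk + 3 + 9 * k)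
      (by decide) rfl (by simpa using Lρ.M) ⟨i1, by simp, by simp, by simp⟩ ?_ ?_
    · rintro k hk π hB' hr' hS' ⟨j1, j2, j3, j4⟩
      have Lπ : Loaded G L π := (Lρ.tick 1).same hS' rfl
      have fal : π.arr .al k = if edgeNo L k ∈ F then 1 else 0 := by
        rw [hS'.2.1 .al rfl]; simpa [fal] using hs k hk
      have hen := Lπ.en (k + k) (by omega)
      have hop := Lπ.op (k + k) (by omega)
      have hne : halfEnd L (k + k) ≠ halfOpp L (k + k) := (adj_half hI.listing (by omega)).ne
      have hek := mk_halfEnd_halfOpp_double (L := L) k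
      refine AC.Run.ite (if edgeNo L k ∈ F then 1 else 0) (by simp) (by simp [hr', fal])
        (fun hx => ?_) (fun hx => ?_)
      · have hkF : edgeNo L k ∈ F := by simpa using hx
        refine AC.Run.seq (AC.Run.set (halfEnd L (k + k)) (by simp) (by simp [hr', hen]) (.inl rfl)
          (AC.Run.seq (AC.Run.set (halfOpp L (k + k)) (by simp) (by simp [hr', hop]) (.inl rfl)
          (AC.Run.iteNe (π.arr .mk (halfEnd L (k + k))) (π.arr .mk (halfOpp L (k + k))) (by simp)
            (by simp) (by simp) (by simp) (fun hx => ?_) (fun hx => ?_)))))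
        · refine AC.Run.seq (AC.Run.put (halfEnd L (k + k)) 1 trivial trivial (by simp) rfl (.inl rfl)
            (AC.Run.seq (AC.Run.put (halfOpp L (k + k)) 1 trivial trivial (by simp) rfl (.inl rfl)
            (AC.Run.put k 1 trivial trivial (by simp [hr']) rfl (.inl rfl) ⟨?_, ?_, ?_, ?_⟩))))
          · simpa using j1.step hI hk hkF hek.symm hx
          · intro v hv
            have := j2 v hv
            simp [Function.update_apply, this]
          · intro j hj hjF a b hab ha
            rcases Nat.lt_succ_iff_lt_or_eq.1 hj with h | rfl
            · have := j3 j h hjF a b hab ha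
              simp [Function.update_apply, this]
            · rw [← hek] at hab
              rcases Sym2.eq_iff.1 hab with ⟨-, rfl⟩ | ⟨rfl, -⟩
              · simp
              · simp [Function.update_apply]
          · simp; omega
        · refine AC.Run.skip ⟨by simpa using j1, by simpa using j2, ?_, by simp; omega⟩
          intro j hj hjF a b hab ha
          rcases Nat.lt_succ_iff_lt_or_eq.1 hj with h | rfl
          · simpa using j3 j h hjF a b hab ha
          · have := j2 a ha
            rw [← hek] at hab
            rcases Sym2.eq_iff.1 hab with ⟨rfl, rfl⟩ | ⟨rfl, rfl⟩
            · simpa [← hx] using this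
            · simpa [hx] using this
      · have hkF : edgeNo L k ∉ F := by simpa using hx
        refine AC.Run.skip ⟨by simpa using j1, by simpa using j2, ?_, by simp; omega⟩
        intro j hj hjF a b hab ha
        rcases Nat.lt_succ_iff_lt_or_eq.1 hj with h | rfl
        exacts [by simpa using j3 j h hjF a b hab ha, absurd hjF hkF]
    · rintro π _ _ ⟨j1, j2, j3, j4⟩
      refine ⟨by simpa using j1, fun v p hp => ?_, by simp; ring_nf at i3 ⊢; omega⟩
      simp only [Store.tick_arr, Store.set_arr]
      -- Reversing the walk exposes its last edge, whose nearer end was marked in an earlier round.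
      have hlen : p.reverse.length ≤ t + 1 := by simpa using hp
      generalize p.reverse = q at hlen
      cases q with
      | nil => exact j2 _ (i2 _ .nil (by simp))
      | @cons _ w _ hadj q =>
        have hw := i2 w q.reverse (by simpa using hlen)
        have hmem : s(w, v) ∈ F := by
          rw [Sym2.eq_swap]; simpa using (SimpleGraph.fromEdgeSet_adj _ |>.1 hadj).1
        obtain ⟨j, hj, he⟩ := exists_edgeNo hI.listing (hF _ hmem)
        exact j3 j hj (he ▸ hmem) w v he hw
  · rintro ρ hB hS ⟨⟨Z, hZ, hac, hsZ, ht, hm⟩, i2, i3⟩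
    have hall : ∀ v, Reach F r v → Reach Z r v := by
      intro v hv
      obtain ⟨p, hp⟩ := exists_walk_le hv
      exact (hm v).2.1 (i2 v p hp)
    refine ⟨⟨Z, hZ, ⟨fun e he => hF e (hZ he), hac, fun a b ha hb => (ht a ha).symm.trans (ht b hb)⟩,
      hsZ, hall⟩, fun v => ?_, ?_⟩
    · have h1 := hm v
      simp only [Store.tick_arr]
      constructor
      · intro h
        exact (h1.2.1 (h1.1.resolve_left h)).mono hZ
      · intro h
        rw [h1.2.2 (hall v h)]; omega
    · simp only [Store.tick_clk]
      have : n * 1 ≤ n * L.length := Nat.mul_le_mul_left n hI.pos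
      have : 1 * L.length ≤ n * L.length := Nat.mul_le_mul_right _ hn0
      have h3 : n * (9 * L.length + 5) = 9 * (n * L.length) + 5 * n := by ring
      have h4 : 50 * n * L.length = 50 * (n * L.length) := by ring
      omega

end RAM

/-! ### Moves that drop a leaf -/

namespace RAM

variable {n : ℕ} [NeZero n] {G : SimpleGraph (Fin n)} [DecidableRel G.Adj]
  {L : List (Fin n × Fin n)} {F X : Finset (Sym2 (Fin n))} {σ : Store}

theorem _root_.Covers.mono {V : Type*} {G : SimpleGraph V} {F F' : Finset (Sym2 V)}
    (h : Covers G F) (hF : ∀ z, Touches F z → Touches F' z) : Covers G F' :=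
  fun a b hab => (h a b hab).imp (hF a) (hF b)

/-- This follows from `Δ < n ≤ m + 1`. It turns the cost `Δ * Δ` of a leaf move into `m * Δ`. -/
theorem maxDegree_le_length (hI : IsInput G L) : G.maxDegree ≤ L.length := by
  have h := G.maxDegree_lt_card_verts
  have := hI.le
  simp only [Fintype.card_fin] at h
  omega

theorem one_le_maxDegree (hI : IsInput G L) : 1 ≤ G.maxDegree := by
  have h := adj_half hI.listing (h := 0) (by have := hI.pos; omega)
  have h1 : 0 < G.degree (halfEnd L 0) := (G.degree_pos_iff_exists_adj _).2 ⟨_, h⟩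
  exact h1.trans_le (G.degree_le_maxDegree _)

/-- The current solution `X` has been loaded. -/
structure Current (G : SimpleGraph (Fin n)) [DecidableRel G.Adj] (L : List (Fin n × Fin n))
    (X : Finset (Sym2 (Fin n))) (σ : Store) : Prop where
  loaded : Loaded G L σ
  xs : RepSet L (σ.arr .xs) X
  dx : RepDeg (σ.arr .dx) X

/-- `c` does not touch the current solution. -/
def AC.keepsCurrent (c : AC) : Bool := c.keeps && !c.wa .xs && !c.wa .dx

theorem Current.same {σ τ : Store} {c : AC} (h : Current G L X σ) (hs : c.Same σ τ)
    (hc : c.keepsCurrent = true) : Current G L X τ := by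
  simp only [AC.keepsCurrent, Bool.and_eq_true, Bool.not_eq_true'] at hc
  exact ⟨h.loaded.same hs hc.1.1, (hs.2.1 _ hc.1.2).symm ▸ h.xs, (hs.2.1 _ hc.2).symm ▸ h.dx⟩

theorem Current.tick (h : Current G L X σ) (t : ℕ) : Current G L X (σ.tick t) :=
  ⟨h.loaded.tick t, h.xs, h.dx⟩

theorem Current.set (h : Current G L X σ) {r : Reg} (x : ℕ) (hr : r ∉ [Reg.M, .N, .full]) :
    Current G L X (σ.set r x) := ⟨h.loaded.set x hr, h.xs, h.dx⟩

theorem Current.put (h : Current G L X σ) {k : Arr} (i x : ℕ)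
    (hk : k ∉ [Arr.en, .op, .ei, .st, .ad, .xs, .dx]) : Current G L X (σ.put k i x) := by
  simp only [List.mem_cons, List.not_mem_nil, or_false, not_or] at hk
  obtain ⟨h1, h2, h3, h4, h5, h6, h7⟩ := hk
  refine ⟨h.loaded.put i x (by simp [h1, h2, h3, h4, h5]), ?_, ?_⟩
  · rw [Store.put_arr, if_neg (Ne.symm h6)]; exact h.xs
  · rw [Store.put_arr, if_neg (Ne.symm h7)]; exact h.dx

/-- Looks for an edge from `w` to a vertex different from `i`. -/
def findOther : AC :=
  .set .flag (.const 0) ;;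
  .loop .l .lq (.cell .st (.reg .w)) (.cell .st (.add (.reg .w) (.const 1)))
    (.set .h (.cell .ad (.reg .l)) ;;
     .ite (.ne (.cell .op (.reg .h)) (.reg .i))
      (.set .c (.cell .ei (.reg .h)) ;; .set .flag (.const 1)) .skip)

theorem findOther_spec {v w : Fin n} (hI : IsInput G L) (hσ : Loaded G L σ) (hv : σ.reg .i = v)
    (hw : σ.reg .w = w) : AC.Run (bound L) findOther σ fun τ =>
      (τ.reg .flag ≠ 0 → ∃ u, G.Adj w u ∧ u ≠ v ∧ τ.reg .c < L.length ∧
        edgeNo L (τ.reg .c) = s(w, u)) ∧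
      (τ.reg .flag = 0 → ∀ u, G.Adj w u → u = v) ∧
      τ.clk ≤ σ.clk + 4 + 6 * G.maxDegree := by
  have hwid := hσ.adj.width w w.2
  refine AC.Run.seq (AC.Run.set 0 trivial rfl (.inl rfl) (AC.Run.segment (v := w)
    (l := σ.arr .st w) (u := σ.arr .st (w + 1))
    (fun j τ => (τ.reg .flag ≠ 0 → ∃ u, G.Adj w u ∧ u ≠ v ∧ τ.reg .c < L.length ∧
        edgeNo L (τ.reg .c) = s(w, u)) ∧
      (τ.reg .flag = 0 → ∀ j', σ.arr .st w ≤ j' → j' < j → halfOpp L (σ.arr .ad j') = v) ∧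
      τ.clk + 6 * σ.arr .st w ≤ σ.clk + 3 + 6 * j)
    (by decide) (by decide) rfl (by simp [hw]) (by simp) (by simp) (hσ.adj.mono w w.2) ?_ ?_ ?_))
  · exact ⟨by simp, fun _ j' _ _ => by omega, by simp⟩
  · rintro j hj1 hj2 τ hB hr hS ⟨i1, i2, i3⟩
    obtain ⟨h, hh, e1, e2, e3, e4, e5⟩ := hσ.half hj1 hj2
    have fad : τ.arr .ad = σ.arr .ad := by simpa using hS.2.1 .ad rfl
    have fop : τ.arr .op = σ.arr .op := by simpa using hS.2.1 .op rfl
    have fei : τ.arr .ei = σ.arr .ei := by simpa using hS.2.1 .ei rfl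
    have fri : τ.reg .i = v := by simpa [hv] using hS.1 .i rfl
    have hadj : G.Adj w (halfOpp L h) := e2 ▸ adj_half hI.listing hh
    refine AC.Run.seq (AC.Run.set h (by simp) (by simp [hr, fad, e1]) (.inl rfl)
      (AC.Run.iteNe (halfOpp L h) v (by simp) (by simp) (by simp [fop, e3]) (by simp [fri])
        (fun hx => ?_) (fun hx => ?_)))
    · rw [Ne, Fin.val_inj] at hx
      refine AC.Run.seq (AC.Run.set (h / 2) (by simp) (by simp [fei, e4]) (.inl rfl)
        (AC.Run.set 1 trivial rfl (.inl rfl) ⟨fun _ => ⟨_, hadj, hx, ?_, ?_⟩, by simp, by simp; omega⟩))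
      · simp; omega
      · simp [e5]
    · rw [Fin.val_inj] at hx
      refine AC.Run.skip ⟨by simpa using i1, fun hf j' h1 h2 => ?_, by simp; omega⟩
      rcases Nat.lt_succ_iff_lt_or_eq.1 h2 with h3 | rfl
      · exact i2 (by simpa using hf) j' h1 h3
      · rw [e1, hx]
  · rintro τ _ _ ⟨i1, i2, i3⟩
    refine ⟨i1, fun hf u hu => ?_, by simp; omega⟩
    obtain ⟨j, h1, h2, rfl⟩ := hσ.exists_pos hI hu
    exact i2 hf j h1 h2

/-- Attaches the neighbours of `i` outside the current solution to `ys`; register `e` reports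
failure. -/
def attach : AC :=
  .set .e (.const 0) ;;
  .loop .j .jq (.cell .st (.reg .i)) (.cell .st (.add (.reg .i) (.const 1)))
    (.set .w (.cell .op (.cell .ad (.reg .j))) ;;
     .ite (.cell .dx (.reg .w)) .skip
      (findOther ;; .ite (.reg .flag) (.put .ys (.reg .c) (.const 1)) (.set .e (.const 1))))

/-- An outside neighbour `w` of `v` with a neighbour `u ≠ v` can be hung on `u`, because `X` covers
the edge from `w` to `u` and does not touch `w`. When all are attached, every neighbour of `v` is
touched, so `v` is no longer needed for covering. -/
theorem attach_spec {v y : Fin n} (hI : IsInput G L) (hσ : Current G L X σ)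
    (hX : IsMinimalCEDS G X) (hv : σ.reg .i = v) (hvy : s(v, y) ∈ X)
    (hy : ∀ e ∈ X, v ∈ e → e = s(v, y)) (hs : RepSet L (σ.arr .ys) (X.erase s(v, y))) :
    AC.Run (bound L) attach σ fun τ =>
      (τ.reg .e = 0 → ∃ Y, IsSubtree G Y ∧ Covers G Y ∧ RepSet L (τ.arr .ys) Y ∧
        ∀ z, Touches Y z → (Touches X z ∨ G.Adj v z) ∧ z ≠ v) ∧
      (τ.reg .e ≠ 0 → ∃ w, G.Adj v w ∧ ¬ Touches X w ∧ ∀ u, G.Adj w u → u = v) ∧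
      τ.clk ≤ σ.clk + 24 * (L.length * G.maxDegree) := by
  have hwid := hσ.loaded.adj.width v v.2
  have hD := maxDegree_le_length hI
  have hD1 := one_le_maxDegree hI
  have ht := hX.isSubtree
  have h2 := hI.two X hX.1
  obtain ⟨T, hT⟩ : ∃ T, T = 11 + 6 * G.maxDegree := ⟨_, rfl⟩
  refine AC.Run.seq (AC.Run.set 0 trivial rfl (.inl rfl) (AC.Run.segment (v := v)
    (l := σ.arr .st v) (u := σ.arr .st (v + 1))
    (fun j τ => (τ.reg .e = 0 → ∃ Y, IsSubtree G Y ∧ RepSet L (τ.arr .ys) Y ∧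
        (∀ z, Touches Y z → z ≠ v ∧ (Touches X z ∨ ∃ j', σ.arr .st v ≤ j' ∧ j' < j ∧
          halfOpp L (σ.arr .ad j') = z)) ∧
        (∀ z, z ≠ v → Touches X z → Touches Y z) ∧
        (∀ j', σ.arr .st v ≤ j' → j' < j → Touches Y (halfOpp L (σ.arr .ad j')))) ∧
      (τ.reg .e ≠ 0 → ∃ w, G.Adj v w ∧ ¬ Touches X w ∧ ∀ u, G.Adj w u → u = v) ∧
      τ.clk + T * σ.arr .st v ≤ σ.clk + 3 + T * j)
    (by decide) (by decide) rfl (by simp [hv]) (by simp) (by simp) (hσ.loaded.adj.mono v v.2)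
    ?_ ?_ ?_))
  · refine ⟨fun _ => ⟨_, ht.erase_leaf hvy hy, by simpa using hs, fun z hz => ⟨?_, .inl ?_⟩,
      fun z hz hz' => ht.touches_erase_leaf hvy hy h2 hz' hz, fun j' _ _ => by omega⟩, by simp, by simp⟩
    · rintro rfl
      exact ht.not_touches_erase_leaf hvy hy hz
    · exact hz.mono (Finset.erase_subset _ _)
  · rintro j hj1 hj2 τ hB hr hS ⟨i1, i2, i3⟩
    have Cτ : Current G L X τ := ((hσ.set 0 (r := .e) (by decide)).tick 1).same hS rfl
    obtain ⟨h, hh, e1, e2, e3, e4, e5⟩ := hσ.loaded.half hj1 hj2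
    have fad : τ.arr .ad = σ.arr .ad := by simpa using hS.2.1 .ad rfl
    have fop : τ.arr .op = σ.arr .op := by simpa using hS.2.1 .op rfl
    have fri : τ.reg .i = v := by simpa [hv] using hS.1 .i rfl
    have hadj : G.Adj v (halfOpp L h) := e2 ▸ adj_half hI.listing hh
    refine AC.Run.seq (AC.Run.set (halfOpp L h) (by simp) (by simp [hr, fad, e1, fop, e3]) (.inl rfl)
      (AC.Run.ite (edgeDeg X (halfOpp L h)) (by simp) (by simp [Cτ.dx (halfOpp L h)])
        (fun hx => ?_) (fun hx => ?_)))
    · have htw : Touches X (halfOpp L h) := by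
        by_contra hcon; exact hx (edgeDeg_eq_zero.2 hcon)
      refine AC.Run.skip ⟨fun he => ?_, by simpa using i2, by simp [Nat.mul_succ]; omega⟩
      obtain ⟨Y, y1, y2, y3, y4, y5⟩ := i1 (by simpa using he)
      refine ⟨Y, y1, by simpa using y2, fun z hz => ⟨(y3 z hz).1, (y3 z hz).2.imp_right
        fun ⟨j', a1, a2, a3⟩ => ⟨j', a1, by omega, a3⟩⟩, y4, fun j' a1 a2 => ?_⟩
      rcases Nat.lt_succ_iff_lt_or_eq.1 a2 with a3 | rfl
      · exact y5 j' a1 a3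
      · rw [e1]; exact y4 _ hadj.ne.symm htw
    · have htw : ¬ Touches X (halfOpp L h) := edgeDeg_eq_zero.1 hx
      refine AC.Run.seq ((findOther_spec (v := v) (w := halfOpp L h) hI
        ((((Cτ.tick 1).set _ (by decide)).tick 1).tick 1).loaded (by simp [fri]) (by simp)).mono ?_)
      rintro π _ S ⟨p1, p2, p3⟩
      have fys : π.arr .ys = τ.arr .ys := by simpa using S.2.1 .ys rfl
      have fre : π.reg .e = τ.reg .e := by simpa using S.1 .e rfl
      simp only [Store.tick_clk, Store.set_clk] at p3
      refine AC.Run.ite _ trivial rfl (fun hx => ?_) (fun hx => ?_)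
      · obtain ⟨u, u1, u2, u3, u4⟩ := p1 hx
        refine AC.Run.put (π.reg .c) 1 trivial trivial rfl rfl (.inl rfl)
          ⟨fun he => ?_, by simpa [fre] using i2, by simp [Nat.mul_succ]; omega⟩
        obtain ⟨Y, y1, y2, y3, y4, y5⟩ := i1 (by simpa [fre] using he)
        have huX : Touches X u := (hX.covers _ _ u1).resolve_left htw
        -- The graph is simple and the adjacency list of `v` has no repetitions, so this neighbour
        -- was not attached before.
        have hwY : ¬ Touches Y (halfOpp L h) := by
          intro hcon
          obtain ⟨_, h1 | ⟨j', a1, a2, a3⟩⟩ := y3 _ hcon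
          · exact htw h1
          · obtain ⟨b1, b2⟩ := hσ.loaded.adj.mem v j' a1 (by omega)
            refine hσ.loaded.adj.inj v j' j a1 a2 hj2 (e1 ▸ half_inj hI.listing b1 hh ?_ a3)
            rw [b2, e2]
        refine ⟨insert s(u, halfOpp L h) Y, y1.insert_pendant u1.symm (y4 u u2 huX) hwY, ?_, ?_, ?_, ?_⟩
        · have := y2.insert hI.listing u3
          rw [u4, Sym2.eq_swap] at this
          simpa [fys] using this
        · rintro z ⟨e, he, hz⟩
          rcases Finset.mem_insert.1 he with rfl | he
          · rcases Sym2.mem_iff.1 hz with rfl | rfl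
            · exact ⟨u2, .inl huX⟩
            · exact ⟨hadj.ne.symm, .inr ⟨j, hj1, by omega, by rw [e1]⟩⟩
          · obtain ⟨a0, h1⟩ := y3 z ⟨e, he, hz⟩
            exact ⟨a0, h1.imp_right fun ⟨j', a1, a2, a3⟩ => ⟨j', a1, by omega, a3⟩⟩
        · exact fun z h1 h2 => (y4 z h1 h2).mono (Finset.subset_insert _ _)
        · intro j' a1 a2
          rcases Nat.lt_succ_iff_lt_or_eq.1 a2 with a3 | rfl
          · exact (y5 j' a1 a3).mono (Finset.subset_insert _ _)
          · rw [e1]; exact touches_right (Finset.mem_insert_self _ _)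
      · exact AC.Run.set 1 trivial rfl (.inl rfl) ⟨by simp, fun _ => ⟨_, hadj, htw, p2 hx⟩,
          by simp [Nat.mul_succ]; omega⟩
  · rintro τ _ _ ⟨i1, i2, i3⟩
    refine ⟨fun he => ?_, i2, ?_⟩
    · obtain ⟨Y, y1, y2, y3, y4, y5⟩ := i1 he
      have hnb : ∀ w, G.Adj v w → Touches Y w := by
        intro w hw
        obtain ⟨j, h1, h2, rfl⟩ := hσ.loaded.exists_pos hI hw
        exact y5 j h1 h2
      refine ⟨Y, y1, fun a b hab => ?_, y2, fun z hz => ⟨(y3 z hz).2.imp_right ?_, (y3 z hz).1⟩⟩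
      · by_cases ha : a = v
        · exact .inr (hnb b (ha ▸ hab))
        by_cases hb : b = v
        · exact .inl (hnb a (hb ▸ hab.symm))
        exact (hX.covers a b hab).imp (y4 a ha) (y4 b hb)
      · rintro ⟨j', a1, a2, rfl⟩
        obtain ⟨b1, b2⟩ := hσ.loaded.adj.mem v j' a1 a2
        rw [← b2]
        exact adj_half hI.listing b1
    · have h3 : T * σ.arr .st (v + 1) ≤ T * σ.arr .st v + T * G.maxDegree := by
        rw [← Nat.mul_add]; exact Nat.mul_le_mul_left _ hwid
      have h4 : G.maxDegree * G.maxDegree ≤ L.length * G.maxDegree := Nat.mul_le_mul_right _ hD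
      have h5 : 1 * G.maxDegree ≤ L.length * G.maxDegree := Nat.mul_le_mul_right _ hI.pos
      have h6 : T * G.maxDegree = 11 * G.maxDegree + 6 * (G.maxDegree * G.maxDegree) := by
        rw [hT]; ring
      simp only [Store.tick_clk]
      omega

/-- All moves that drop a leaf of the current solution. -/
def leafMoves : AC :=
  .loop .i .iq (.const 0) (.reg .N) (.ite (.ne (.cell .dx (.reg .i)) (.const 1)) .skip
    (.loop .k .kq (.const 0) (.reg .M)
      (.ite (.ne (.cell .en (.add (.reg .k) (.reg .k))) (.reg .i))
        (.ite (.ne (.cell .op (.add (.reg .k) (.reg .k))) (.reg .i))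
          (.put .ys (.reg .k) (.cell .xs (.reg .k))) (.put .ys (.reg .k) (.const 0)))
        (.put .ys (.reg .k) (.const 0))) ;;
     attach ;;
     .ite (.reg .e) .skip process))

theorem leafMoves_spec {done : List (Finset (Sym2 (Fin n)))} (hI : IsInput G L)
    (hσ : Current G L X σ) (hX : IsMinimalCEDS G X) (hS : Search G L done σ) :
    AC.Run (bound L) leafMoves σ fun τ => Extends G L σ τ ∧
      (∀ v, edgeDeg X v = 1 → (∀ w, G.Adj v w → ¬ Touches X w → ∃ u, G.Adj w u ∧ u ≠ v) →
        ∃ F, Found G L τ F ∧ ∀ z, Touches F z → (Touches X z ∨ G.Adj v z) ∧ z ≠ v) ∧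
      τ.clk ≤ σ.clk + 200 * (n * (L.length * G.maxDegree)) := by
  have hm := hI.pos
  have hD1 := one_le_maxDegree hI
  have hmD : L.length * 1 ≤ L.length * G.maxDegree := Nat.mul_le_mul_left _ hD1
  have hn0 : 0 < n := Nat.pos_of_ne_zero (NeZero.ne n)
  have ht := hX.isSubtree
  obtain ⟨T, hT⟩ : ∃ T, T = 150 * (L.length * G.maxDegree) := ⟨_, rfl⟩
  refine AC.Run.range (u := n) (fun i τ => Extends G L σ τ ∧
      (∀ v : Fin n, (v : ℕ) < i → edgeDeg X v = 1 →
        (∀ w, G.Adj v w → ¬ Touches X w → ∃ u, G.Adj w u ∧ u ≠ v) →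
        ∃ F, Found G L τ F ∧ ∀ z, Touches F z → (Touches X z ∨ G.Adj v z) ∧ z ≠ v) ∧
      τ.clk ≤ σ.clk + 2 + T * i)
    (by decide) rfl hσ.loaded.N ⟨Extends.of_eq (by simp) (by simp), by simp, by simp⟩ ?_ ?_
  · rintro i hi τ hB hr hSame ⟨i1, i2, i3⟩
    have Cτ : Current G L X τ := hσ.same hSame rfl
    obtain ⟨v, rfl⟩ : ∃ v : Fin n, (v : ℕ) = i := ⟨⟨i, hi⟩, rfl⟩
    refine AC.Run.iteNe (edgeDeg X v) 1 (by simp) trivial (by simp [hr, Cτ.dx v]) rfl (fun h1 => ?_)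
      (fun h1 => ?_)
    · refine AC.Run.skip ⟨i1.trans (Extends.of_eq (by simp) (by simp)), fun x hx hx1 => ?_,
        by simp [Nat.mul_succ]; omega⟩
      rcases Nat.lt_succ_iff_lt_or_eq.1 hx with h | h
      · exact i2 x h hx1
      · rw [Fin.val_inj] at h; subst h; exact absurd hx1 h1
    obtain ⟨y, hvy, hy⟩ := edgeDeg_eq_one.1 h1
    refine AC.Run.seq (AC.Run.range (u := L.length) (fun k ρ =>
        (∀ j < k, ρ.arr .ys j = if edgeNo L j ∈ X.erase s(v, y) then 1 else 0) ∧
        ρ.clk ≤ τ.clk + 4 + 5 * k) (by decide) rfl (by simpa using Cτ.loaded.M) (by simp) ?_ ?_)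
    · rintro k hk ρ hB' hr' hS' ⟨j1, j2⟩
      have Cρ : Current G L X ρ := ((Cτ.tick 1).tick 1).same hS' rfl
      have hen := Cρ.loaded.en (k + k) (by omega)
      have hop := Cρ.loaded.op (k + k) (by omega)
      have hxs := Cρ.xs k hk
      have hek := mk_halfEnd_halfOpp_double (L := L) k
      have fri : ρ.reg .i = v := by simpa [hr] using hS'.1 .i rfl
      have upd : ∀ x, x = (if edgeNo L k ∈ X.erase s(v, y) then 1 else 0) → ∀ j < k + 1,
          Function.update (ρ.arr .ys) k x j = if edgeNo L j ∈ X.erase s(v, y) then 1 else 0 := by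
        rintro x rfl j hj
        rcases Nat.lt_succ_iff_lt_or_eq.1 hj with h | rfl
        · rw [Function.update_of_ne (by omega), j1 j h]
        · rw [Function.update_self]
      -- The leaf edge is the only edge of `X` at `v`, so clearing all edges at `v` removes it
      -- although the program does not know `y`.
      have hin : v ∈ edgeNo L k → 0 = if edgeNo L k ∈ X.erase s(v, y) then 1 else 0 := by
        intro hv
        rw [if_neg]
        intro hmem
        exact (Finset.mem_erase.1 hmem).1 (hy _ (Finset.mem_erase.1 hmem).2 hv)
      refine AC.Run.iteNe (halfEnd L (k + k)) v (by simp) (by simp) (by simp [hr', hen]) (by simp [fri])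
        (fun hx => ?_) (fun hx => ?_)
      · refine AC.Run.iteNe (halfOpp L (k + k)) v (by simp) (by simp) (by simp [hr', hop])
          (by simp [fri]) (fun hx' => ?_) (fun hx' => ?_)
        · refine AC.Run.put k (if edgeNo L k ∈ X.erase s(v, y) then 1 else 0) (by simp) (by simp)
            (by simp [hr']) ?_ (.inl rfl) ⟨by simpa using upd _ rfl, by simp; omega⟩
          rw [Ne, Fin.val_inj] at hx hx'
          have : edgeNo L k ≠ s(v, y) := by
            rintro h
            have : v ∈ edgeNo L k := h ▸ Sym2.mem_mk_left _ _
            rw [← hek, Sym2.mem_iff] at this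
            rcases this with h | h
            exacts [hx h.symm, hx' h.symm]
          simp [hr', hxs, this]
        · rw [Fin.val_inj] at hx'
          have hv : v ∈ edgeNo L k := by rw [← hek, hx']; exact Sym2.mem_mk_right _ _
          exact AC.Run.put k 0 (by simp) (by simp) (by simp [hr']) rfl (.inl rfl)
            ⟨by simpa using upd 0 (hin hv), by simp; omega⟩
      · rw [Fin.val_inj] at hx
        have hv : v ∈ edgeNo L k := by rw [← hek, hx]; exact Sym2.mem_mk_left _ _
        exact AC.Run.put k 0 (by simp) (by simp) (by simp [hr']) rfl (.inl rfl)
          ⟨by simpa using upd 0 (hin hv), by simp; omega⟩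
    rintro ρ _ S₁ ⟨j1, j2⟩
    have Cρ : Current G L X ρ := (Cτ.tick 1).same S₁ rfl
    refine AC.Run.seq ((attach_spec (v := v) (y := y) hI (Cρ.tick 1) hX
      (by simpa [hr] using S₁.1 .i rfl) hvy hy (fun j hj => j1 j hj)).mono ?_)
    rintro π _ S₂ ⟨a1, a2, a3⟩
    have Cπ : Current G L X π := (Cρ.tick 1).same S₂ rfl
    have Eπ : Extends G L τ π := Extends.of_eq
      (by simpa using (S₂.1 .top rfl).trans (S₁.1 .top rfl))
      (by simpa using (S₂.2.1 .tb rfl).trans (S₁.2.1 .tb rfl))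
    simp only [Store.tick_clk] at a3
    refine AC.Run.ite _ trivial rfl (fun hx => ?_) (fun hx => ?_)
    · refine AC.Run.skip ⟨(i1.trans Eπ).trans (Extends.of_eq (by simp) (by simp)),
        fun x hx' hx1 hw => ?_, by simp [Nat.mul_succ]; omega⟩
      rcases Nat.lt_succ_iff_lt_or_eq.1 hx' with h | h
      · obtain ⟨F, f1, f2⟩ := i2 x h hx1 hw
        exact ⟨F, Eπ.found f1, f2⟩
      · rw [Fin.val_inj] at h; subst h
        -- Failure of `attach` exhibits an outside neighbour whose only neighbour is `v`, so the
        -- condition for this move is violated.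
        obtain ⟨w, w1, w2, w3⟩ := a2 hx
        obtain ⟨u, u1, u2⟩ := hw w w1 w2
        exact absurd (w3 u u1) u2
    · obtain ⟨Y, y1, y2, y3, y4⟩ := a1 hx
      refine (process_spec hI (Cπ.tick 1).loaded y1 y2 y3 ((i1.trans Eπ).1 done hS)).mono ?_
      rintro κ _ _ ⟨b1, ⟨F', hF', b2⟩, b3⟩
      have Eκ : Extends G L π κ := b1
      simp only [Store.tick_clk] at b3
      refine ⟨((i1.trans Eπ).trans Eκ).trans (Extends.of_eq (by simp) (by simp)),
        fun x hx' hx1 hw => ?_, by simp [Nat.mul_succ]; omega⟩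
      rcases Nat.lt_succ_iff_lt_or_eq.1 hx' with h | h
      · obtain ⟨F, f1, f2⟩ := i2 x h hx1 hw
        exact ⟨F, Eκ.found (Eπ.found f1), f2⟩
      · rw [Fin.val_inj] at h; subst h
        exact ⟨F', b2, fun z hz => y4 z (hz.mono hF')⟩
  · rintro τ _ _ ⟨i1, i2, i3⟩
    refine ⟨i1, fun v => i2 v v.2, ?_⟩
    have h1 : T * n = 150 * (n * (L.length * G.maxDegree)) := by rw [hT]; ring
    have h2 : 1 * 1 ≤ n * (L.length * G.maxDegree) := Nat.mul_le_mul hn0 (by omega)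
    simp only [Store.tick_clk]
    omega

end RAM

/-! ### Moves that replace an edge -/

namespace RAM

variable {n : ℕ} [NeZero n] {G : SimpleGraph (Fin n)} [DecidableRel G.Adj]
  {L : List (Fin n × Fin n)} {F X : Finset (Sym2 (Fin n))} {σ : Store}

/-- Copies the current solution to `dst`. -/
def copy (dst : Arr) : AC :=
  .loop .k .kq (.const 0) (.reg .M) (.put dst (.reg .k) (.cell .xs (.reg .k)))

theorem copy_spec {dst : Arr} (hσ : Current G L X σ) (hd : dst ∉ [Arr.inp, .xs]) :
    AC.Run (bound L) (copy dst) σ fun τ =>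
      RepSet L (τ.arr dst) X ∧ τ.clk = σ.clk + 3 + 3 * L.length := by
  simp only [List.mem_cons, List.not_mem_nil, or_false, not_or] at hd
  refine AC.Run.range (u := L.length)
    (fun k τ => (∀ j < k, τ.arr dst j = if edgeNo L j ∈ X then 1 else 0) ∧
      τ.clk = σ.clk + 2 + 3 * k) (by decide) rfl hσ.loaded.M (by simp) ?_ ?_
  · rintro k hk τ hB hr hS ⟨j1, j2⟩
    have fxs : τ.arr .xs = σ.arr .xs := hS.2.1 .xs (by simp [AC.wa, Ne.symm hd.2])
    refine AC.Run.put k (if edgeNo L k ∈ X then 1 else 0) trivial (by simp) hr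
      (by simp [hr, fxs, hσ.xs k hk]) (.inl rfl) ⟨fun j hj => ?_, by simp; omega⟩
    rcases Nat.lt_succ_iff_lt_or_eq.1 hj with h | rfl
    · simpa [Function.update_of_ne (show j ≠ k by omega)] using j1 j h
    · simp
  · rintro τ _ _ ⟨j1, j2⟩
    exact ⟨j1, by simp; omega⟩

/-- Processes the current solution with edge `i` replaced by the edges of the half-edges `p`
and `g`. -/
def candidate : AC :=
  copy .ys ;;
  .put .ys (.reg .i) (.const 0) ;;
  .put .ys (.cell .ei (.reg .p)) (.const 1) ;;
  .put .ys (.cell .ei (.reg .g)) (.const 1) ;;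
  process

theorem candidate_spec {done : List (Finset (Sym2 (Fin n)))} {i p g : ℕ} (hI : IsInput G L)
    (hσ : Current G L X σ) (hi : i < L.length) (hp : p < 2 * L.length) (hg : g < 2 * L.length)
    (ri : σ.reg .i = i) (rp : σ.reg .p = p) (rg : σ.reg .g = g)
    (ht : IsSubtree G (insert (edgeNo L (g / 2)) (insert (edgeNo L (p / 2)) (X.erase (edgeNo L i)))))
    (hc : Covers G (insert (edgeNo L (g / 2)) (insert (edgeNo L (p / 2)) (X.erase (edgeNo L i)))))
    (hS : Search G L done σ) :
    AC.Run (bound L) candidate σ fun τ => Extends G L σ τ ∧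
      (∃ F, Found G L τ F ∧
        F ⊆ insert (edgeNo L (g / 2)) (insert (edgeNo L (p / 2)) (X.erase (edgeNo L i)))) ∧
      τ.clk ≤ σ.clk + 110 * L.length := by
  have hm := hI.pos
  refine AC.Run.seq ((copy_spec (dst := .ys) hσ (by decide)).mono ?_)
  rintro τ _ S₁ ⟨hys, j2⟩
  have Cτ : Current G L X τ := hσ.same S₁ rfl
  refine AC.Run.seq (AC.Run.put i 0 trivial trivial (by simpa [ri] using S₁.1 .i rfl) rfl (.inl rfl)
    (AC.Run.seq (AC.Run.put (p / 2) 1 (by simp) trivial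
      (by simpa [rp, S₁.1 .p rfl] using Cτ.loaded.ei p hp) rfl (.inl rfl)
    (AC.Run.seq (AC.Run.put (g / 2) 1 (by simp) trivial
      (by simpa [rg, S₁.1 .g rfl] using Cτ.loaded.ei g hg) rfl (.inl rfl)
    ((process_spec (done := done) hI ?_ ht hc ?_ ?_).mono ?_))))))
  · exact (((((Cτ.loaded.put _ _ (by decide)).tick 1).put _ _ (by decide)).tick 1).put _ _
      (by decide)).tick 1
  · simpa using ((hys.erase hI.listing hi).insert hI.listing (i := p / 2) (by omega)).insert
      hI.listing (i := g / 2) (by omega)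
  · exact (Extends.of_eq (by simpa using S₁.1 .top rfl) (by simpa using S₁.2.1 .tb rfl)).1 done hS
  · rintro ρ _ _ ⟨e1, ⟨F, f1, f2⟩, e3⟩
    refine ⟨.trans (.of_eq (by simpa using S₁.1 .top rfl) (by simpa using S₁.2.1 .tb rfl)) e1,
      ⟨F, f2, f1⟩, ?_⟩
    simp at e3
    omega

/-- Among the sets with property `S` are results of all moves that replace the edge `f` of `X` and
start with the edge from `a` to `w`. -/
def Exchanged (G : SimpleGraph (Fin n)) (S : Finset (Sym2 (Fin n)) → Prop)
    (X : Finset (Sym2 (Fin n))) (f : Sym2 (Fin n)) (x a w : Fin n) : Prop :=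
  (Touches X w → ∃ F, S F ∧ F ⊆ insert s(a, w) (X.erase f)) ∧
    (¬ Touches X w → ∀ b, G.Adj w b → ¬ Reach (X.erase f) x b →
      ∃ F, S F ∧ F ⊆ insert s(a, w) (insert s(w, b) (X.erase f)))

theorem Exchanged.mono {S S' : Finset (Sym2 (Fin n)) → Prop} {f : Sym2 (Fin n)} {x a w : Fin n}
    (h : Exchanged G S X f x a w) (hS : ∀ F, S F → S' F) : Exchanged G S' X f x a w :=
  ⟨fun ht => (h.1 ht).imp fun F hF => ⟨hS F hF.1, hF.2⟩,
    fun ht b hwb hb => (h.2 ht b hwb hb).imp fun F hF => ⟨hS F hF.1, hF.2⟩⟩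

/-- All moves that replace edge `i` of the current solution, one end of which is marked, by an
edge or a path that enters the marked part by the half-edge `p`. -/
def exchangeAt : AC :=
  .ite (.cell .mk (.cell .op (.reg .p)))
    (.ite (.cell .mk (.cell .en (.reg .p))) .skip
      (.ite (.cell .dx (.cell .en (.reg .p)))
        (.set .g (.reg .p) ;; candidate)
        (.set .root (.cell .en (.reg .p)) ;;
         .loop .j .jq (.cell .st (.reg .root)) (.cell .st (.add (.reg .root) (.const 1)))
          (.set .g (.cell .ad (.reg .j)) ;;
           .ite (.cell .mk (.cell .op (.reg .g))) .skip candidate))))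
    .skip

theorem exchangeAt_spec {done : List (Finset (Sym2 (Fin n)))} {i p : ℕ} {x y : Fin n}
    (hI : IsInput G L) (hσ : Current G L X σ) (hX : IsMinimalCEDS G X) (hi : i < L.length)
    (hp : p < 2 * L.length) (ri : σ.reg .i = i) (rp : σ.reg .p = p) (hxy : edgeNo L i = s(x, y))
    (hiX : edgeNo L i ∈ X)
    (hmk : ∀ v : Fin n, σ.arr .mk v ≠ 0 ↔ Reach (X.erase (edgeNo L i)) x v)
    (hS : Search G L done σ) :
    AC.Run (bound L) exchangeAt σ fun τ => Extends G L σ τ ∧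
      (Reach (X.erase (edgeNo L i)) x (halfOpp L p) →
        ¬ Reach (X.erase (edgeNo L i)) x (halfEnd L p) →
        Exchanged G (Found G L τ) X (edgeNo L i) x (halfOpp L p) (halfEnd L p)) ∧
      τ.clk ≤ σ.clk + 130 * (L.length * G.maxDegree) := by
  have hm := hI.pos
  have hD1 := one_le_maxDegree hI
  have hmD : L.length * 1 ≤ L.length * G.maxDegree := Nat.mul_le_mul_left _ hD1
  have hmD' : 1 * G.maxDegree ≤ L.length * G.maxDegree := Nat.mul_le_mul_right _ hm
  have ht := hX.isSubtree
  have hadj := adj_half hI.listing hp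
  have hop := hσ.loaded.op p hp
  have hen := hσ.loaded.en p hp
  have hep := mk_halfEnd_halfOpp (L := L) p
  refine AC.Run.ite (σ.arr .mk (halfOpp L p)) (by simp) (by simp [rp, hop]) (fun ha => ?_)
    (fun ha => AC.Run.skip ⟨Extends.of_eq rfl rfl, fun h => absurd ha ((hmk _).2 h),
      by simp; omega⟩)
  rw [hmk] at ha
  refine AC.Run.ite (σ.arr .mk (halfEnd L p)) (by simp) (by simp [rp, hen])
    (fun hw => AC.Run.skip ⟨Extends.of_eq rfl rfl, fun _ h => absurd ((hmk _).1 hw) h,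
      by simp; omega⟩) (fun hw => ?_)
  replace hw : ¬ Reach (X.erase (edgeNo L i)) x (halfEnd L p) := fun h => (hmk _).2 h hw
  refine AC.Run.ite (edgeDeg X (halfEnd L p)) (by simp) (by simp [rp, hen, hσ.dx (halfEnd L p)])
    (fun hd => ?_) (fun hd => ?_)
  · have htw : Touches X (halfEnd L p) := by
      by_contra hcon; exact hd (edgeDeg_eq_zero.2 hcon)
    obtain ⟨t1, t2⟩ := ht.exchange (hxy ▸ hiX) (hxy ▸ ha) (hxy ▸ hw) hadj.symm htw
    -- Replacement by a single edge is the case `g = p` of `candidate`: the same edge is inserted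
    -- twice.
    have hY : insert (edgeNo L (p / 2)) (insert (edgeNo L (p / 2)) (X.erase (edgeNo L i))) =
        insert s(halfOpp L p, halfEnd L p) (X.erase s(x, y)) := by
      rw [Finset.insert_idem, ← hep, Sym2.eq_swap, hxy]
    refine AC.Run.seq (AC.Run.set p trivial (by simp [rp]) (.inl rfl)
      ((candidate_spec (done := done) hI (((((hσ.tick 1).tick 1).tick 1).set _ (by decide)).tick 1)
        hi hp hp (by simp [ri]) (by simp [rp]) (by simp) (hY ▸ t1) (hY ▸ hX.covers.mono t2)
        ((Extends.of_eq (by simp) (by simp)).1 done hS)).mono ?_))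
    rintro τ _ _ ⟨e1, ⟨F, f1, f2⟩, e3⟩
    refine ⟨.trans (.of_eq (by simp) (by simp)) e1, fun _ _ => ⟨fun _ => ⟨F, f1, ?_⟩,
      fun h => absurd htw h⟩, by simp at e3; omega⟩
    rwa [hY, ← hxy] at f2
  · have htw : ¬ Touches X (halfEnd L p) := edgeDeg_eq_zero.1 hd
    obtain ⟨T, hT⟩ : ∃ T, T = 110 * L.length + 6 := ⟨_, rfl⟩
    have C₀ : Current G L X ((((((σ.tick 1).tick 1).tick 1).set .root (halfEnd L p))).tick 1) :=
      ((((hσ.tick 1).tick 1).tick 1).set _ (by decide)).tick 1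
    have hwid := hσ.loaded.adj.width _ (halfEnd L p).2
    refine AC.Run.seq (AC.Run.set (halfEnd L p : ℕ) (by simp) (by simp [rp, hen]) (.inl rfl)
      (AC.Run.segment (v := halfEnd L p) (l := σ.arr .st (halfEnd L p))
        (u := σ.arr .st (halfEnd L p + 1))
      (fun j τ => Extends G L σ τ ∧
        (∀ j', σ.arr .st (halfEnd L p) ≤ j' → j' < j →
          ¬ Reach (X.erase (edgeNo L i)) x (halfOpp L (σ.arr .ad j')) →
          ∃ F, Found G L τ F ∧ F ⊆ insert s(halfOpp L p, halfEnd L p)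
            (insert s(halfEnd L p, halfOpp L (σ.arr .ad j')) (X.erase (edgeNo L i)))) ∧
        τ.clk + T * σ.arr .st (halfEnd L p) ≤ σ.clk + 6 + T * j)
      (by decide) (by decide) rfl (by simp) (by simp) (by simp)
      (hσ.loaded.adj.mono _ (halfEnd L p).2) ?_ ?_ ?_))
    · exact ⟨Extends.of_eq (by simp) (by simp), fun j' _ _ => by omega, by simp⟩
    · rintro j hj1 hj2 τ hB hr hS' ⟨i1, i2, i3⟩
      have Cτ : Current G L X τ := C₀.same hS' rfl
      obtain ⟨h, hh, e1, e2, e3, e4, e5⟩ := hσ.loaded.half hj1 hj2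
      have fad : τ.arr .ad = σ.arr .ad := by simpa using hS'.2.1 .ad rfl
      have fop : τ.arr .op = σ.arr .op := by simpa using hS'.2.1 .op rfl
      have fmk : τ.arr .mk = σ.arr .mk := by simpa using hS'.2.1 .mk rfl
      have fri : τ.reg .i = i := by simpa [ri] using hS'.1 .i rfl
      have frp : τ.reg .p = p := by simpa [rp] using hS'.1 .p rfl
      have hwb : G.Adj (halfEnd L p) (halfOpp L h) := e2 ▸ adj_half hI.listing hh
      refine AC.Run.seq (AC.Run.set h (by simp) (by simp [hr, fad, e1]) (.inl rfl)
        (AC.Run.ite (σ.arr .mk (halfOpp L h)) (by simp) (by simp [fop, e3, fmk]) (fun hb => ?_)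
          (fun hb => ?_)))
      · refine AC.Run.skip ⟨i1.trans (Extends.of_eq (by simp) (by simp)), fun j' h1 h2 h3 => ?_,
          by simp [Nat.mul_succ]; omega⟩
        rcases Nat.lt_succ_iff_lt_or_eq.1 h2 with h4 | rfl
        · exact i2 j' h1 h4 h3
        · rw [e1] at h3
          exact absurd ((hmk _).1 hb) h3
      · replace hb : ¬ Reach (X.erase (edgeNo L i)) x (halfOpp L h) := fun h => (hmk _).2 h hb
        -- The far end of the path is touched by `X`, because the middle vertex is not and their
        -- edge is covered.
        obtain ⟨t1, t2⟩ := ht.exchange_path (hxy ▸ hiX) (hxy ▸ ha) (hxy ▸ hb) hadj.symm hwb htw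
          ((hX.covers _ _ hwb).resolve_left htw)
        have hY : insert (edgeNo L (h / 2)) (insert (edgeNo L (p / 2)) (X.erase (edgeNo L i))) =
            insert s(halfOpp L p, halfEnd L p) (insert s(halfEnd L p, halfOpp L h)
              (X.erase s(x, y))) := by
          rw [Finset.insert_comm, ← hep, e5, hxy, Sym2.eq_swap (a := halfEnd L p) (b := halfOpp L p)]
        refine (candidate_spec (done := done) hI
          ((((Cτ.tick 1).set _ (by decide)).tick 1).tick 1) hi hp hh (by simp [fri]) (by simp [frp])
          (by simp) (hY ▸ t1) (hY ▸ hX.covers.mono t2)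
          ((i1.trans (Extends.of_eq (by simp) (by simp))).1 done hS)).mono ?_
        rintro ρ _ _ ⟨g1, ⟨F, f1, f2⟩, g3⟩
        have Eρ : Extends G L τ ρ := .trans (.of_eq (by simp) (by simp)) g1
        refine ⟨(i1.trans Eρ).trans (Extends.of_eq (by simp) (by simp)), fun j' h1 h2 h3 => ?_,
          by simp [Nat.mul_succ] at g3 ⊢; omega⟩
        rcases Nat.lt_succ_iff_lt_or_eq.1 h2 with h4 | rfl
        · obtain ⟨F', a1, a2⟩ := i2 j' h1 h4 h3
          exact ⟨F', Eρ.found a1, a2⟩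
        · rw [hY, ← hxy] at f2
          exact ⟨F, f1, by rw [e1]; exact f2⟩
    · rintro τ _ _ ⟨i1, i2, i3⟩
      refine ⟨i1, fun _ _ => ⟨fun h => absurd h htw, fun _ b hwb hb => ?_⟩, ?_⟩
      · obtain ⟨j, h1, h2, rfl⟩ := hσ.loaded.exists_pos hI hwb
        exact i2 j h1 h2 hb
      · have h3 : T * σ.arr .st (halfEnd L p + 1) ≤
            T * σ.arr .st (halfEnd L p) + T * G.maxDegree := by
          rw [← Nat.mul_add]; exact Nat.mul_le_mul_left _ hwid
        have h6 : T * G.maxDegree = 110 * (L.length * G.maxDegree) + 6 * G.maxDegree := by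
          rw [hT]; ring
        simp only [Store.tick_clk]
        omega

/-- All moves that replace an edge of the current solution. -/
def exchangeMoves : AC :=
  .set .q (.add (.reg .M) (.reg .M)) ;;
  .loop .i .iq (.const 0) (.reg .M) (.ite (.cell .xs (.reg .i))
    (copy .al ;;
     .put .al (.reg .i) (.const 0) ;;
     .set .root (.cell .en (.add (.reg .i) (.reg .i))) ;;
     grow ;;
     .loop .p .pq (.const 0) (.reg .q) exchangeAt)
    .skip)

theorem exchangeMoves_spec {done : List (Finset (Sym2 (Fin n)))} (hI : IsInput G L)
    (hσ : Current G L X σ) (hX : IsMinimalCEDS G X) (hS : Search G L done σ) :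
    AC.Run (bound L) exchangeMoves σ fun τ => Extends G L σ τ ∧
      (∀ f ∈ X, ∃ x y, f = s(x, y) ∧ ∀ a w, Reach (X.erase f) x a → ¬ Reach (X.erase f) x w →
        G.Adj a w → Exchanged G (Found G L τ) X f x a w) ∧
      τ.clk ≤ σ.clk + 500 * (n * L.length ^ 2 * G.maxDegree) := by
  have hb := le_bound L
  have hm := hI.pos
  have hD1 := one_le_maxDegree hI
  have hn2 := hI.le_two_mul
  have hn0 : 0 < n := Nat.pos_of_ne_zero (NeZero.ne n)
  have ht := hX.isSubtree
  obtain ⟨T, hT⟩ : ∃ T, T = 450 * (L.length ^ 2 * G.maxDegree) := ⟨_, rfl⟩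
  obtain ⟨U, hU⟩ : ∃ U, U = 130 * (L.length * G.maxDegree) + 2 := ⟨_, rfl⟩
  have hTU : 5 * L.length + 50 * n * L.length + U * (2 * L.length) + 10 ≤ T := by
    have h1 : L.length ^ 2 * 1 ≤ L.length ^ 2 * G.maxDegree := Nat.mul_le_mul_left _ hD1
    have h2 : n * L.length ≤ 2 * L.length * L.length := Nat.mul_le_mul_right _ hn2
    have h3 : 1 * L.length ≤ L.length * L.length := Nat.mul_le_mul_right _ hm
    have h4 : 2 * L.length * L.length = 2 * L.length ^ 2 := by ring
    have h5 : L.length * L.length = L.length ^ 2 := by ring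
    have h6 : 50 * n * L.length = 50 * (n * L.length) := by ring
    have h7 : U * (2 * L.length) = 260 * (L.length ^ 2 * G.maxDegree) + 4 * L.length := by
      rw [hU]; ring
    omega
  refine AC.Run.seq (AC.Run.set (2 * L.length) (by simp) (by simp [hσ.loaded.M]; omega)
    (.inr (by omega)) (AC.Run.range (u := L.length)
    (fun i τ => Extends G L σ τ ∧ (∀ f ∈ below L X i, ∃ x y, f = s(x, y) ∧
        ∀ a w, Reach (X.erase f) x a → ¬ Reach (X.erase f) x w →
        G.Adj a w → Exchanged G (Found G L τ) X f x a w) ∧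
      -- The large cost `T` is charged only for edges of `X`, at most `n` in number; all other
      -- rounds cost a constant.
      τ.clk ≤ σ.clk + 3 + 4 * i + (below L X i).card * T)
    (by decide) rfl (by simp [hσ.loaded.M]) ?_ ?_ ?_))
  · exact ⟨Extends.of_eq (by simp) (by simp), by simp [below_zero], by simp⟩
  · rintro i hi τ hB hr hS' ⟨i1, i2, i3⟩
    have Cτ : Current G L X τ := ((hσ.set _ (by decide)).tick 1).same hS' rfl
    have frq : τ.reg .q = 2 * L.length := by simpa using hS'.1 .q rfl
    have hek := mk_halfEnd_halfOpp_double (L := L) i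
    refine AC.Run.ite (if edgeNo L i ∈ X then 1 else 0) (by simp) (by simp [hr, Cτ.xs i hi])
      (fun hc => ?_) (fun hc => ?_)
    swap
    · have hiX : edgeNo L i ∉ X := by simpa using hc
      rw [below_succ, if_neg hiX]
      exact AC.Run.skip ⟨i1.trans (Extends.of_eq (by simp) (by simp)), i2, by simp; omega⟩
    have hiX : edgeNo L i ∈ X := by simpa using hc
    rw [below_succ, if_pos hiX, Finset.card_insert_of_notMem (notMem_below hI hi)]
    refine AC.Run.seq ((copy_spec (dst := .al) ((Cτ.tick 1).tick 1) (by decide)).mono ?_)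
    rintro ρ _ S₁ ⟨hal, j2⟩
    have Cρ : Current G L X ρ := ((Cτ.tick 1).tick 1).same S₁ rfl
    have fri : ρ.reg .i = i := by simpa [hr] using S₁.1 .i rfl
    refine AC.Run.seq (AC.Run.put i 0 trivial trivial (by simpa using fri) rfl (.inl rfl)
      (AC.Run.seq (AC.Run.set (halfEnd L (i + i) : ℕ) (by simp)
        (by simpa [fri] using Cρ.loaded.en (i + i) (by omega)) (.inl rfl)
      (AC.Run.seq ((grow_spec (F := X.erase (edgeNo L i)) (r := halfEnd L (i + i)) hI ?_
        (fun e he => ht.sub e (Finset.mem_of_mem_erase he)) ?_ (by simp)).mono ?_)))))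
    · exact (((Cρ.loaded.put _ _ (by decide)).tick 1).set _ (by decide)).tick 1
    · simpa using hal.erase hI.listing hi
    rintro π _ S₂ ⟨-, hmk, p3⟩
    have Cπ : Current G L X π :=
      ((((Cρ.put _ _ (by decide)).tick 1).set _ (by decide)).tick 1).same S₂ rfl
    have Eπ : Extends G L τ π := Extends.of_eq
      (by simpa using (S₂.1 .top rfl).trans (by simpa using S₁.1 .top rfl))
      (by simpa using (S₂.2.1 .tb rfl).trans (by simpa using S₁.2.1 .tb rfl))
    have fri' : π.reg .i = i := by simpa [fri] using S₂.1 .i rfl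
    have frq' : π.reg .q = 2 * L.length := by
      simpa using (S₂.1 .q rfl).trans (by simpa [frq] using S₁.1 .q rfl)
    refine AC.Run.range (u := 2 * L.length) (fun p κ => Extends G L π κ ∧
        (∀ p' < p, Reach (X.erase (edgeNo L i)) (halfEnd L (i + i)) (halfOpp L p') →
          ¬ Reach (X.erase (edgeNo L i)) (halfEnd L (i + i)) (halfEnd L p') →
          Exchanged G (Found G L κ) X (edgeNo L i) (halfEnd L (i + i)) (halfOpp L p')
            (halfEnd L p')) ∧
        κ.clk ≤ π.clk + 2 + U * p) (by decide) rfl frq'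
        ⟨Extends.of_eq (by simp) (by simp), by simp, by simp⟩ ?_ ?_
    · rintro p hp κ hB hr hS' ⟨k1, k2, k3⟩
      have Cκ : Current G L X κ := Cπ.same hS' rfl
      have fmk : κ.arr .mk = π.arr .mk := hS'.2.1 .mk rfl
      refine (exchangeAt_spec (done := done) (y := halfOpp L (i + i)) hI (Cκ.tick 1) hX hi hp
        (by simpa [fri'] using hS'.1 .i rfl) (by simpa using hr) hek.symm hiX
        (by simpa [fmk] using hmk)
        (((i1.trans Eπ).trans (k1.trans (Extends.of_eq (by simp) (by simp)))).1 done hS)).mono ?_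
      rintro κ' _ _ ⟨l1, l2, l3⟩
      have Eκ : Extends G L κ κ' := .trans (.of_eq (by simp) (by simp)) l1
      refine ⟨(k1.trans Eκ).trans (Extends.of_eq (by simp) (by simp)), fun p' h1 h2 h3 => ?_,
        by simp [Nat.mul_succ] at l3 ⊢; omega⟩
      rcases Nat.lt_succ_iff_lt_or_eq.1 h1 with h | rfl
      · exact (k2 p' h h2 h3).mono fun F hF => Eκ.found hF
      · exact l2 h2 h3
    · rintro κ _ _ ⟨k1, k2, k3⟩
      have Eκ : Extends G L τ κ := Eπ.trans k1
      refine ⟨(i1.trans Eκ).trans (Extends.of_eq (by simp) (by simp)), fun f hf => ?_, ?_⟩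
      · rcases Finset.mem_insert.1 hf with rfl | hf
        · refine ⟨_, _, hek.symm, fun a w ha hw haw => ?_⟩
          -- The half-edge is oriented from the outer vertex `w` to the marked vertex `a`, as
          -- `exchangeAt` expects.
          obtain ⟨p, hp, rfl, rfl⟩ := exists_half hI.listing haw.symm
          exact k2 p hp ha hw
        · obtain ⟨x, y, e, h⟩ := i2 f hf
          exact ⟨x, y, e, fun a w ha hw haw => (h a w ha hw haw).mono fun F hF => Eκ.found hF⟩
      · simp only [Store.tick_clk] at j2
        simp only [Nat.add_mul, one_mul, Store.tick_clk, Store.set_clk, Store.put_clk] at p3 ⊢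
        omega
  · rintro τ _ _ ⟨i1, i2, i3⟩
    rw [below_length hI ht.sub] at i2 i3
    refine ⟨i1, i2, ?_⟩
    have h1 : X.card * T ≤ n * T := Nat.mul_le_mul_right _ (by simpa using ht.card_le)
    have h2 : n * T = 450 * (n * L.length ^ 2 * G.maxDegree) := by rw [hT]; ring
    have h3 : 1 * (L.length * 1) * 1 ≤ n * (L.length * L.length) * G.maxDegree :=
      Nat.mul_le_mul (Nat.mul_le_mul hn0 (Nat.mul_le_mul_left _ hm)) hD1
    have h4 : n * (L.length * L.length) * G.maxDegree = n * L.length ^ 2 * G.maxDegree := by ring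
    simp only [Store.tick_clk]
    omega

/-- All moves from the current solution. -/
def moves : AC := degrees .xs .dx ;; leafMoves ;; exchangeMoves

theorem moves_spec {done : List (Finset (Sym2 (Fin n)))} (hI : IsInput G L)
    (hσ : Loaded G L σ) (hs : RepSet L (σ.arr .xs) X) (hX : IsMinimalCEDS G X)
    (hS : Search G L done σ) :
    AC.Run (bound L) moves σ fun τ => Extends G L σ τ ∧ MoveClosed G (Found G L τ) X ∧
      τ.clk ≤ σ.clk + 800 * (n * L.length ^ 2 * G.maxDegree) := by
  have hm := hI.pos
  have hD1 := one_le_maxDegree hI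
  have hn0 : 0 < n := Nat.pos_of_ne_zero (NeZero.ne n)
  refine AC.Run.seq ((degrees_spec hI hσ hX.isSubtree.sub hs (by decide) (by decide) (by decide)
    (by decide) (by decide)).mono ?_)
  rintro τ _ S₁ ⟨h1, h2⟩
  have Cτ : Current G L X τ := ⟨hσ.same S₁ rfl, by rwa [S₁.2.1 .xs rfl], h1⟩
  have Eτ : Extends G L σ τ := Extends.of_eq (S₁.1 .top rfl) (S₁.2.1 .tb rfl)
  refine AC.Run.seq ((leafMoves_spec hI Cτ hX (Eτ.1 done hS)).mono ?_)
  rintro ρ _ S₂ ⟨Eρ, h3, h4⟩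
  have Cρ : Current G L X ρ := Cτ.same S₂ rfl
  refine (exchangeMoves_spec hI Cρ hX ((Eτ.trans Eρ).1 done hS)).mono ?_
  rintro π _ _ ⟨Eπ, h5, h6⟩
  refine ⟨(Eτ.trans Eρ).trans Eπ, ⟨fun v hv hw => ?_, h5⟩, ?_⟩
  · obtain ⟨F, hF, h⟩ := h3 v hv hw
    exact ⟨F, Eπ.found hF, h⟩
  · have e1 : n * (L.length * L.length) * G.maxDegree = n * L.length ^ 2 * G.maxDegree := by ring
    have e2 : 1 * (L.length * 1) * 1 ≤ n * (L.length * L.length) * G.maxDegree :=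
      Nat.mul_le_mul (Nat.mul_le_mul hn0 (Nat.mul_le_mul_left _ hm)) hD1
    have e3 : n * (L.length * 1) * G.maxDegree ≤ n * (L.length * L.length) * G.maxDegree :=
      Nat.mul_le_mul_right _ (Nat.mul_le_mul_left _ (Nat.mul_le_mul_left _ hm))
    have e4 : n * (L.length * 1) * G.maxDegree = n * (L.length * G.maxDegree) := by ring
    omega

end RAM

/-! ### Reading the input -/

section Segments

variable {n : ℕ} [NeZero n] {G : SimpleGraph (Fin n)} {L : List (Fin n × Fin n)}

theorem halfEnd_double (i : ℕ) : halfEnd L (i + i) = (L.getD i (0, 0)).1 := by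
  rw [halfEnd, if_pos (by omega), show (i + i) / 2 = i by omega]

theorem halfOpp_double (i : ℕ) : halfOpp L (i + i) = (L.getD i (0, 0)).2 := by
  rw [halfOpp, if_pos (by omega), show (i + i) / 2 = i by omega]

theorem halfEnd_double_succ (i : ℕ) : halfEnd L (i + i + 1) = (L.getD i (0, 0)).2 := by
  rw [halfEnd, if_neg (by omega), show (i + i + 1) / 2 = i by omega]

theorem halfOpp_double_succ (i : ℕ) : halfOpp L (i + i + 1) = (L.getD i (0, 0)).1 := by
  rw [halfOpp, if_neg (by omega), show (i + i + 1) / 2 = i by omega]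

/-- Positions `a` to `b - 1` of `ad` list the half-edges at `v` with number less than `h`. -/
structure IsSegment (L : List (Fin n × Fin n)) (ad : ℕ → ℕ) (v : Fin n) (h a b : ℕ) : Prop where
  le : a ≤ b
  mem : ∀ j, a ≤ j → j < b → ad j < h ∧ halfEnd L (ad j) = v
  all : ∀ h' < h, halfEnd L h' = v → ∃ j, a ≤ j ∧ j < b ∧ ad j = h'
  inj : ∀ j j', a ≤ j → j < j' → j' < b → ad j ≠ ad j'

theorem IsSegment.empty (L : List (Fin n × Fin n)) (ad : ℕ → ℕ) (v : Fin n) (a : ℕ) :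
    IsSegment L ad v 0 a a :=
  ⟨le_rfl, fun _ _ _ => by omega, fun _ h => absurd h (Nat.not_lt_zero _), fun _ _ _ _ _ => by omega⟩

variable {ad ad' : ℕ → ℕ} {v : Fin n} {h a b : ℕ}

theorem IsSegment.congr (hs : IsSegment L ad v h a b) (he : ∀ j < b, ad' j = ad j) :
    IsSegment L ad' v h a b where
  le := hs.le
  mem := fun j h1 h2 => by rw [he j h2]; exact hs.mem j h1 h2
  all := fun h' h1 h2 => by
    obtain ⟨j, h3, h4, h5⟩ := hs.all h' h1 h2
    exact ⟨j, h3, h4, (he j h4).trans h5⟩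
  inj := fun j j' h1 h2 h3 => by rw [he j (by omega), he j' h3]; exact hs.inj j j' h1 h2 h3

theorem IsSegment.skip (hs : IsSegment L ad v h a b) (hv : halfEnd L h ≠ v) :
    IsSegment L ad v (h + 1) a b where
  le := hs.le
  mem := fun j h1 h2 => ⟨(hs.mem j h1 h2).1.trans (Nat.lt_succ_self h), (hs.mem j h1 h2).2⟩
  all := fun h' h1 h2 => (Nat.lt_succ_iff_lt_or_eq.1 h1).elim (fun h3 => hs.all h' h3 h2)
    fun h3 => absurd (h3 ▸ h2) hv
  inj := hs.inj

theorem IsSegment.push (hs : IsSegment L ad v h a b) (hv : halfEnd L h = v) :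
    IsSegment L (Function.update ad b h) v (h + 1) a (b + 1) := by
  have hlt : ∀ j < b, Function.update ad b h j = ad j := fun j hj =>
    Function.update_of_ne (by omega) _ _
  have hb : Function.update ad b h b = h := Function.update_self _ _ _
  refine ⟨hs.le.trans (Nat.le_succ b), fun j h1 h2 => ?_, fun h' h1 h2 => ?_, fun j j' h1 h2 h3 => ?_⟩
  · rcases Nat.lt_succ_iff_lt_or_eq.1 h2 with h3 | rfl
    · rw [hlt j h3]
      exact ⟨(hs.mem j h1 h3).1.trans (Nat.lt_succ_self h), (hs.mem j h1 h3).2⟩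
    · rw [hb]
      exact ⟨Nat.lt_succ_self h, hv⟩
  · rcases Nat.lt_succ_iff_lt_or_eq.1 h1 with h3 | rfl
    · obtain ⟨j, h4, h5, h6⟩ := hs.all h' h3 h2
      exact ⟨j, h4, by omega, (hlt j h5).trans h6⟩
    · exact ⟨b, hs.le, Nat.lt_succ_self b, hb⟩
  · rw [hlt j (by omega)]
    rcases Nat.lt_succ_iff_lt_or_eq.1 h3 with h4 | rfl
    · rw [hlt j' h4]
      exact hs.inj j j' h1 h2 h4
    · rw [hb]
      exact (hs.mem j h1 h2).1.ne

/-- Distinct half-edges at `v` have distinct opposite ends, so positions inject into the neighbours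
of `v`. -/
theorem IsSegment.width [DecidableRel G.Adj] (hL : IsEdgeListing G L)
    (hs : IsSegment L ad v (2 * L.length) a b) : b ≤ a + G.maxDegree := by
  have h1 : (Finset.Ico a b).card ≤ (G.neighborFinset v).card := by
    refine Finset.card_le_card_of_injOn (fun j => halfOpp L (ad j)) (fun j hj => ?_)
      (fun j hj j' hj' hjj => ?_)
    · have hj := Finset.mem_Ico.1 hj
      obtain ⟨h2, h3⟩ := hs.mem j hj.1 hj.2
      simpa using h3 ▸ adj_half hL h2
    · have hj := Finset.mem_Ico.1 hj
      have hj' := Finset.mem_Ico.1 hj'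
      obtain ⟨h2, h3⟩ := hs.mem j hj.1 hj.2
      obtain ⟨h4, h5⟩ := hs.mem j' hj'.1 hj'.2
      have he := half_inj hL h2 h4 (h3.trans h5.symm) hjj
      rcases lt_trichotomy j j' with h | h | h
      · exact absurd he (hs.inj j j' hj.1 h hj'.2)
      · exact h
      · exact absurd he.symm (hs.inj j' j hj'.1 h hj.2)
  have h2 := G.degree_le_maxDegree v
  rw [Nat.card_Ico, SimpleGraph.card_neighborFinset_eq_degree] at h1
  omega

end Segments

namespace RAM

variable {n : ℕ} [NeZero n] {G : SimpleGraph (Fin n)} [DecidableRel G.Adj]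
  {L : List (Fin n × Fin n)} {F X : Finset (Sym2 (Fin n))} {σ : Store}

/-- The input is in its array, and the number of edges in register `M`. -/
structure HasInput (L : List (Fin n × Fin n)) (σ : Store) : Prop where
  M : σ.reg .M = L.length
  zero : σ.arr .inp 0 = n
  fst : ∀ i < L.length, σ.arr .inp (i + i + 2) = (L.getD i (0, 0)).1
  snd : ∀ i < L.length, σ.arr .inp (i + i + 3) = (L.getD i (0, 0)).2

/-- Creates the half-edges, and computes `2 ^ M`. -/
def readInput : AC :=
  .set .N (.cell .inp (.const 0)) ;;
  .loop .i .iq (.const 0) (.reg .M)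
    (.set .p (.add (.reg .i) (.reg .i)) ;;
     .set .c (.cell .inp (.add (.reg .p) (.const 2))) ;;
     .set .u (.cell .inp (.add (.reg .p) (.const 3))) ;;
     .put .en (.reg .p) (.reg .c) ;;
     .put .op (.reg .p) (.reg .u) ;;
     .put .ei (.reg .p) (.reg .i) ;;
     .put .en (.add (.reg .p) (.const 1)) (.reg .u) ;;
     .put .op (.add (.reg .p) (.const 1)) (.reg .c) ;;
     .put .ei (.add (.reg .p) (.const 1)) (.reg .i)) ;;
  .set .full (.const 1) ;;
  .loop .i .iq (.const 0) (.reg .M) (.set .full (.add (.reg .full) (.reg .full)))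

theorem readInput_spec (hI : IsInput G L) (hσ : HasInput L σ) :
    AC.Run (bound L) readInput σ fun τ => (τ.reg .M = L.length ∧ τ.reg .N = n ∧
        τ.reg .full = 2 ^ L.length ∧ (∀ h < 2 * L.length, τ.arr .en h = halfEnd L h ∧
          τ.arr .op h = halfOpp L h ∧ τ.arr .ei h = h / 2)) ∧
      τ.clk ≤ σ.clk + 30 * L.length := by
  have hm := hI.pos
  have hb := le_bound L
  have hb' := pow_lt_bound (L := L)
  refine AC.Run.seq (AC.Run.set n (by simp) (by simp [hσ.zero]) (.inl rfl)
    (AC.Run.seq (AC.Run.range (u := L.length) (fun i τ =>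
      (∀ h < i + i, τ.arr .en h = halfEnd L h ∧ τ.arr .op h = halfOpp L h ∧
        τ.arr .ei h = h / 2) ∧ τ.clk = σ.clk + 3 + 11 * i)
      (by decide) rfl (by simpa using hσ.M) (by simp) ?_ ?_)))
  · rintro i hi τ hB hr hS ⟨i1, i2⟩
    have fM : τ.reg .M = L.length := by simpa [hσ.M] using hS.1 .M rfl
    have fi : τ.arr .inp = σ.arr .inp := by simpa using hS.2.1 .inp rfl
    have e1 := hσ.fst i hi
    have e2 := hσ.snd i hi
    refine AC.Run.seq (AC.Run.set (i + i) (by simp) (by simp [hr]) (.inr (by omega))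
      (AC.Run.seq (AC.Run.set (L.getD i (0, 0)).1 (by simp [fM]; omega) (by simp [fi, e1]) (.inl rfl)
      (AC.Run.seq (AC.Run.set (L.getD i (0, 0)).2 (by simp [fM]; omega) (by simp [fi, e2]) (.inl rfl)
      (AC.Run.seq (AC.Run.put (i + i) (L.getD i (0, 0)).1 trivial trivial (by simp) (by simp) (.inl rfl)
      (AC.Run.seq (AC.Run.put (i + i) (L.getD i (0, 0)).2 trivial trivial (by simp) (by simp) (.inl rfl)
      (AC.Run.seq (AC.Run.put (i + i) i trivial trivial (by simp) (by simp [hr]) (.inl rfl)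
      (AC.Run.seq (AC.Run.put (i + i + 1) (L.getD i (0, 0)).2 (by simp) trivial (by simp) (by simp)
        (.inl rfl)
      (AC.Run.seq (AC.Run.put (i + i + 1) (L.getD i (0, 0)).1 (by simp) trivial (by simp) (by simp)
        (.inl rfl)
      (AC.Run.put (i + i + 1) i (by simp) trivial (by simp) (by simp [hr]) (.inl rfl)
        ⟨fun h hh => ?_, by simp; omega⟩))))))))))))))))
    rcases (by omega : h < i + i ∨ h = i + i ∨ h = i + i + 1) with h1 | rfl | rfl
    · have n1 : h ≠ i + i := by omega
      have n2 : h ≠ i + i + 1 := by omega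
      simpa [Function.update_of_ne n1, Function.update_of_ne n2] using i1 h h1
    · simp [halfEnd_double, halfOpp_double]
      omega
    · simp [halfEnd_double_succ, halfOpp_double_succ]
      omega
  · rintro τ _ S₁ ⟨i1, i2⟩
    refine AC.Run.seq (AC.Run.set 1 trivial rfl (.inl rfl) (AC.Run.range (u := L.length)
      (fun i ρ => ρ.reg .full = 2 ^ i ∧ ρ.clk = τ.clk + 4 + 3 * i)
      (by decide) rfl (by simpa [hσ.M] using S₁.1 .M rfl) (by simp) ?_ ?_))
    · rintro i hi ρ _ hr hS ⟨j1, j2⟩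
      have hle : 2 ^ (i + 1) ≤ 2 ^ L.length := Nat.pow_le_pow_right (by omega) hi
      exact AC.Run.set (2 ^ (i + 1)) (by simp) (by simp [j1, pow_succ]; omega) (.inr (by omega))
        ⟨by simp, by simp; omega⟩
    · rintro ρ _ S₂ ⟨j1, j2⟩
      refine ⟨⟨?_, ?_, j1, fun h hh => ?_⟩, by simp; omega⟩
      · simpa using (S₂.1 .M rfl).trans (by simpa [hσ.M] using S₁.1 .M rfl)
      · simpa using (S₂.1 .N rfl).trans (by simpa using S₁.1 .N rfl)
      · have a1 : ρ.arr .en = τ.arr .en := by simpa using S₂.2.1 .en rfl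
        have a2 : ρ.arr .op = τ.arr .op := by simpa using S₂.2.1 .op rfl
        have a3 : ρ.arr .ei = τ.arr .ei := by simpa using S₂.2.1 .ei rfl
        simpa [a1, a2, a3] using i1 h (by omega)

/-- Builds the adjacency lists. -/
def buildLists : AC :=
  .set .q (.const 0) ;;
  .set .e (.add (.reg .M) (.reg .M)) ;;
  .put .st (.const 0) (.const 0) ;;
  .loop .v .vq (.const 0) (.reg .N)
    (.loop .k .kq (.const 0) (.reg .e)
      (.ite (.ne (.cell .en (.reg .k)) (.reg .v)) .skip
        (.put .ad (.reg .q) (.reg .k) ;; .set .q (.add (.reg .q) (.const 1)))) ;;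
     .put .st (.add (.reg .v) (.const 1)) (.reg .q))

theorem buildLists_spec (hI : IsInput G L) (hM : σ.reg .M = L.length) (hN : σ.reg .N = n)
    (hen : ∀ h < 2 * L.length, σ.arr .en h = halfEnd L h) :
    AC.Run (bound L) buildLists σ fun τ => IsAdjacency G L (τ.arr .st) (τ.arr .ad) ∧
      τ.clk ≤ σ.clk + 30 * (n * L.length) := by
  have hm := hI.pos
  have hb := le_bound L
  have hn1 := hI.le
  have hn0 : 0 < n := Nat.pos_of_ne_zero (NeZero.ne n)
  obtain ⟨T, hT⟩ : ∃ T, T = 10 * L.length + 6 := ⟨_, rfl⟩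
  refine AC.Run.seq (AC.Run.set 0 trivial rfl (.inl rfl)
    (AC.Run.seq (AC.Run.set (2 * L.length) (by simp) (by simp [hM]; omega) (.inr (by omega))
    (AC.Run.seq (AC.Run.put 0 0 trivial trivial rfl rfl (.inl rfl)
    (AC.Run.range (u := n) (fun x τ => τ.arr .st x = τ.reg .q ∧
        (∀ y ≤ x, τ.arr .st y ≤ τ.reg .q) ∧
        (∀ y : Fin n, (y : ℕ) < x →
          IsSegment L (τ.arr .ad) y (2 * L.length) (τ.arr .st y) (τ.arr .st (y + 1))) ∧
        -- Knowing exactly how many half-edges have been listed keeps `q` within `2 * m`, for the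
        -- number bound and for the field `last`.
        τ.reg .q = ((Finset.range (2 * L.length)).filter fun h => (halfEnd L h : ℕ) < x).card ∧
        τ.clk ≤ σ.clk + 5 + T * x)
      (by decide) rfl (by simpa using hN) ?_ ?_ ?_))))))
  · exact ⟨by simp, by simp, by simp, by simp, by simp⟩
  · rintro x hx τ hB hr hS ⟨i1, i2, i3, i4, i5⟩
    obtain ⟨v, rfl⟩ : ∃ v : Fin n, (v : ℕ) = x := ⟨⟨x, hx⟩, rfl⟩
    have fe : τ.reg .e = 2 * L.length := by simpa using hS.1 .e rfl
    have fen : τ.arr .en = σ.arr .en := by simpa using hS.2.1 .en rfl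
    have hq : τ.reg .q + 2 * L.length ≤ bound L := by
      have := (Finset.card_filter_le (Finset.range (2 * L.length))
        fun h => (halfEnd L h : ℕ) < v).trans_eq (Finset.card_range _)
      omega
    refine AC.Run.seq (AC.Run.range (u := 2 * L.length) (fun h ρ =>
        IsSegment L (ρ.arr .ad) v h (τ.reg .q) (ρ.reg .q) ∧
        (∀ j < τ.reg .q, ρ.arr .ad j = τ.arr .ad j) ∧
        ρ.reg .q = τ.reg .q + ((Finset.range h).filter fun h => halfEnd L h = v).card ∧
        ρ.clk ≤ τ.clk + 3 + 5 * h)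
      (by decide) rfl (by simpa using fe) ?_ ?_ ?_)
    · exact ⟨by simpa using IsSegment.empty _ _ _ _, by simp, by simp, by simp⟩
    · rintro h hh ρ hB' hr' hS' ⟨j1, j2, j3, j4⟩
      have gen : ρ.arr .en h = halfEnd L h := by
        rw [show ρ.arr .en = σ.arr .en by simpa [fen] using hS'.2.1 .en rfl, hen h hh]
      have grv : ρ.reg .v = v := by simpa [hr] using hS'.1 .v rfl
      refine AC.Run.iteNe (halfEnd L h) v (by simp) trivial (by simp [hr', gen]) (by simp [grv])
        (fun hv => ?_) (fun hv => ?_)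
      · rw [Ne, Fin.val_inj] at hv
        rw [Finset.range_add_one, Finset.filter_insert, if_neg hv]
        exact AC.Run.skip ⟨by simpa using j1.skip hv, by simpa using j2, by simpa using j3,
          by simp; omega⟩
      · rw [Fin.val_inj] at hv
        have hcard := (Finset.card_filter_le (Finset.range h)
          fun h => halfEnd L h = v).trans_eq (Finset.card_range _)
        rw [Finset.range_add_one, Finset.filter_insert, if_pos hv,
          Finset.card_insert_of_notMem (by simp)]
        refine AC.Run.seq (AC.Run.put (ρ.reg .q) h trivial trivial rfl (by simp [hr']) (.inl rfl)
          (AC.Run.set (ρ.reg .q + 1) (by simp) (by simp) (.inr (by omega))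
          ⟨by simpa using j1.push hv, fun j hj => ?_, by simp; omega, by simp; omega⟩))
        have hne : j ≠ ρ.reg .q := by
          have := j1.le
          omega
        simpa [Function.update_of_ne hne] using j2 j hj
    · rintro ρ _ S₁ ⟨j1, j2, j3, j4⟩
      have fst : ρ.arr .st = τ.arr .st := by simpa using S₁.2.1 .st rfl
      have frv : ρ.reg .v = v := by simpa [hr] using S₁.1 .v rfl
      refine AC.Run.put (v + 1) (ρ.reg .q) (by simp) trivial (by simp [frv]) rfl (.inl rfl)
        ⟨by simp, fun y hy => ?_, fun y hy => ?_, ?_, ?_⟩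
      · rcases Nat.le_succ_iff.1 hy with h | rfl
        · have := i2 y h
          have hne : y ≠ v + 1 := by omega
          have hle := j1.le
          simp [Function.update_of_ne hne, fst]
          omega
        · simp
      · rcases Nat.lt_succ_iff_lt_or_eq.1 hy with h | h
        · have h1 : (y : ℕ) ≠ v + 1 := by omega
          have h2 : (y : ℕ) ≠ v := by omega
          have h3 := i2 (y + 1) h
          simpa [Function.update_apply, h1, h2, fst] using
            (i3 y h).congr fun j hj => j2 j (by omega)
        · rw [Fin.val_inj] at h
          subst h
          have h1 : (y : ℕ) ≠ y + 1 := by omega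
          simpa [Function.update_apply, fst, i1] using j1
      · simp only [Store.tick_reg, Store.set_reg, Store.put_reg, reduceCtorEq, if_false]
        rw [j3, i4, ← Finset.card_union_of_disjoint, ← Finset.filter_or]
        · congr 1
          ext h
          simp only [Finset.mem_filter, ← Fin.val_inj, Nat.lt_succ_iff_lt_or_eq]
        · refine Finset.disjoint_filter.2 fun h _ h1 h2 => ?_
          rw [h2] at h1
          exact absurd h1 (lt_irrefl _)
      · simp [Nat.mul_succ]
        omega
  · rintro τ _ _ ⟨i1, i2, i3, i4, i5⟩
    refine ⟨⟨?_, fun v hv => (i3 ⟨v, hv⟩ hv).le, fun v hv => (i3 ⟨v, hv⟩ hv).width hI.listing,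
      fun v => (i3 v v.2).mem, fun h hh => (i3 _ (Fin.is_lt _)).all h hh rfl,
      fun v => (i3 v v.2).inj⟩, ?_⟩
    · simp only [Store.tick_arr]
      rw [i1, i4]
      exact (Finset.card_filter_le _ _).trans_eq (Finset.card_range _)
    have h1 : n * 1 ≤ n * L.length := Nat.mul_le_mul_left _ hm
    have h2 : T * n = 10 * (n * L.length) + 6 * n := by rw [hT]; ring
    simp only [Store.tick_clk]
    omega

end RAM

/-! ### Starting the search, and printing -/

namespace RAM

variable {n : ℕ} [NeZero n] {G : SimpleGraph (Fin n)} [DecidableRel G.Adj]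
  {L : List (Fin n × Fin n)} {F X : Finset (Sym2 (Fin n))} {σ : Store}

/-- Finds a first minimal connected edge dominating set within a spanning tree. -/
def start : AC :=
  .loop .k .kq (.const 0) (.reg .M) (.put .al (.reg .k) (.const 1)) ;;
  .set .root (.const 0) ;;
  grow ;;
  process

/-- With all edges allowed, `grow` produces a spanning tree, which covers every edge and so is a
legitimate candidate for `process`. -/
theorem start_spec (hI : IsInput G L) (hσ : Loaded G L σ) (htop : σ.reg .top = 0)
    (htb : ∀ c, σ.arr .tb c = 0) :
    AC.Run (bound L) start σ fun τ => Loaded G L τ ∧ Search G L [] τ ∧ (∃ F, Found G L τ F) ∧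
      τ.clk ≤ σ.clk + 160 * (n * L.length) := by
  have hm := hI.pos
  have hn0 : 0 < n := Nat.pos_of_ne_zero (NeZero.ne n)
  have hS : Search G L [] σ := by
    refine ⟨[], by simp, by simp, fun c => by simp [htb], htop⟩
  obtain ⟨E, hE⟩ : ∃ E : Finset (Sym2 (Fin n)), ∀ e, e ∈ E ↔ e ∈ G.edgeSet :=
    ⟨(L.map fun p => s(p.1, p.2)).toFinset, fun e => by rw [List.mem_toFinset]; exact hI.listing.2 e⟩
  refine AC.Run.seq (AC.Run.range (u := L.length) (fun k τ =>
    (∀ j < k, τ.arr .al j = 1) ∧ τ.clk = σ.clk + 2 + 3 * k) (by decide) rfl hσ.M (by simp) ?_ ?_)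
  · rintro k hk τ _ hr _ ⟨j1, j2⟩
    refine AC.Run.put k 1 trivial trivial hr rfl (.inl rfl) ⟨fun j hj => ?_, by simp; omega⟩
    rcases Nat.lt_succ_iff_lt_or_eq.1 hj with h | rfl
    · simpa [Function.update_of_ne (show j ≠ k by omega)] using j1 j h
    · simp
  rintro τ _ S₁ ⟨j1, j2⟩
  have Lτ : Loaded G L (((τ.tick 1).set .root 0).tick 1) :=
    ((((hσ.same S₁ rfl).tick 1).set _ (by decide)).tick 1)
  refine AC.Run.seq (AC.Run.set 0 trivial rfl (.inl rfl) (AC.Run.seq ((grow_spec (F := E)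
    (r := 0) hI Lτ (fun e he => (hE e).1 he) (fun j hj => ?_) (by simp)).mono ?_)))
  · rw [if_pos ((hE _).2 (edgeNo_mem hI.listing hj))]
    exact j1 j hj
  rintro ρ _ S₂ ⟨⟨Z, hZ, hZt, hZs, hZr⟩, -, k3⟩
  have Lρ := Lτ.same S₂ rfl
  have hreach : ∀ v, Reach Z 0 v := fun v => hZr v (by
    have : SimpleGraph.fromEdgeSet (↑E : Set (Sym2 (Fin n))) = G := by
      ext a b
      simp only [SimpleGraph.fromEdgeSet_adj, Finset.mem_coe, hE, SimpleGraph.mem_edgeSet]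
      exact ⟨fun h => h.1, fun h => ⟨h, h.ne⟩⟩
    rw [Reach, this]
    exact hI.conn.preconnected 0 v)
  have hcov : Covers G Z := by
    intro a b hab
    by_cases ha : (0 : Fin n) = a
    · exact .inr ((hreach b).touches (ha ▸ hab.ne))
    · exact .inl ((hreach a).touches ha)
  have Eρ : Extends G L σ ρ := Extends.of_eq
    (by simpa using (S₂.1 .top rfl).trans (by simpa using S₁.1 .top rfl))
    (by simpa using (S₂.2.1 .tb rfl).trans (by simpa using S₁.2.1 .tb rfl))
  refine (process_spec (done := []) hI Lρ hZt hcov hZs (Eρ.1 _ hS)).mono ?_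
  rintro π _ S₃ ⟨l1, ⟨F, -, l2⟩, l3⟩
  refine ⟨Lρ.same S₃ rfl, (Eρ.trans l1).1 _ hS, ⟨F, l2⟩, ?_⟩
  have h1 : 1 * L.length ≤ n * L.length := Nat.mul_le_mul_right _ hn0
  have h2 : 50 * n * L.length = 50 * (n * L.length) := by ring
  simp at k3
  omega

/-- The preparatory part of the program. -/
def prepare : AC := readInput ;; buildLists ;; start

theorem prepare_spec (hI : IsInput G L) (hσ : HasInput L σ) (htop : σ.reg .top = 0)
    (htb : ∀ c, σ.arr .tb c = 0) :
    AC.Run (bound L) prepare σ fun τ => Loaded G L τ ∧ Search G L [] τ ∧ (∃ F, Found G L τ F) ∧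
      τ.clk ≤ σ.clk + 250 * (n * L.length) := by
  have hn0 : 0 < n := Nat.pos_of_ne_zero (NeZero.ne n)
  refine AC.Run.seq ((readInput_spec hI hσ).mono ?_)
  rintro τ _ S₁ ⟨⟨h1, h2, h3, h4⟩, h5⟩
  refine AC.Run.seq ((buildLists_spec hI h1 h2 fun h hh => (h4 h hh).1).mono ?_)
  rintro ρ _ S₂ ⟨h6, h7⟩
  have hρ : Loaded G L ρ := by
    refine ⟨(S₂.1 .M rfl).trans h1, (S₂.1 .N rfl).trans h2, (S₂.1 .full rfl).trans h3, ?_, ?_, ?_, h6⟩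
    · rw [S₂.2.1 .en rfl]; exact fun h hh => (h4 h hh).1
    · rw [S₂.2.1 .op rfl]; exact fun h hh => (h4 h hh).2.1
    · rw [S₂.2.1 .ei rfl]; exact fun h hh => (h4 h hh).2.2
  refine (start_spec hI hρ ?_ ?_).mono ?_
  · rw [S₂.1 .top rfl, S₁.1 .top rfl, htop]
  · rw [S₂.2.1 .tb rfl, S₁.2.1 .tb rfl]; exact htb
  · rintro π _ _ ⟨g1, g2, g3, g4⟩
    have h8 : 1 * L.length ≤ n * L.length := Nat.mul_le_mul_right _ hn0
    exact ⟨g1, g2, g3, by omega⟩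

/-- Pops the top of the stack, decodes it to `xs`, and prints it. -/
def pop : AC :=
  .set .code (.sub (.reg .top) (.const 1)) ;;
  .set .top (.sub (.cell .tb (.reg .code)) (.const 1)) ;;
  .loop .i .iq (.const 0) (.reg .M)
    (.set .code (.add (.reg .code) (.reg .code)) ;;
     .ite (.sub (.add (.reg .code) (.const 1)) (.reg .full))
      (.put .xs (.reg .i) (.const 1) ;; .set .code (.sub (.reg .code) (.reg .full)) ;;
       .print (.reg .i))
      (.put .xs (.reg .i) (.const 0)))

/-- The positions of the edges of `F` in increasing order. -/
def positions (L : List (Fin n × Fin n)) (F : Finset (Sym2 (Fin n))) (k : ℕ) : List ℕ :=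
  (List.range k).filter (edgeNo L · ∈ F)

theorem positions_succ (k : ℕ) : positions L F (k + 1) =
    positions L F k ++ if edgeNo L k ∈ F then [k] else [] := by
  rw [positions, List.range_succ, List.filter_append]
  congr 1
  split_ifs with h <;> simp [h]

theorem printsEdgeSet_positions (hL : IsEdgeListing G L) (hF : ∀ e ∈ F, e ∈ G.edgeSet) :
    PrintsEdgeSet L (positions L F L.length) F := by
  refine ⟨List.nodup_range.filter _, fun i hi => ?_, fun e => ⟨fun he => ?_, ?_⟩⟩
  · simp [positions] at hi
    exact hi.1
  · obtain ⟨i, hi, rfl⟩ := exists_edgeNo hL (hF e he)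
    exact ⟨i, by simp [positions, hi, he], (getElem?_edges _ _).2 ⟨hi, rfl⟩⟩
  · rintro ⟨i, hi, h⟩
    simp [positions] at hi
    rw [← ((getElem?_edges _ _).1 h).2]
    exact hi.2

/-- The prefix is the quotient of `codeOf L F * 2 ^ i` by `2 ^ m`, so that bits can be read from the
most significant one without division. -/
theorem codeOf_bounds {i : ℕ} (hi : i ≤ L.length) :
    prefixCode L F i * 2 ^ L.length ≤ codeOf L F * 2 ^ i ∧
      codeOf L F * 2 ^ i < (prefixCode L F i + 1) * 2 ^ L.length := by
  obtain ⟨k, hk⟩ := Nat.exists_eq_add_of_le hi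
  obtain ⟨h1, h2⟩ := prefixCode_bounds (L := L) (F := F) i k
  rw [codeOf, hk, pow_add, mul_comm (2 ^ i), ← mul_assoc, ← mul_assoc]
  exact ⟨Nat.mul_le_mul_right _ h1, Nat.mul_lt_mul_of_pos_right h2 (by positivity)⟩

/-- The table is left as it is, so a popped set stays marked as visited and is never pushed again.
-/
theorem IsSearch.pop {done l : List (Finset (Sym2 (Fin n)))} {top : ℕ} {tb : ℕ → ℕ}
    (h : IsSearch G L done (F :: l) top tb) :
    IsSearch G L (done ++ [F]) l (tb (codeOf L F) - 1) tb := by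
  have e : done ++ [F] ++ l = done ++ F :: l := by simp
  exact ⟨e ▸ h.nodup, e ▸ h.minimal, e ▸ h.visited, h.stack.2⟩

theorem pop_spec {done l : List (Finset (Sym2 (Fin n)))} (hI : IsInput G L) (hσ : Loaded G L σ)
    (hS : IsSearch G L done (F :: l) (σ.reg .top) (σ.arr .tb)) :
    AC.Run (bound L) pop σ fun τ => Search G L (done ++ [F]) τ ∧ RepSet L (τ.arr .xs) F ∧
      τ.line = σ.line ++ positions L F L.length ∧ τ.clk ≤ σ.clk + 20 * L.length := by
  have hm := hI.pos
  have hb := le_bound L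
  have hb' := pow_lt_bound (L := L)
  have hc := codeOf_lt (L := L) (F := F)
  have htop := hS.stack.1
  have hpop := hS.pop
  have htb : σ.arr .tb (codeOf L F) - 1 ≤ 2 ^ L.length := hpop.stack.top_le
  refine AC.Run.seq (AC.Run.set (codeOf L F) (by simp) (by simp [htop]) (.inr (by omega))
    (AC.Run.seq (AC.Run.set (σ.arr .tb (codeOf L F) - 1) (by simp) (by simp) (.inr (by omega))
    (AC.Run.range (u := L.length) (fun i τ =>
      -- Register `code` holds the remainder of `codeOf L F * 2 ^ i` modulo `2 ^ m`. The next bit is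
      -- 1 exactly when the doubled remainder reaches `2 ^ m`, which the test `code + 1 - full`
      -- detects.
      τ.reg .code + prefixCode L F i * 2 ^ L.length = codeOf L F * 2 ^ i ∧
      (∀ j < i, τ.arr .xs j = if edgeNo L j ∈ F then 1 else 0) ∧
      τ.line = σ.line ++ positions L F i ∧ τ.clk ≤ σ.clk + 4 + 7 * i)
      (by decide) rfl (by simpa using hσ.M) ?_ ?_ ?_))))
  · exact ⟨by simp [prefixCode], by simp, by simp [positions], by simp⟩
  · rintro i hi τ hB hr hS' ⟨i1, i2, i3, i4⟩
    have ffull : τ.reg .full = 2 ^ L.length := by simpa [hσ.full] using hS'.1 .full rfl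
    obtain ⟨b1, b2⟩ := codeOf_bounds (L := L) (F := F) (i := i) hi.le
    obtain ⟨b3, b4⟩ := codeOf_bounds (L := L) (F := F) (i := i + 1) hi
    have hxs : ∀ x, x = (if edgeNo L i ∈ F then 1 else 0) → ∀ j < i + 1,
        Function.update (τ.arr .xs) i x j = if edgeNo L j ∈ F then 1 else 0 := by
      rintro x rfl j hj
      rcases Nat.lt_succ_iff_lt_or_eq.1 hj with h | rfl
      · rw [Function.update_of_ne (by omega), i2 j h]
      · rw [Function.update_self]
    have e1 : codeOf L F * 2 ^ (i + 1) = codeOf L F * 2 ^ i + codeOf L F * 2 ^ i := by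
      rw [pow_succ]; ring
    rw [e1] at b3 b4 ⊢
    rw [add_mul, one_mul] at b2 b4
    rw [prefixCode, positions_succ]
    rw [prefixCode] at b3 b4
    refine AC.Run.seq (AC.Run.set (τ.reg .code + τ.reg .code) (by simp) (by simp) (.inr (by omega))
      (AC.Run.ite (τ.reg .code + τ.reg .code + 1 - 2 ^ L.length) (by simp) (by simp [ffull])
        (fun hx => ?_) (fun hx => ?_)))
    · have hF : edgeNo L i ∈ F := by
        by_contra hF
        rw [if_neg hF, add_zero, add_mul] at b4
        omega
      rw [if_pos hF] at b3 b4 hxs ⊢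
      refine AC.Run.seq (AC.Run.put i 1 trivial trivial (by simp [hr]) rfl (.inl rfl)
        (AC.Run.seq (AC.Run.set (τ.reg .code + τ.reg .code - 2 ^ L.length) (by simp)
          (by simp [ffull]) (.inr (by omega)) (AC.Run.print trivial ⟨?_, ?_, ?_, ?_⟩))))
      · simp only [add_mul, one_mul] at b3 ⊢
        simp
        omega
      · simpa using hxs 1 rfl
      · simp [hr, i3, hF]
      · simp; omega
    · have hF : edgeNo L i ∉ F := by
        intro hF
        rw [if_pos hF, add_mul, add_mul, one_mul] at b3
        omega
      rw [if_neg hF] at b3 b4 hxs ⊢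
      refine AC.Run.put i 0 trivial trivial (by simp [hr]) rfl (.inl rfl) ⟨?_, ?_, ?_, ?_⟩
      · simp only [add_zero, add_mul] at b3 ⊢
        simp
        omega
      · simpa using hxs 0 rfl
      · simp [i3, hF]
      · simp; omega
  · rintro τ _ S ⟨i1, i2, i3, i4⟩
    refine ⟨⟨l, ?_⟩, i2, i3, by simp; omega⟩
    have f1 : τ.reg .top = σ.arr .tb (codeOf L F) - 1 := by simpa using S.1 .top rfl
    have f2 : τ.arr .tb = σ.arr .tb := by simpa using S.2.1 .tb rfl
    simpa [f1, f2] using hpop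

end RAM

/-! ### The program -/

section Words

variable {n : ℕ} [NeZero n]

theorem length_graphInput (L : List (Fin n × Fin n)) : (graphInput L).length = 2 * L.length + 2 := by
  have : ∀ L : List (Fin n × Fin n),
      (L.flatMap fun p => [(p.1 : ℕ), (p.2 : ℕ)]).length = 2 * L.length := by
    intro L
    induction L with
    | nil => rfl
    | cons p L ih => simp at ih ⊢; omega
  simp only [graphInput, List.length_cons, this]

theorem graphInput_getD (L : List (Fin n × Fin n)) {i : ℕ} (hi : i < L.length) :
    (graphInput L).getD (i + i + 2) 0 = (L.getD i (0, 0)).1 ∧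
      (graphInput L).getD (i + i + 3) 0 = (L.getD i (0, 0)).2 := by
  have : ∀ (L : List (Fin n × Fin n)) (i : ℕ), i < L.length →
      (L.flatMap fun p => [(p.1 : ℕ), (p.2 : ℕ)]).getD (i + i) 0 = (L.getD i (0, 0)).1 ∧
      (L.flatMap fun p => [(p.1 : ℕ), (p.2 : ℕ)]).getD (i + i + 1) 0 = (L.getD i (0, 0)).2 := by
    intro L
    induction L with
    | nil => intro i hi; simp at hi
    | cons p L ih =>
      intro i hi
      cases i with
      | zero => exact ⟨rfl, rfl⟩
      | succ i =>
        rw [show i + 1 + (i + 1) = i + i + 1 + 1 by omega]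
        exact ih i (by simpa using hi)
  exact this L i hi

theorem graphInput_getD_le (L : List (Fin n × Fin n)) (i : ℕ) :
    (graphInput L).getD i 0 ≤ n + L.length := by
  rcases lt_or_ge i (graphInput L).length with h | h
  · rw [List.getD_eq_getElem _ _ h]
    have hmem := List.getElem_mem h
    generalize (graphInput L)[i] = x at hmem
    simp only [graphInput, List.mem_cons, List.mem_flatMap, List.not_mem_nil, or_false] at hmem
    rcases hmem with rfl | rfl | ⟨p, -, rfl | rfl⟩
    · omega
    · omega
    · have := p.1.2; omega
    · have := p.2.2; omega
  · rw [List.getD_eq_default _ _ h]; exact Nat.zero_le _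

end Words

namespace RAM

variable {n : ℕ} [NeZero n] {G : SimpleGraph (Fin n)} [DecidableRel G.Adj]
  {L : List (Fin n × Fin n)} {F X : Finset (Sym2 (Fin n))} {σ : Store} {s : Config} {m B W : ℕ}

theorem AC.Run.exec {K t : ℕ} {c : AC} {Q : Store → Prop} (hm : 0 < m) (hW : 8 ≤ W)
    (hB : W * K < B) (hwf : c.wf W = true) (h : AC.Run K c σ Q)
    (hQ : ∀ τ, Q τ → τ.clk ≤ σ.clk + t) (hR : Represents m s σ) (hb : σ.Bounded K) :
    ∃ s' τ, Exec B c.comp s s' ∧ Represents m s' τ ∧ τ.Bounded K ∧ c.Same σ τ ∧ Q τ ∧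
      s'.log = s.log ∧ s'.time ≤ s.time + W * t := by
  obtain ⟨h1, h2⟩ := h hb
  obtain ⟨s', h3, h4, h5, h6⟩ := c.simulate hm hW hB hwf hR hb h1
  refine ⟨s', _, h3, h4, c.bounded_den hb h1, c.same_den σ, h2, h5, ?_⟩
  have h7 : W * (c.den σ).clk ≤ W * σ.clk + W * t := by
    rw [← Nat.mul_add]; exact Nat.mul_le_mul_left _ (hQ _ h2)
  omega

theorem Represents.tick (h : Represents m s σ) (t : ℕ) : Represents m (s.tick t) σ :=
  ⟨h.reg, h.arr, h.inp, h.line, h.size⟩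

/-- Processes the top of the stack. -/
def body : Cmd := .seq pop.comp (.seq .endLine moves.comp)

/-- The enumeration program. -/
def program : Cmd :=
  .seq (.assign 0 (.load (.const 1))) (.seq prepare.comp (.loop (.reg 2) body))

/-- Growth and cost of a single step of the loop language. -/
theorem wf_program : prepare.wf 10000 = true ∧ pop.wf 10000 = true ∧ moves.wf 10000 = true := by
  decide

/-- The sets in `done` have been printed in time, and the moves from them have been made. -/
structure Progress (G : SimpleGraph (Fin n)) [DecidableRel G.Adj] (L : List (Fin n × Fin n))
    (A D : ℕ) (done : List (Finset (Sym2 (Fin n)))) (s : Config) (σ : Store) : Prop where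
  rep : Represents L.length s σ
  bdd : σ.Bounded (bound L)
  loaded : Loaded G L σ
  search : Search G L done σ
  found : ∃ F, Found G L σ F
  closed : ∀ F ∈ done, MoveClosed G (Found G L σ) F
  line : σ.line = []
  printed : List.Forall₂ (PrintsEdgeSet L) (s.log.map Prod.snd) done
  delay : List.IsChain (fun t t' => t' ≤ t + D) (0 :: s.log.map Prod.fst)
  last : ∀ t ∈ (0 :: s.log.map Prod.fst).getLast?, s.time ≤ t + A

variable {A D : ℕ} {done : List (Finset (Sym2 (Fin n)))}

/-- With an empty stack every set found is in `done`, so the found sets are closed under moves. As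
there is at least one, `of_moveClosed` applies. -/
theorem Progress.mem_iff (hI : IsInput G L) (h : Progress G L A D done s σ) (h0 : σ.reg .top = 0) :
    done.Nodup ∧ ∀ F, F ∈ done ↔ IsMinimalCEDS G F := by
  obtain ⟨l, hl⟩ := h.search
  obtain rfl : l = [] := by
    cases l with
    | nil => rfl
    | cons F l =>
      have := hl.stack.1
      omega
  have hnd := hl.nodup
  have hmin := hl.minimal
  have hvis := hl.visited
  rw [List.append_nil] at hnd hmin hvis
  have hfound : ∀ F, Found G L σ F → F ∈ done := by
    rintro F ⟨h1, h2⟩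
    obtain ⟨F', h3, h4⟩ := (hvis _).1 h2
    exact codeOf_inj hI.listing (hmin F' h3).isSubtree.sub h1.isSubtree.sub h4 ▸ h3
  refine ⟨hnd, fun F => ⟨hmin F, fun hF => ?_⟩⟩
  obtain ⟨X, hX⟩ := h.found
  exact hfound F (of_moveClosed hI.two (S := Found G L σ) (fun _ h => h.1)
    (fun X hX => h.closed X (hfound X hX)) hF hX)

theorem Progress.step (hI : IsInput G L) (h : Progress G L A D done s σ) (h0 : σ.reg .top ≠ 0)
    (hB : 10000 * bound L < B)
    (hA : 10000 * (800 * (n * L.length ^ 2 * G.maxDegree)) ≤ A)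
    (hD : A + 10000 * (20 * L.length) + 3 ≤ D) :
    ∃ F s' τ, F ∉ done ∧ Exec B body (s.tick 2) s' ∧ Progress G L A D (done ++ [F]) s' τ := by
  obtain ⟨w1, w2, w3⟩ := wf_program
  obtain ⟨l, hl⟩ := h.search
  obtain ⟨F, l, rfl⟩ : ∃ F l', l = F :: l' := by
    cases l with
    | nil => exact absurd hl.stack h0
    | cons F l => exact ⟨F, l, rfl⟩
  have hF : IsMinimalCEDS G F := hl.minimal F (by simp)
  have hFd : F ∉ done := by
    intro hd
    have := List.nodup_append.1 hl.nodup
    exact this.2.2 F hd F (by simp) rfl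
  obtain ⟨s₁, τ, x1, r1, b1, S1, ⟨p1, p2, p3, -⟩, g1, t1⟩ := (pop_spec hI h.loaded hl).exec hI.pos
    (by norm_num) hB w2 (fun _ h => h.2.2.2) (h.rep.tick 2) h.bdd
  -- Completing a line has no counterpart in the loop language, so the abstract line is emptied by
  -- hand.
  obtain ⟨τ', hτ'⟩ : ∃ τ' : Store, τ' = ⟨τ.reg, τ.arr, [], τ.clk⟩ := ⟨_, rfl⟩
  have hreg : τ'.reg = τ.reg := by rw [hτ']
  have harr : τ'.arr = τ.arr := by rw [hτ']
  have hline : τ'.line = [] := by rw [hτ']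
  have r1' : Represents L.length (s₁.tick 1).closeLine τ' :=
    ⟨by rw [hreg]; exact r1.reg, by rw [harr]; exact r1.arr, by rw [harr]; exact r1.inp,
      hline.symm, by rw [hreg]; exact r1.size⟩
  have b1' : τ'.Bounded (bound L) := ⟨b1.1, by rw [hreg]; exact b1.2.1, by rw [harr]; exact b1.2.2⟩
  have L1 : Loaded G L τ' := (h.loaded.same S1 rfl).congr (fun _ _ => by rw [hreg]) harr
  have p1' : Search G L (done ++ [F]) τ' := by rw [Search, hreg, harr]; exact p1
  obtain ⟨s₂, π, x2, r2, b2, S2, ⟨e2, c2, -⟩, g2, t2⟩ := (moves_spec hI L1 (by rw [harr]; exact p2)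
    hF p1').exec hI.pos (by norm_num) hB w3 (fun _ h => h.2.2) r1' b1'
  have E1 : ∀ F, Found G L σ F → Found G L π F := by
    refine fun F hF => e2.found ⟨hF.1, ?_⟩
    rw [harr, S1.2.1 .tb rfl]
    exact hF.2
  have hlog : s₂.log = s.log ++ [(s₁.time + 1, positions L F L.length)] := by
    rw [g2]
    change s₁.log ++ [(s₁.time + 1, s₁.line)] = _
    rw [g1, r1.line, p3, h.line]
    rfl
  have ht1 : s₁.time ≤ s.time + 2 + 10000 * (20 * L.length) := t1
  refine ⟨F, s₂, π, hFd, .seq x1 (.seq (.endLine _) x2), r2, b2, L1.same S2 rfl, e2.1 _ p1',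
    h.found.imp E1, ?_, ?_, ?_, ?_, ?_⟩
  · intro X hX
    rcases List.mem_append.1 hX with hX | hX
    · exact (h.closed X hX).mono E1
    · rw [List.mem_singleton.1 hX]; exact c2
  · rw [S2.2.2 rfl, hline]
  · rw [hlog, List.map_append]
    exact List.rel_append h.printed (.cons (printsEdgeSet_positions hI.listing hF.isSubtree.sub) .nil)
  · rw [hlog, List.map_append, ← List.cons_append]
    -- The time since the previous output is at most `A`, plus 2 for the loop test, the cost of
    -- `pop`, and 1 for `endLine`.
    refine List.isChain_append.2 ⟨h.delay, by simp, fun t ht t' ht' => ?_⟩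
    have := h.last t ht
    simp at ht'
    omega
  · intro t ht
    rw [hlog, List.map_append, ← List.cons_append, List.map_singleton, List.getLast?_concat] at ht
    obtain rfl : s₁.time + 1 = t := by simpa using ht
    have : s₂.time ≤ s₁.time + 1 + 10000 * (800 * (n * L.length ^ 2 * G.maxDegree)) := t2
    omega

/-- Each round prints a new edge set, and there are finitely many; `k` bounds the number of those
not yet printed. For `k = 0` another round would give a list without repetitions that is too long.
-/
theorem Progress.exec_loop (hI : IsInput G L) (hB : 10000 * bound L < B)
    (hA : 10000 * (800 * (n * L.length ^ 2 * G.maxDegree)) ≤ A)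
    (hD : A + 10000 * (20 * L.length) + 3 ≤ D) (k : ℕ) :
    ∀ {done s σ}, Progress G L A D done s σ →
      Fintype.card (Finset (Sym2 (Fin n))) ≤ done.length + k →
      ∃ final, Exec B (.loop (.reg 2) body) s final ∧ EnumeratesMinimalCEDS G L final ∧
        final.DelayAtMost D := by
  have fits : ∀ {done s σ}, Progress G L A D done s σ → (Expr.reg 2).Fits B s := by
    intro done s σ h
    change s.reg Reg.top.idx < B
    rw [h.rep.reg]
    have := h.bdd.2.1 .top
    omega
  have halts : ∀ {done s σ}, Progress G L A D done s σ → σ.reg .top = 0 →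
      ∃ final, Exec B (.loop (.reg 2) body) s final ∧ EnumeratesMinimalCEDS G L final ∧
        final.DelayAtMost D := by
    intro done s σ h h0
    obtain ⟨h1, h2⟩ := h.mem_iff hI h0
    refine ⟨_, .loop_false (fits h) ((h.rep.reg .top).trans h0), ⟨h.rep.line.trans h.line, done, h1, h2,
      h.printed⟩, ?_⟩
    rw [Config.DelayAtMost, ← List.cons_append]
    refine List.isChain_append.2 ⟨h.delay, by simp, fun t ht t' ht' => ?_⟩
    have := h.last t ht
    simp [Config.tick, Expr.cost] at ht'
    omega
  induction k with
  | zero =>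
    intro done s σ h hk
    refine halts h ?_
    by_contra h0
    obtain ⟨F, s', τ, hF, -, h'⟩ := h.step hI h0 hB hA hD
    obtain ⟨l, hl⟩ := h'.search
    have := (List.nodup_append.1 hl.nodup).1.length_le_card
    simp only [List.length_append, List.length_singleton] at this
    omega
  | succ k ih =>
    intro done s σ h hk
    by_cases h0 : σ.reg .top = 0
    · exact halts h h0
    obtain ⟨F, s', τ, -, hx, h'⟩ := h.step hI h0 hB hA hD
    obtain ⟨final, h1, h2⟩ := ih h' (by rw [List.length_append, List.length_singleton]; omega)
    exact ⟨final, .loop_true (fits h) (fun h => h0 ((‹Progress G L A D done s σ›.rep.reg .top).symm.trans h))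
      hx h1, h2⟩

/-- The abstract state in which the number of edges has been read. -/
def initial (L : List (Fin n × Fin n)) : Store where
  reg := fun r => if r = .M then L.length else 0
  arr := fun a i => if a = .inp then (graphInput L).getD i 0 else 0
  line := []
  clk := 0

/-- The three time units are the cost of the first assignment, which fetches `m` from address 1 into
register 0, on which all array addresses depend. -/
theorem represents_initial (hI : IsInput G L) :
    Represents L.length (((Config.init (graphInput L)).setReg 0 L.length).tick 3) (initial L) where
  reg r := by cases r <;> rfl
  arr a ha i := by
    have hm := hI.pos
    have hl := length_graphInput L
    simp only [initial, if_neg ha]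
    exact List.getD_eq_default _ _ (by omega)
  inp i _ := rfl
  line := rfl
  size := rfl

theorem bounded_initial (hI : IsInput G L) : (initial L).Bounded (bound L) := by
  have hb := le_bound L
  have hn := hI.le_two_mul
  refine ⟨by omega, fun r => ?_, fun a i => ?_⟩
  · simp only [initial]
    split_ifs <;> omega
  · have := graphInput_getD_le L i
    simp only [initial]
    split_ifs <;> omega

theorem exec_program (hI : IsInput G L) :
    ∃ final, Exec (2 ^ (10000000 * L.length)) program (Config.init (graphInput L)) final ∧
      EnumeratesMinimalCEDS G L final ∧
      final.DelayAtMost (10000000 * (n * L.length ^ 2 * G.maxDegree)) := by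
  have hm := hI.pos
  have hD1 := one_le_maxDegree hI
  have hn0 : 0 < n := Nat.pos_of_ne_zero (NeZero.ne n)
  have e1 : n * (L.length * L.length) * G.maxDegree = n * L.length ^ 2 * G.maxDegree := by ring
  have e2 : 1 * (L.length * 1) * 1 ≤ n * (L.length * L.length) * G.maxDegree :=
    Nat.mul_le_mul (Nat.mul_le_mul hn0 (Nat.mul_le_mul_left _ hm)) hD1
  have e3 : n * (L.length * 1) * 1 ≤ n * (L.length * L.length) * G.maxDegree :=
    Nat.mul_le_mul (Nat.mul_le_mul_left _ (Nat.mul_le_mul_left _ hm)) hD1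
  rw [mul_one, mul_one] at e3
  -- Since `10000 < 2 ^ 14`, the left side is below `2 ^ (m + 17)`.
  have hlt : 10000 * bound L < 2 ^ (10000000 * L.length) := by
    have h1 : 10000 * bound L < 2 ^ 14 * bound L :=
      Nat.mul_lt_mul_of_pos_right (by norm_num) (by rw [bound]; positivity)
    refine h1.trans_le ?_
    rw [bound, ← pow_add]
    exact Nat.pow_le_pow_right (by norm_num) (by omega)
  have hb := le_bound L
  obtain ⟨s, σ, x, r, b, S, ⟨p1, p2, p3, p4⟩, g, t⟩ := (prepare_spec hI (σ := initial L)
    ⟨rfl, rfl, fun i hi => (graphInput_getD L hi).1, fun i hi => (graphInput_getD L hi).2⟩ rfl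
    (fun _ => rfl)).exec hm (W := 10000) (by norm_num) hlt wf_program.1 (fun _ h => h.2.2.2)
    (represents_initial hI) (bounded_initial hI)
  have ht : s.time ≤ 3 + 10000 * (250 * (n * L.length)) := by
    simpa [Config.tick, Config.setReg, Config.init] using t
  have hg : s.log = [] := g
  -- The moves take at most 8000000 units of `n * m ^ 2 * Δ`, printing at most 200000 units of `m`,
  -- and three more steps; together this is below 10000000. The preparation, with 2500000 units of
  -- `n * m` and three steps, fits into the share of the moves.
  obtain ⟨final, h1, h2⟩ := Progress.exec_loop (s := s) (σ := σ) (done := []) hI hlt le_rfl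
    (D := 10000000 * (n * L.length ^ 2 * G.maxDegree)) (by omega) _
    ⟨r, b, p1, p2, p3, by simp, S.2.2 rfl, by simp [hg], by simp [hg], by simp [hg]; omega⟩
    (Nat.le_add_left _ _)
  refine ⟨final, .seq (.assign _ 0 _ ⟨?_, ?_⟩) (.seq x h1), h2⟩
  · change 1 < _
    omega
  · change L.length < _
    omega

end RAM

theorem mainTheorem2 :
    ∃ (prog : RAM.Cmd) (C : ℕ),
      ∀ (n : ℕ) (G : SimpleGraph (Fin n)) [DecidableRel G.Adj] (L : List (Fin n × Fin n)),
        G.Connected → IsEdgeListing G L →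
        (∀ F : Finset (Sym2 (Fin n)), IsCEDS G F → 2 ≤ F.card) →
        ∃ final : RAM.Config,
          RAM.Exec (2 ^ (C * L.length)) prog (RAM.Config.init (graphInput L)) final ∧
          EnumeratesMinimalCEDS G L final ∧
          final.DelayAtMost (C * (n * L.length ^ 2 * G.maxDegree)) := by
  refine ⟨RAM.program, 10000000, fun n G _ L hc hL h2 => ?_⟩
  obtain ⟨v⟩ := hc.nonempty
  have : NeZero n := ⟨fun h => (h ▸ v).elim0⟩
  exact RAM.exec_program ⟨hL, hc, h2⟩
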